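/- **Conventions.** Manifolds are finite-dimensional smooth manifolds without boundary (all components of the same dimension), not necessarily Hausdorff or second countable; maps on open subsets, submanifolds and fibre products along submersions are smooth in the usual sense. A Lie groupoid $\mathcal G\rightrightarrows X_{\mathcal G}$ has surjective submersions $s,t:\mathcal G\to X_{\mathcal G}$ as source and target; the product $gh$ is defined when $s(g)=t(h)$; multiplication, units $\mathbf 1_x$ and inversion are smooth. A Lie group is viewed as a Lie groupoid over a point. A *right principal $\mathcal H$-bundle* over $M$ is a manifold $P$ with a surjective submersion $\pi:P\to M$, a smooth momentum $\varepsilon:P\to X_{\mathcal H}$ and a smooth right action $(p,h)\mapsto ph$ of $\mathcal H$ (defined for $\varepsilon(p)=t(h)$, with $\varepsilon(ph)=s(h)$, $\pi(ph)=\pi(p)$) such that $(p,h)\mapsto(p,ph)$ is a diffeomorphism $P\times_{\varepsilon,t}\mathcal H\to P\times_MP$. Left principal bundles are defined symmetrically. A *generalized morphism* $P:\mathcal G\to\mathcal H$ is a right principal $\mathcal H$-bundle $\pi:P\to X_{\mathcal G}$ with momentum $\varepsilon:P\to X_{\mathcal H}$ and a smooth left $\mathcal G$-action on $P$ with momentum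 $\pi$ which leaves $\varepsilon$ invariant and commutes with the right action. It is a *Morita equivalence* if in addition $\varepsilon:P\to X_{\mathcal H}$ is a left principal $\mathcal G$-bundle with momentum $\pi$. **Local generalized morphisms.** *Local trivializing data* over $M$ with values in $\mathcal H$ consist of an open cover $(U_\alpha)$ of $M$, smooth maps $\varepsilon_\alpha:U_\alpha\to X_{\mathcal H}$ and smooth maps $\Phi_{\alpha\beta}:U_\alpha\cap U_\beta\to\mathcal H$ with $t\circ\Phi_{\alpha\beta}=\varepsilon_\alpha$, $s\circ\Phi_{\alpha\beta}=\varepsilon_\beta$, $\Phi_{\alpha\alpha}(x)=\mathbf 1_{\varepsilon_\alpha(x)}$ and $\Phi_{\alpha\gamma}=\Phi_{\alpha\beta}\Phi_{\beta\gamma}$ on triple intersections. A *local generalized morphism* $\Theta:\mathcal G\to\mathcal H$ subordinate to such data over $M=X_{\mathcal G}$ is a family of smooth maps $\Theta_{\beta\alpha}:\mathcal G_{\alpha,\beta}=\{g: s(g)\in U_\alpha,\ t(g)\in U_\beta\}\to\mathcal H$ with $s(\Theta_{\beta\alpha}(g))=\varepsilon_\alpha(s(g))$, $t(\Theta_{\beta\alpha}(g))=\varepsilon_\beta(t(g))$,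 $\Theta_{\alpha\alpha}(\mathbf 1_x)=\mathbf 1_{\varepsilon_\alpha(x)}$, $\Theta_{\gamma\alpha}(g_1g_2)=\Theta_{\gamma\beta}(g_1)\Theta_{\beta\alpha}(g_2)$ whenever these are defined, and $$\Theta_{\beta\alpha}(g)=\Phi_{\beta\delta}(t(g))\,\Theta_{\delta\gamma}(g)\,\Phi_{\gamma\alpha}(s(g))\qquad\text{if } s(g)\in U_\alpha\cap U_\gamma,\ t(g)\in U_\beta\cap U_\delta .$$ **The associated generalized morphism.** Given $\Theta$, let $P_\Theta$ be the disjoint union of the sets $\{(x,h): x\in U_\alpha,\ \varepsilon_\alpha(x)=t(h)\}$, modulo $(\alpha,x,h)\sim(\beta,x,h')$ if $h=\Phi_{\alpha\beta}(x)h'$, with $\pi[\alpha,x,h]=x$, $\varepsilon[\alpha,x,h]=s(h)$, right action $[\alpha,x,h]k=[\alpha,x,hk]$ for $s(h)=t(k)$, and left action $g[\alpha,x,h]=[\beta,t(g),\Theta_{\beta\alpha}(g)h]$ for $s(g)=x$ and any $\beta$ with $t(g)\in U_\beta$. Its smooth structure is the one for which the sets $\pi^{-1}(U_\alpha)$ are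 open and the canonical bijections $(x,h)\mapsto[\alpha,x,h]$ onto them are diffeomorphisms. **Composition and local Morita equivalence.** Let $\Theta:\mathcal G\to\mathcal H$ be subordinate to $(U_\alpha,\varepsilon_\alpha,\Phi_{\alpha\beta})$ over $X_{\mathcal G}$ and $\mathrm H:\mathcal H\to\mathcal G$ subordinate to $(V_i,\pi_i,\Psi_{ij})$ over $X_{\mathcal H}$. A matched refinement is an open cover $(U_{\alpha i})$ of $X_{\mathcal G}$ with $U_{\alpha i}\subset U_\alpha$ and $\varepsilon_\alpha(U_{\alpha i})\subset V_i$. Over it, $\mathrm H\circ\Theta$ is the local generalized morphism $\mathcal G\to\mathcal G$ with components $(\mathrm H\circ\Theta)_{\beta j,\alpha i}=\mathrm H_{ji}\circ\Theta_{\beta\alpha}$, local momenta $\pi_i\circ\varepsilon_\alpha$ and cocycle $\Phi^{\mathrm H\circ\Theta}_{\alpha i,\beta j}=\mathrm H_{ij}\circ\Phi_{\alpha\beta}$. Symmetrically, one has $\Theta\circ\mathrm H$ over an open cover $(V_{i\alpha})$ of $X_{\mathcal H}$ with $V_{i\alpha}\subset V_i$, $\pi_i(V_{i\alpha})\subset U_\alpha$.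 A *local Morita equivalence* between $\Theta$ and $\mathrm H$ consists of matched refinements $(U_{\alpha i})$ and $(V_{i\alpha})$ and families of smooth maps $\Phi^\Theta_{\alpha i}:U_{\alpha i}\to\mathcal G$ and $\Phi^{\mathrm H}_{i\alpha}:V_{i\alpha}\to\mathcal H$ such that, wherever both sides are defined, (a) $t\circ\Phi^\Theta_{\alpha i}=\mathrm{id}$ and $s\circ\Phi^\Theta_{\alpha i}=\pi_i\circ\varepsilon_\alpha$; (b) $\Phi^\Theta_{\alpha i}(x)=\Phi^\Theta_{\beta j}(x)\,\Phi^{\mathrm H\circ\Theta}_{\beta j,\alpha i}(x)$ for $x\in U_{\alpha i}\cap U_{\beta j}$; (c) $(\mathrm H\circ\Theta)_{\beta j,\alpha i}(g)=\Phi^\Theta_{\beta j}(t(g))^{-1}\,g\,\Phi^\Theta_{\alpha i}(s(g))$ for $s(g)\in U_{\alpha i}$, $t(g)\in U_{\beta j}$; and the same three conditions hold for $\Phi^{\mathrm H}$, with the roles of $(\mathcal G,\Theta)$ and $(\mathcal H,\mathrm H)$ exchanged. (That is, $\mathrm H\circ\Theta$ and $\Theta\circ\mathrm H$ are cohomologous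 to the identity morphisms.) $\mathcal G$ and $\mathcal H$ are *locally Morita equivalent* if such $\Theta$, $\mathrm H$ and such an equivalence exist. **Theorem.** (1) Let $\Theta:\mathcal G\to\mathcal H$ and $\mathrm H:\mathcal H\to\mathcal G$ be local generalized morphisms with a local Morita equivalence between them. Then the smooth structures on $P_\Theta$ and $P_{\mathrm H}$ described above exist, and $P_\Theta$ and $P_{\mathrm H}$ are Morita equivalences, from $\mathcal G$ to $\mathcal H$ and from $\mathcal H$ to $\mathcal G$ respectively. If $X_{\mathcal G}$ and $\mathcal H$ are both Hausdorff (both second countable), so is $P_\Theta$; if $X_{\mathcal H}$ and $\mathcal G$ are, so is $P_{\mathrm H}$. (2) Let $G$ be a Lie group and $\pi:P\to M$ a (right) principal $G$-bundle over a non-empty manifold $M$. Then the gauge groupoid $\mathcal G(P)=(P\times P)/G\rightrightarrows M$ exists as a Lie groupoid: its arrows form the quotient manifold of $P\times P$ by the diagonal action (the quotient map is a surjective submersion), with $t[p_1,p_2]=\pi(p_1)$, $s[p_1,p_2]=\pi(p_2)$, $\mathbf 1_{\pi(p)}=[p,p]$ and $[p_1,p_2][p_2g,p_3]=[p_1g,p_3]$.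 It is locally Morita equivalent to $G$. If $P$ and $M$ are Hausdorff, so is the manifold of arrows of $\mathcal G(P)$; if $P$ is second countable, so is it. -/

import Mathlib

open Set Function
open scoped Manifold ContDiff Topology

universe u₁ u₂ u₃ u₄ u₅ u₆ u₇ u₈ u₉

noncomputable section

/-! ## Smooth manifolds -/

/-- A smooth structure on a set: a topology together with a smooth atlas with values in some
`ℝⁿ`.  Neither the Hausdorff property nor second countability is built in; where they matter they
are stated separately. -/
structure SmoothStructure (X : Type u₁) where
  dim : ℕ
  top : TopologicalSpace X
  charted : ChartedSpace (EuclideanSpace ℝ (Fin dim)) X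
  isManifold : IsManifold (𝓡 dim) ∞ X

/-- A (finite-dimensional, real, boundaryless) smooth manifold. -/
structure Mfd where
  carrier : Type u₁
  str : SmoothStructure carrier

namespace Mfd

instance : CoeSort Mfd.{u₁} (Type u₁) := ⟨Mfd.carrier⟩

abbrev dim (M : Mfd.{u₁}) : ℕ := M.str.dim

instance (M : Mfd.{u₁}) : TopologicalSpace M := M.str.top

instance (M : Mfd.{u₁}) : ChartedSpace (EuclideanSpace ℝ (Fin M.dim)) M := M.str.charted

instance (M : Mfd.{u₁}) : IsManifold (𝓡 M.dim) ∞ M := M.str.isManifold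

/-- The one-point manifold `ℝ⁰`. -/
def point : Mfd.{0} where
  carrier := EuclideanSpace ℝ (Fin 0)
  str :=
    { dim := 0
      top := inferInstance
      charted := inferInstance
      isManifold := inferInstance }

instance : Unique point := inferInstanceAs (Unique (EuclideanSpace ℝ (Fin 0)))

end Mfd

/-- The model of the product manifold `M × N`. -/
abbrev prodModel (M : Mfd.{u₁}) (N : Mfd.{u₂}) :=
  (𝓡 M.dim).prod (𝓡 N.dim)

/-- `f` restricts to a diffeomorphism from `S` onto `T`.  This is used for subsets which are
embedded submanifolds (open subsets, fibre products along a submersion); for these, smoothness on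
the subset in the sense of `ContMDiffOn` is smoothness for the submanifold structure. -/
def IsDiffeoOn {E E' H H' M N : Type*}
    [NormedAddCommGroup E] [NormedSpace ℝ E] [TopologicalSpace H]
    [NormedAddCommGroup E'] [NormedSpace ℝ E'] [TopologicalSpace H']
    [TopologicalSpace M] [ChartedSpace H M] [TopologicalSpace N] [ChartedSpace H' N]
    (I : ModelWithCorners ℝ E H) (J : ModelWithCorners ℝ E' H')
    (f : M → N) (S : Set M) (T : Set N) : Prop :=
  MapsTo f S T ∧ ContMDiffOn I J ∞ f S ∧
    ∃ g : N → M, MapsTo g T S ∧ ContMDiffOn J I ∞ g T ∧ LeftInvOn g f S ∧ RightInvOn g f T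

/-- Surjective submersions between manifolds. -/
def IsSurjSubmersion {M : Mfd.{u₁}} {N : Mfd.{u₂}} (f : M → N) : Prop :=
  Surjective f ∧ Manifold.IsSubmersion (𝓡 M.dim) (𝓡 N.dim) ∞ f

/-! ## Lie groupoids -/

/-- A Lie groupoid with manifold of arrows `A` and manifold of objects `X`: source `s`, target `t`,
units `one`, multiplication and inversion.  The product `g h` is meaningful when `s g = t h`;
the total function `mul` is unconstrained elsewhere. -/
structure LieGroupoid (A : Mfd.{u₁}) (X : Mfd.{u₂}) where
  s : A → X
  t : A → X
  one : X → A
  mul : A → A → A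
  inv : A → A
  s_subm : IsSurjSubmersion s
  t_subm : IsSurjSubmersion t
  one_smooth : ContMDiff (𝓡 X.dim) (𝓡 A.dim) ∞ one
  mul_smooth : ContMDiffOn (prodModel A A) (𝓡 A.dim) ∞ (fun z : A × A => mul z.1 z.2)
    {z | s z.1 = t z.2}
  inv_smooth : ContMDiff (𝓡 A.dim) (𝓡 A.dim) ∞ inv
  s_one : ∀ x, s (one x) = x
  t_one : ∀ x, t (one x) = x
  s_mul : ∀ g h, s g = t h → s (mul g h) = s h
  t_mul : ∀ g h, s g = t h → t (mul g h) = t g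
  mul_assoc : ∀ g h k, s g = t h → s h = t k → mul (mul g h) k = mul g (mul h k)
  one_mul : ∀ g, mul (one (t g)) g = g
  mul_one : ∀ g, mul g (one (s g)) = g
  s_inv : ∀ g, s (inv g) = t g
  t_inv : ∀ g, t (inv g) = s g
  inv_mul : ∀ g, mul (inv g) g = one (s g)
  mul_inv : ∀ g, mul g (inv g) = one (t g)

theorem isSurjSubmersion_point (A : Mfd.{u₁}) [Nonempty A] :
    IsSurjSubmersion (fun _ : A => (default : Mfd.point)) := by
  refine ⟨fun y => ⟨Classical.arbitrary A, Subsingleton.elim _ _⟩, ?_⟩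
  refine ⟨EuclideanSpace ℝ (Fin A.dim), inferInstance, inferInstance, fun x => ?_⟩
  have : Unique (EuclideanSpace ℝ (Fin Mfd.point.dim)) :=
    inferInstanceAs (Unique (EuclideanSpace ℝ (Fin 0)))
  refine Manifold.IsSubmersionAtOfComplement.mk_of_charts
    (ContinuousLinearEquiv.uniqueProd ℝ (EuclideanSpace ℝ (Fin A.dim))
      (EuclideanSpace ℝ (Fin Mfd.point.dim))).symm
    (chartAt _ x) (chartAt _ default) (mem_chart_source _ x) (mem_chart_source _ _)
    (IsManifold.chart_mem_maximalAtlas x) (IsManifold.chart_mem_maximalAtlas _)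
    (fun y _ => mem_chart_source (EuclideanSpace ℝ (Fin Mfd.point.dim)) (default : Mfd.point)) (fun y _ => Subsingleton.elim _ _)

/-- A Lie group, viewed as a Lie groupoid over the one-point manifold. -/
def LieGroupoid.ofLieGroup (A : Mfd.{u₁}) [Group A] [LieGroup (𝓡 A.dim) ∞ A] :
    LieGroupoid A Mfd.point where
  s := fun _ => default
  t := fun _ => default
  one := fun _ => 1
  mul := fun g h => g * h
  inv := fun g => g⁻¹
  s_subm := isSurjSubmersion_point A
  t_subm := isSurjSubmersion_point A
  one_smooth := contMDiff_const
  mul_smooth := (contMDiff_mul (𝓡 A.dim) ∞).contMDiffOn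
  inv_smooth := contMDiff_inv (𝓡 A.dim) ∞
  s_one := fun _ => Subsingleton.elim _ _
  t_one := fun _ => Subsingleton.elim _ _
  s_mul := fun _ _ _ => rfl
  t_mul := fun _ _ _ => rfl
  mul_assoc := fun g h k _ _ => _root_.mul_assoc g h k
  one_mul := fun g => _root_.one_mul g
  mul_one := fun g => _root_.mul_one g
  s_inv := fun _ => rfl
  t_inv := fun _ => rfl
  inv_mul := fun g => inv_mul_cancel g
  mul_inv := fun g => mul_inv_cancel g

/-! ## Principal bundles, generalized morphisms, Morita equivalences -/

/-- A smooth right action of a Lie groupoid on `P` with momentum `ε`; `p g` is meaningful when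
`ε p = t g`. -/
structure IsRightAction {A : Mfd.{u₁}} {X : Mfd.{u₂}} (G : LieGroupoid A X) (P : Mfd.{u₃})
    (ε : P → X) (act : P → A → P) : Prop where
  mom_smooth : ContMDiff (𝓡 P.dim) (𝓡 X.dim) ∞ ε
  act_smooth : ContMDiffOn (prodModel P A) (𝓡 P.dim) ∞ (fun z : P × A => act z.1 z.2)
    {z | ε z.1 = G.t z.2}
  mom_act : ∀ p g, ε p = G.t g → ε (act p g) = G.s g
  act_one : ∀ p, act p (G.one (ε p)) = p
  act_mul : ∀ p g h, ε p = G.t g → G.s g = G.t h → act p (G.mul g h) = act (act p g) h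

/-- A smooth left action of a Lie groupoid on `P` with momentum `ε`; `g p` is meaningful when
`s g = ε p`. -/
structure IsLeftAction {A : Mfd.{u₁}} {X : Mfd.{u₂}} (G : LieGroupoid A X) (P : Mfd.{u₃})
    (ε : P → X) (act : A → P → P) : Prop where
  mom_smooth : ContMDiff (𝓡 P.dim) (𝓡 X.dim) ∞ ε
  act_smooth : ContMDiffOn (prodModel A P) (𝓡 P.dim) ∞ (fun z : A × P => act z.1 z.2)
    {z | G.s z.1 = ε z.2}
  mom_act : ∀ g p, G.s g = ε p → ε (act g p) = G.t g
  act_one : ∀ p, act (G.one (ε p)) p = p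
  act_mul : ∀ g h p, G.s g = G.t h → G.s h = ε p → act (G.mul g h) p = act g (act h p)

/-- A right principal bundle with projection `π : P → M`, structure groupoid `G` and momentum
`ε`. -/
structure IsRightPrincipal {A : Mfd.{u₁}} {X : Mfd.{u₂}} (G : LieGroupoid A X)
    (P : Mfd.{u₃}) (M : Mfd.{u₄}) (π : P → M) (ε : P → X) (act : P → A → P) : Prop where
  isAction : IsRightAction G P ε act
  proj_subm : IsSurjSubmersion π
  proj_act : ∀ p g, ε p = G.t g → π (act p g) = π p
  diffeo : IsDiffeoOn (prodModel P A) (prodModel P P) (fun z : P × A => (z.1, act z.1 z.2))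
    {z | ε z.1 = G.t z.2} {z | π z.1 = π z.2}

/-- A left principal bundle with projection `π : P → M`, structure groupoid `G` and momentum
`ε`. -/
structure IsLeftPrincipal {A : Mfd.{u₁}} {X : Mfd.{u₂}} (G : LieGroupoid A X)
    (P : Mfd.{u₃}) (M : Mfd.{u₄}) (π : P → M) (ε : P → X) (act : A → P → P) : Prop where
  isAction : IsLeftAction G P ε act
  proj_subm : IsSurjSubmersion π
  proj_act : ∀ g p, G.s g = ε p → π (act g p) = π p
  diffeo : IsDiffeoOn (prodModel A P) (prodModel P P) (fun z : A × P => (act z.1 z.2, z.2))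
    {z | G.s z.1 = ε z.2} {z | π z.1 = π z.2}

/-- A generalized (Hilsum–Skandalis) morphism from `G` to `H` with total space `P`, projection
`π`, momentum `ε`, left `G`-action `actL` and right `H`-action `actR`. -/
structure IsGeneralizedMorphism {A : Mfd.{u₁}} {X : Mfd.{u₂}} {B : Mfd.{u₃}} {Y : Mfd.{u₄}}
    (G : LieGroupoid A X) (H : LieGroupoid B Y) (P : Mfd.{u₅}) (π : P → X) (ε : P → Y)
    (actL : A → P → P) (actR : P → B → P) : Prop where
  principal : IsRightPrincipal H P X π ε actR
  leftAction : IsLeftAction G P π actL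
  mom_actL : ∀ g p, G.s g = π p → ε (actL g p) = ε p
  compatible : ∀ g p h, G.s g = π p → ε p = H.t h → actR (actL g p) h = actL g (actR p h)

/-- The generalized morphism with total space `P` is a Morita equivalence between `G` and `H`:
in addition, `ε : P → Y` is a left principal `G`-bundle with momentum `π`. -/
structure IsMoritaEquivalence {A : Mfd.{u₁}} {X : Mfd.{u₂}} {B : Mfd.{u₃}} {Y : Mfd.{u₄}}
    (G : LieGroupoid A X) (H : LieGroupoid B Y) (P : Mfd.{u₅}) (π : P → X) (ε : P → Y)
    (actL : A → P → P) (actR : P → B → P) : Prop where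
  isMorphism : IsGeneralizedMorphism G H P π ε actL actR
  leftPrincipal : IsLeftPrincipal G P Y ε π actL

/-! ## Local trivializing data and the glued bundle -/

/-- Local trivializing data over `M` with values in `H`: an open cover `U`, local momenta `mom` and
a cocycle `trans`.  The maps `mom α` and `trans α β` are only relevant on `U α` and on
`U α ∩ U β`. -/
structure TrivData (ι : Type u₁) (M : Mfd.{u₂}) {B : Mfd.{u₃}} {Y : Mfd.{u₄}}
    (H : LieGroupoid B Y) where
  U : ι → Set M
  mom : ι → M → Y
  trans : ι → ι → M → B
  isOpen_U : ∀ α, IsOpen (U α)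
  cover : ∀ x, ∃ α, x ∈ U α
  mom_smooth : ∀ α, ContMDiffOn (𝓡 M.dim) (𝓡 Y.dim) ∞ (mom α) (U α)
  trans_smooth : ∀ α β, ContMDiffOn (𝓡 M.dim) (𝓡 B.dim) ∞ (trans α β) (U α ∩ U β)
  t_trans : ∀ α β x, x ∈ U α → x ∈ U β → H.t (trans α β x) = mom α x
  s_trans : ∀ α β x, x ∈ U α → x ∈ U β → H.s (trans α β x) = mom β x
  trans_self : ∀ α x, x ∈ U α → trans α α x = H.one (mom α x)
  cocycle : ∀ α β γ x, x ∈ U α → x ∈ U β → x ∈ U γ →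
    trans α γ x = H.mul (trans α β x) (trans β γ x)

namespace TrivData

variable {ι : Type u₁} {M : Mfd.{u₂}} {B : Mfd.{u₃}} {Y : Mfd.{u₄}} {H : LieGroupoid B Y}

/-- The trivial bundle over `U α` pulled back from the unit bundle of `H` along `mom α`, as a
subset of `M × B`. -/
def trivialBundle (D : TrivData ι M H) (α : ι) : Set (M × B) :=
  {z | z.1 ∈ D.U α ∧ D.mom α z.1 = H.t z.2}

/-- The disjoint union of the trivial bundles: triples `(α, x, h)`. -/
structure PreTotal (D : TrivData ι M H) where
  idx : ι
  base : M
  arr : B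
  base_mem : base ∈ D.U idx
  mom_eq : D.mom idx base = H.t arr

/-- The gluing relation: `(α, x, h) ∼ (β, x, h')` when `h = Φ_{αβ}(x) h'`. -/
def setoid (D : TrivData ι M H) : Setoid D.PreTotal where
  r a b := a.base = b.base ∧ a.arr = H.mul (D.trans a.idx b.idx a.base) b.arr
  iseqv := by
    refine ⟨?_, ?_, ?_⟩
    · intro a
      refine ⟨rfl, ?_⟩
      rw [D.trans_self _ _ a.base_mem, a.mom_eq, H.one_mul]
    · rintro ⟨α, x, h, hx, hm⟩ ⟨β, y, k, hy, hn⟩ ⟨rfl, hr⟩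
      dsimp only at *
      refine ⟨rfl, ?_⟩
      rw [hr, ← H.mul_assoc, ← D.cocycle β α β x hy hx hy, D.trans_self β x hy, hn, H.one_mul]
      · rw [D.s_trans β α x hy hx, D.t_trans α β x hx hy]
      · rw [D.s_trans α β x hx hy, hn]
    · rintro ⟨α, x, h, hx, hm⟩ ⟨β, y, k, hy, hn⟩ ⟨γ, z, l, hz, hl⟩ ⟨rfl, hr⟩ ⟨rfl, hr'⟩
      dsimp only at *
      refine ⟨rfl, ?_⟩
      rw [hr, hr', ← H.mul_assoc, ← D.cocycle α β γ x hx hy hz]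
      · rw [D.s_trans α β x hx hy, D.t_trans β γ x hy hz]
      · rw [D.s_trans β γ x hy hz, hl]

/-- The total space of the bundle glued from local trivializing data. -/
def Total (D : TrivData ι M H) : Type (max u₁ u₂ u₃) := Quotient D.setoid

/-- The class `[α, x, h]`. -/
def cls (D : TrivData ι M H) (α : ι) (x : M) (h : B) (hx : x ∈ D.U α)
    (hm : D.mom α x = H.t h) : D.Total :=
  Quotient.mk D.setoid ⟨α, x, h, hx, hm⟩

/-- `π [α, x, h] = x`. -/
def proj (D : TrivData ι M H) : D.Total → M :=
  Quotient.lift (fun a => a.base) (fun _ _ h => h.1)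

/-- `ε [α, x, h] = s h`. -/
def momentum (D : TrivData ι M H) : D.Total → Y :=
  Quotient.lift (fun a => H.s a.arr) (by
    rintro ⟨α, x, h, hx, hm⟩ ⟨β, y, k, hy, hn⟩ ⟨rfl, hr⟩
    dsimp only at *
    rw [hr, H.s_mul]
    rw [D.s_trans α β x hx hy, hn])

open Classical in
/-- `[α, x, h] k = [α, x, h k]` when `s h = t k` (and a junk value otherwise). -/
def actR (D : TrivData ι M H) (p : D.Total) (k : B) : D.Total :=
  Quotient.lift
    (fun a : D.PreTotal =>
      if hk : H.s a.arr = H.t k then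
        D.cls a.idx a.base (H.mul a.arr k) a.base_mem (by rw [H.t_mul _ _ hk, a.mom_eq])
      else D.cls a.idx a.base a.arr a.base_mem a.mom_eq)
    (by
      rintro ⟨α, x, h, hx, hm⟩ ⟨β, y, l, hy, hn⟩ hab
      obtain ⟨rfl, hr⟩ := id hab
      dsimp only at *
      have h1 : H.s (D.trans α β x) = H.t l := by rw [D.s_trans α β x hx hy, hn]
      have h2 : H.s h = H.s l := by rw [hr, H.s_mul _ _ h1]
      by_cases hk : H.s l = H.t k
      · rw [dif_pos (h2.trans hk), dif_pos hk]
        refine Quotient.sound ⟨rfl, ?_⟩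
        dsimp only
        rw [hr, H.mul_assoc _ _ _ h1 hk]
      · rw [dif_neg (fun h => hk (h2 ▸ h)), dif_neg hk]
        exact Quotient.sound hab) p

/-- The glued space with a given smooth structure, as a manifold. -/
def total (D : TrivData ι M H) (σ : SmoothStructure D.Total) : Mfd.{max u₁ u₂ u₃} := ⟨D.Total, σ⟩

/-- The smooth structure on the glued space: the sets `π⁻¹(U_α)` are open and the canonical
bijections `(x, h) ↦ [α, x, h]` from the trivial bundles `{(x, h) | x ∈ U_α, ε_α(x) = t(h)}` onto
them are diffeomorphisms. -/
def IsGluedStructure (D : TrivData ι M H) (σ : SmoothStructure D.Total) : Prop :=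
  ∀ α, IsOpen (X := D.total σ) (D.proj ⁻¹' D.U α) ∧
    ∃ F : M × B → D.total σ,
      (∀ x h (hx : x ∈ D.U α) (hm : D.mom α x = H.t h), F (x, h) = D.cls α x h hx hm) ∧
      IsDiffeoOn (prodModel M B) (𝓡 (D.total σ).dim) F (D.trivialBundle α) (D.proj ⁻¹' D.U α)

end TrivData

/-! ## Local generalized morphisms -/

/-- A local generalized morphism from `G` to `H` subordinate to local trivializing data `D` over
the objects of `G`; `map β α` is the component `Θ_{βα}`, defined on the arrows with source in
`U α` and target in `U β`. -/
structure LocGenMor {ι : Type u₁} {A : Mfd.{u₂}} {X : Mfd.{u₃}} {B : Mfd.{u₄}} {Y : Mfd.{u₅}}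
    (G : LieGroupoid A X) {H : LieGroupoid B Y} (D : TrivData ι X H) where
  map : ι → ι → A → B
  map_smooth : ∀ α β, ContMDiffOn (𝓡 A.dim) (𝓡 B.dim) ∞ (map β α)
    {g | G.s g ∈ D.U α ∧ G.t g ∈ D.U β}
  s_map : ∀ α β g, G.s g ∈ D.U α → G.t g ∈ D.U β → H.s (map β α g) = D.mom α (G.s g)
  t_map : ∀ α β g, G.s g ∈ D.U α → G.t g ∈ D.U β → H.t (map β α g) = D.mom β (G.t g)
  map_one : ∀ α x, x ∈ D.U α → map α α (G.one x) = H.one (D.mom α x)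
  map_mul : ∀ α β γ g₁ g₂, G.s g₁ ∈ D.U β → G.t g₁ ∈ D.U γ → G.s g₂ ∈ D.U α → G.t g₂ ∈ D.U β →
    G.s g₁ = G.t g₂ → map γ α (G.mul g₁ g₂) = H.mul (map γ β g₁) (map β α g₂)
  map_trans : ∀ α β γ δ g, G.s g ∈ D.U α → G.t g ∈ D.U β → G.s g ∈ D.U γ → G.t g ∈ D.U δ →
    map β α g = H.mul (H.mul (D.trans β δ (G.t g)) (map δ γ g)) (D.trans γ α (G.s g))

namespace LocGenMor

section action

variable {ι : Type u₁} {A : Mfd.{u₂}} {X : Mfd.{u₃}} {B : Mfd.{u₄}} {Y : Mfd.{u₅}}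
  {G : LieGroupoid A X} {H : LieGroupoid B Y} {D : TrivData ι X H}

/-- `Θ_{βα}(g) = Φ_{βδ}(t g) Θ_{δα}(g)`. -/
theorem map_trans_left (Θ : LocGenMor G D) (α β δ : ι) (g : A) (hs : G.s g ∈ D.U α)
    (hβ : G.t g ∈ D.U β) (hδ : G.t g ∈ D.U δ) :
    Θ.map β α g = H.mul (D.trans β δ (G.t g)) (Θ.map δ α g) := by
  have h1 : H.s (D.trans β δ (G.t g)) = H.t (Θ.map δ α g) := by
    rw [D.s_trans _ _ _ hβ hδ, Θ.t_map _ _ _ hs hδ]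
  rw [Θ.map_trans α β α δ g hs hβ hs hδ, D.trans_self _ _ hs, ← Θ.s_map α δ g hs hδ,
    ← H.s_mul _ _ h1, H.mul_one]

/-- `Θ_{βγ}(g) Φ_{γα}(s g) = Θ_{βα}(g)`. -/
theorem map_trans_right (Θ : LocGenMor G D) (α β γ : ι) (g : A) (hα : G.s g ∈ D.U α)
    (hγ : G.s g ∈ D.U γ) (hβ : G.t g ∈ D.U β) :
    Θ.map β α g = H.mul (Θ.map β γ g) (D.trans γ α (G.s g)) := by
  rw [Θ.map_trans α β γ β g hα hβ hγ hβ, D.trans_self _ _ hβ, ← Θ.t_map γ β g hγ hβ, H.one_mul]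

open Classical in
/-- The left action `g [α, x, h] = [β, t g, Θ_{βα}(g) h]`, for `s g = x` and any `β` with
`t g ∈ U_β` (and a junk value when `s g ≠ x`); see `actL_cls`. -/
def actL (Θ : LocGenMor G D) (g : A) (p : D.Total) : D.Total :=
  Quotient.lift
    (fun a : D.PreTotal =>
      if hg : G.s g = a.base then
        D.cls (D.cover (G.t g)).choose (G.t g)
          (H.mul (Θ.map (D.cover (G.t g)).choose a.idx g) a.arr)
          (D.cover (G.t g)).choose_spec
          (by
            have hs : G.s g ∈ D.U a.idx := hg ▸ a.base_mem
            have ht := (D.cover (G.t g)).choose_spec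
            rw [H.t_mul, Θ.t_map _ _ _ hs ht]
            rw [Θ.s_map _ _ _ hs ht, hg, a.mom_eq])
      else D.cls a.idx a.base a.arr a.base_mem a.mom_eq)
    (by
      rintro ⟨α, x, h, hx, hm⟩ ⟨β, y, l, hy, hn⟩ hab
      obtain ⟨rfl, hr⟩ := id hab
      dsimp only at *
      by_cases hg : G.s g = x
      · subst hg
        rw [dif_pos rfl, dif_pos rfl]
        congr 1
        have ht := (D.cover (G.t g)).choose_spec
        rw [Θ.map_trans_right β _ α g hy hx ht, H.mul_assoc, hr]
        · rw [Θ.s_map _ _ _ hx ht, D.t_trans _ _ _ hx hy]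
        · rw [D.s_trans _ _ _ hx hy, hn]
      · rw [dif_neg hg, dif_neg hg]
        exact Quotient.sound hab) p

theorem actL_cls (Θ : LocGenMor G D) (α β : ι) (g : A) (h : B) (hs : G.s g ∈ D.U α)
    (hm : D.mom α (G.s g) = H.t h) (ht : G.t g ∈ D.U β)
    (hm' : D.mom β (G.t g) = H.t (H.mul (Θ.map β α g) h)) :
    Θ.actL g (D.cls α (G.s g) h hs hm) = D.cls β (G.t g) (H.mul (Θ.map β α g) h) ht hm' := by
  refine (dif_pos rfl).trans (Quotient.sound ⟨rfl, ?_⟩)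
  have hc := (D.cover (G.t g)).choose_spec
  dsimp only
  rw [Θ.map_trans_left α _ β g hs hc ht, H.mul_assoc]
  · rw [D.s_trans _ _ _ hc ht, Θ.t_map _ _ _ hs ht]
  · rw [Θ.s_map _ _ _ hs ht, hm]

end action

end LocGenMor

/-! ## Composition of local generalized morphisms -/

section composition

variable {ι : Type u₁} {κ : Type u₂} {C : Mfd.{u₃}} {Z : Mfd.{u₄}} {A : Mfd.{u₅}} {X : Mfd.{u₆}}
  {B : Mfd.{u₇}} {Y : Mfd.{u₈}}
  {F : LieGroupoid C Z} {G : LieGroupoid A X} {H : LieGroupoid B Y}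

/-- A refinement of the cover of `D` matched with the cover of `E` through the local momenta of
`D`: open sets `U_{αi} ⊆ U_α` covering the base with `ε_α(U_{αi}) ⊆ V_i`.  The sets
`U_α ∩ ε_α⁻¹(V_i)` form the largest such refinement. -/
structure Birefinement (D : TrivData ι Z G) (E : TrivData κ X H) where
  U : ι × κ → Set Z
  isOpen_U : ∀ a, IsOpen (U a)
  cover : ∀ x, ∃ a, x ∈ U a
  subset : ∀ a x, x ∈ U a → x ∈ D.U a.1
  mapsTo : ∀ a x, x ∈ U a → D.mom a.1 x ∈ E.U a.2

/-- The local trivializing data of the composition `Η ∘ Θ`: local momenta `ε_i ∘ ε_α` and cocycle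
`Η_{ij} ∘ Φ_{αβ}`. -/
def TrivData.comp {D : TrivData ι Z G} {E : TrivData κ X H} (R : Birefinement D E)
    (Η : LocGenMor G E) : TrivData (ι × κ) Z H where
  U := R.U
  mom a x := E.mom a.2 (D.mom a.1 x)
  trans a b x := Η.map a.2 b.2 (D.trans a.1 b.1 x)
  isOpen_U := R.isOpen_U
  cover := R.cover
  mom_smooth a := (E.mom_smooth a.2).comp ((D.mom_smooth a.1).mono (R.subset a)) (R.mapsTo a)
  trans_smooth a b := by
    refine (Η.map_smooth b.2 a.2).comp
      ((D.trans_smooth a.1 b.1).mono (fun x hx => ⟨R.subset a x hx.1, R.subset b x hx.2⟩)) ?_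
    rintro x ⟨ha, hb⟩
    refine ⟨?_, ?_⟩
    · rw [D.s_trans _ _ _ (R.subset a x ha) (R.subset b x hb)]
      exact R.mapsTo b x hb
    · rw [D.t_trans _ _ _ (R.subset a x ha) (R.subset b x hb)]
      exact R.mapsTo a x ha
  t_trans a b x ha hb := by
    have h1 := D.s_trans _ _ _ (R.subset a x ha) (R.subset b x hb)
    have h2 := D.t_trans _ _ _ (R.subset a x ha) (R.subset b x hb)
    rw [Η.t_map _ _ _ (h1 ▸ R.mapsTo b x hb) (h2 ▸ R.mapsTo a x ha), h2]
  s_trans a b x ha hb := by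
    have h1 := D.s_trans _ _ _ (R.subset a x ha) (R.subset b x hb)
    have h2 := D.t_trans _ _ _ (R.subset a x ha) (R.subset b x hb)
    rw [Η.s_map _ _ _ (h1 ▸ R.mapsTo b x hb) (h2 ▸ R.mapsTo a x ha), h1]
  trans_self a x ha := by
    rw [D.trans_self _ _ (R.subset a x ha), Η.map_one _ _ (R.mapsTo a x ha)]
  cocycle a b c x ha hb hc := by
    have h1 := D.s_trans _ _ _ (R.subset a x ha) (R.subset b x hb)
    have h2 := D.t_trans _ _ _ (R.subset a x ha) (R.subset b x hb)
    have h3 := D.s_trans _ _ _ (R.subset b x hb) (R.subset c x hc)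
    have h4 := D.t_trans _ _ _ (R.subset b x hb) (R.subset c x hc)
    rw [D.cocycle _ _ _ x (R.subset a x ha) (R.subset b x hb) (R.subset c x hc)]
    exact Η.map_mul c.2 b.2 a.2 _ _ (h1 ▸ R.mapsTo b x hb) (h2 ▸ R.mapsTo a x ha)
      (h3 ▸ R.mapsTo c x hc) (h4 ▸ R.mapsTo b x hb) (h1.trans h4.symm)

/-- The composition `Η ∘ Θ` over a matched refinement:
`(Η ∘ Θ)_{(β,j)(α,i)}(f) = Η_{ji}(Θ_{βα}(f))`. -/
def LocGenMor.comp {D : TrivData ι Z G} {E : TrivData κ X H} (R : Birefinement D E)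
    (Η : LocGenMor G E) (Θ : LocGenMor F D) : LocGenMor F (TrivData.comp R Η) where
  map b a f := Η.map b.2 a.2 (Θ.map b.1 a.1 f)
  map_smooth a b := by
    refine (Η.map_smooth a.2 b.2).comp
      ((Θ.map_smooth a.1 b.1).mono (fun f hf => ⟨R.subset a _ hf.1, R.subset b _ hf.2⟩)) ?_
    rintro f ⟨ha, hb⟩
    refine ⟨?_, ?_⟩
    · rw [Θ.s_map _ _ _ (R.subset a _ ha) (R.subset b _ hb)]
      exact R.mapsTo a _ ha
    · rw [Θ.t_map _ _ _ (R.subset a _ ha) (R.subset b _ hb)]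
      exact R.mapsTo b _ hb
  s_map a b f ha hb := by
    have h1 := Θ.s_map _ _ _ (R.subset a _ ha) (R.subset b _ hb)
    have h2 := Θ.t_map _ _ _ (R.subset a _ ha) (R.subset b _ hb)
    rw [Η.s_map _ _ _ (h1 ▸ R.mapsTo a _ ha) (h2 ▸ R.mapsTo b _ hb), h1]
    rfl
  t_map a b f ha hb := by
    have h1 := Θ.s_map _ _ _ (R.subset a _ ha) (R.subset b _ hb)
    have h2 := Θ.t_map _ _ _ (R.subset a _ ha) (R.subset b _ hb)
    rw [Η.t_map _ _ _ (h1 ▸ R.mapsTo a _ ha) (h2 ▸ R.mapsTo b _ hb), h2]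
    rfl
  map_one a x ha := by
    rw [Θ.map_one _ _ (R.subset a x ha), Η.map_one _ _ (R.mapsTo a x ha)]
    rfl
  map_mul a b c f₁ f₂ h1 h2 h3 h4 h := by
    have e1 := Θ.s_map _ _ _ (R.subset b _ h1) (R.subset c _ h2)
    have e2 := Θ.t_map _ _ _ (R.subset b _ h1) (R.subset c _ h2)
    have e3 := Θ.s_map _ _ _ (R.subset a _ h3) (R.subset b _ h4)
    have e4 := Θ.t_map _ _ _ (R.subset a _ h3) (R.subset b _ h4)
    rw [Θ.map_mul a.1 b.1 c.1 f₁ f₂ (R.subset b _ h1) (R.subset c _ h2) (R.subset a _ h3)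
      (R.subset b _ h4) h]
    exact Η.map_mul a.2 b.2 c.2 _ _ (e1 ▸ R.mapsTo b _ h1) (e2 ▸ R.mapsTo c _ h2)
      (e3 ▸ R.mapsTo a _ h3) (e4 ▸ R.mapsTo b _ h4) (by rw [e1, e4, h])
  map_trans a b c d f ha hb hc hd := by
    have a1 := R.subset a _ ha
    have b1 := R.subset b _ hb
    have c1 := R.subset c _ hc
    have d1 := R.subset d _ hd
    have a2 := R.mapsTo a _ ha
    have b2 := R.mapsTo b _ hb
    have c2 := R.mapsTo c _ hc
    have d2 := R.mapsTo d _ hd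
    have e1 := Θ.s_map _ _ f c1 d1
    have e2 := Θ.t_map _ _ f c1 d1
    have e3 := D.t_trans _ _ _ b1 d1
    have e4 := D.s_trans _ _ _ b1 d1
    have e5 := D.t_trans _ _ _ c1 a1
    have e6 := D.s_trans _ _ _ c1 a1
    have e7 := e4.trans e2.symm
    have e8 := G.s_mul _ _ e7
    have e9 := G.t_mul _ _ e7
    rw [Θ.map_trans a.1 b.1 c.1 d.1 f a1 b1 c1 d1,
      Η.map_mul a.2 c.2 b.2 _ _ (by rw [e8, e1]; exact c2) (by rw [e9, e3]; exact b2)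
        (by rw [e6]; exact a2) (by rw [e5]; exact c2) (by rw [e8, e1, e5]),
      Η.map_mul c.2 d.2 b.2 _ _ (by rw [e4]; exact d2) (by rw [e3]; exact b2)
        (by rw [e1]; exact c2) (by rw [e2]; exact d2) e7]
    rfl

end composition

/-! ## Local Morita equivalences -/

/-- A local Morita equivalence between the local generalized morphisms `Θ : G → H` and
`Η : H → G`: matched refinements of the two covers and families of smooth maps `Φ` (into `G`) and
`Ψ` (into `H`) on the sets of the refinements which exhibit `Η ∘ Θ` and `Θ ∘ Η` as cohomologous to
the identity morphisms. -/
structure LocalMoritaEquivalence {ι : Type u₁} {κ : Type u₂} {A : Mfd.{u₃}} {X : Mfd.{u₄}}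
    {B : Mfd.{u₅}} {Y : Mfd.{u₆}} {G : LieGroupoid A X} {H : LieGroupoid B Y}
    {D : TrivData ι X H} {E : TrivData κ Y G} (Θ : LocGenMor G D) (Η : LocGenMor H E) where
  R : Birefinement D E
  S : Birefinement E D
  Φ : ι × κ → X → A
  Ψ : κ × ι → Y → B
  Φ_smooth : ∀ a, ContMDiffOn (𝓡 X.dim) (𝓡 A.dim) ∞ (Φ a) (R.U a)
  Ψ_smooth : ∀ a, ContMDiffOn (𝓡 Y.dim) (𝓡 B.dim) ∞ (Ψ a) (S.U a)
  t_Φ : ∀ a x, x ∈ R.U a → G.t (Φ a x) = x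
  s_Φ : ∀ a x, x ∈ R.U a → G.s (Φ a x) = E.mom a.2 (D.mom a.1 x)
  t_Ψ : ∀ a y, y ∈ S.U a → H.t (Ψ a y) = y
  s_Ψ : ∀ a y, y ∈ S.U a → H.s (Ψ a y) = D.mom a.2 (E.mom a.1 y)
  Φ_trans : ∀ a b x, x ∈ R.U a → x ∈ R.U b →
    Φ a x = G.mul (Φ b x) ((TrivData.comp R Η).trans b a x)
  Ψ_trans : ∀ a b y, y ∈ S.U a → y ∈ S.U b →
    Ψ a y = H.mul (Ψ b y) ((TrivData.comp S Θ).trans b a y)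
  comp_eq : ∀ a b g, G.s g ∈ R.U a → G.t g ∈ R.U b →
    (LocGenMor.comp R Η Θ).map b a g = G.mul (G.mul (G.inv (Φ b (G.t g))) g) (Φ a (G.s g))
  comp_eq' : ∀ a b h, H.s h ∈ S.U a → H.t h ∈ S.U b →
    (LocGenMor.comp S Θ Η).map b a h = H.mul (H.mul (H.inv (Ψ b (H.t h))) h) (Ψ a (H.s h))

/-- `G` and `H` are locally Morita equivalent: there are local generalized morphisms `Θ : G → H`
and `Η : H → G` together with a local Morita equivalence between them. -/
def LocallyMoritaEquivalent {A : Mfd.{u₁}} {X : Mfd.{u₂}} {B : Mfd.{u₃}} {Y : Mfd.{u₄}}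
    (G : LieGroupoid A X) (H : LieGroupoid B Y) : Prop :=
  ∃ (ι : Type u₂) (κ : Type u₄) (D : TrivData ι X H) (E : TrivData κ Y G)
    (Θ : LocGenMor G D) (Η : LocGenMor H E), Nonempty (LocalMoritaEquivalence Θ Η)

/-! ## Gauge groupoids -/

/-- `K` is the gauge groupoid of the principal `A`-bundle `π : P → M` (`A` a Lie group acting by
`act`), with quotient map `q (p₁, p₂) = [p₁, p₂]`: its manifold of arrows is the quotient manifold
of `P × P` by the diagonal action, its manifold of objects is `M`, and
`t [p₁, p₂] = π p₁`, `s [p₁, p₂] = π p₂`, `one (π p) = [p, p]`,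
`[p₁, p₂] [p₂ g, p₃] = [p₁ g, p₃]`. -/
structure IsGaugeGroupoid {A : Mfd.{u₁}} [Group A] {P : Mfd.{u₂}} {M : Mfd.{u₃}} {Q : Mfd.{u₄}}
    (K : LieGroupoid Q M) (π : P → M) (act : P → A → P) (q : P × P → Q) : Prop where
  surj : Surjective q
  subm : Manifold.IsSubmersion (prodModel P P) (𝓡 Q.dim) ∞ q
  q_eq_iff : ∀ p₁ p₂ p₁' p₂', q (p₁, p₂) = q (p₁', p₂') ↔
    ∃ g : A, p₁' = act p₁ g ∧ p₂' = act p₂ g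
  t_q : ∀ p₁ p₂, K.t (q (p₁, p₂)) = π p₁
  s_q : ∀ p₁ p₂, K.s (q (p₁, p₂)) = π p₂
  one_q : ∀ p, K.one (π p) = q (p, p)
  mul_q : ∀ p₁ p₂ p₃ (g : A), K.mul (q (p₁, p₂)) (q (act p₂ g, p₃)) = q (act p₁ g, p₃)

end

noncomputable section

/-! ## Submersions and local sections -/

/-! Two general tools carry the proof. A submersion, defined by a normal form in charts, is the same
as a smooth map with a smooth local section through every point
(`Manifold.IsSubmersionAt.exists_localSection`, `isSubmersion_of_sections`), so claims about
submersions become constructions of sections. A smooth structure can be glued from bijections with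
locally Euclidean subsets of a manifold as soon as overlaps are relatively open and transitions
smooth (`exists_smoothStructure_of_gluing`); no separation axiom enters.

Part (1). The pieces of `P_Θ` are the fibre products of `ε_α` with the submersion `t`, and the
transitions are left multiplications by the cocycle. Reading off the fibre coordinate `h` of `[α, x,
h]` turns the axioms of both actions, and right principality, into identities between arrows. Only
left principality needs the local Morita equivalence. The map `[α, x, h] ↦ [j, s h, Η_{ji}(h⁻¹)
Φ_{αi}(x)⁻¹]` from `P_Θ` to `P_Η` (`flip`) exchanges projection and momentum and converts left
actions into right actions by inverses, and conversely. Condition (b) makes it well defined,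
condition (c) makes it equivariant for `G`, and multiplicativity of `Η` makes it equivariant for
`H`. The symmetric data give a flip back. The two flips need not be mutually inverse, but their
composites are equivariant and preserve fibres, which for principal bundles forces bijectivity. The
right principal `G`-structure of `P_Η` is thus carried over to `P_Θ`
(`isLeftPrincipal_of_equivariant`).

Part (2). Over a set `V` with a local section `σ` of `π`, a class with source in `V` has exactly one
representative of the form `(p, σ y)`, so the quotient is locally `V × P` and the gluing tool
applies. An arrow is sent to the group element comparing it with local sections at its two ends, and
`a ↦ [p₀ a, p₀]` goes back by identifying the group with the isotropy group at `π p₀`. The arrows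
`[σ_α x, p₀]` and the elements `div p₀ (σ_α (π p₀))` make both composites cohomologous to the
identity. -/

theorem exists_openPartialHomeomorph_of_hasFDerivAt {E : Type*} [NormedAddCommGroup E]
    [NormedSpace ℝ E] [CompleteSpace E] {G : E → E} {U : Set E} {a : E} (hU : IsOpen U)
    (ha : a ∈ U) (hG : ContDiffOn ℝ ∞ G U) {L : E ≃L[ℝ] E}
    (hL : HasFDerivAt G (L : E →L[ℝ] E) a) :
    ∃ e : OpenPartialHomeomorph E E, a ∈ e.source ∧ e.source ⊆ U ∧ (∀ z, e z = G z) ∧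
      ContDiffOn ℝ ∞ e.symm e.target := by
  have hGa : ContDiffAt ℝ ∞ G a := hG.contDiffAt (hU.mem_nhds ha)
  let e₀ := hGa.toOpenPartialHomeomorph G hL (by simp)
  have hcont : ContinuousOn (fderiv ℝ G) U :=
    hG.continuousOn_fderiv_of_isOpen hU (by simp)
  -- Smoothness of the inverse is checked point by point and needs an invertible derivative at each
  -- point; the source is therefore cut down to the open set where the derivative of `G` is
  -- invertible.
  have hS : IsOpen (U ∩ fderiv ℝ G ⁻¹' range ((↑) : (E ≃L[ℝ] E) → E →L[ℝ] E)) :=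
    hcont.isOpen_inter_preimage hU ContinuousLinearEquiv.isOpen
  refine ⟨e₀.restrOpen _ hS, ⟨?_, ha, L, hL.fderiv.symm⟩, fun z hz => hz.2.1, fun z => rfl, ?_⟩
  · exact hGa.mem_toOpenPartialHomeomorph_source hL (by simp)
  · intro y hy
    have hy' := (e₀.restrOpen _ hS).map_target hy
    obtain ⟨-, hyU, L', hL'⟩ := hy'
    refine ((e₀.restrOpen _ hS).contDiffAt_symm (f₀' := L') hy ?_ ?_).contDiffWithinAt
    · rw [hL']
      exact ((hG.contDiffAt (hU.mem_nhds hyU)).differentiableAt (by simp)).hasFDerivAt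
    · exact hG.contDiffAt (hU.mem_nhds hyU)

/-- Pair `T` with the projection onto its kernel along a complement. The kernel is replaced by a
standard Euclidean space depending only on dimensions, because `Manifold.IsSubmersion` demands one
complement common to all points. -/
theorem ContinuousLinearMap.exists_equiv_prod_of_surjective {E E' : Type*} [NormedAddCommGroup E]
    [NormedSpace ℝ E] [FiniteDimensional ℝ E] [NormedAddCommGroup E'] [NormedSpace ℝ E']
    [FiniteDimensional ℝ E'] (T : E →L[ℝ] E') (hT : Surjective T) :
    ∃ L : E ≃L[ℝ] E' × EuclideanSpace ℝ (Fin (Module.finrank ℝ E - Module.finrank ℝ E')),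
      ∀ v, (L v).1 = T v := by
  obtain ⟨K, hK⟩ := (LinearMap.ker (T : E →ₗ[ℝ] E')).exists_isCompl
  let L₀ : E ≃ₗ[ℝ] E' × LinearMap.ker (T : E →ₗ[ℝ] E') :=
    LinearMap.equivProdOfSurjectiveOfIsCompl (T : E →ₗ[ℝ] E')
      (Submodule.projectionOnto _ _ hK)
      (LinearMap.range_eq_top.2 hT) (Submodule.range_projectionOnto hK)
      (by rw [Submodule.ker_projectionOnto]; exact hK)
  have hfin : Module.finrank ℝ (LinearMap.ker (T : E →ₗ[ℝ] E')) =
      Module.finrank ℝ (EuclideanSpace ℝ (Fin (Module.finrank ℝ E - Module.finrank ℝ E'))) := by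
    have := L₀.finrank_eq
    rw [Module.finrank_prod] at this
    rw [finrank_euclideanSpace_fin]
    omega
  let L₁ := LinearEquiv.ofFinrankEq _ _ hfin
  exact ⟨(L₀.trans ((LinearEquiv.refl ℝ E').prodCongr L₁)).toContinuousLinearEquiv, fun v => rfl⟩

section

variable {E E' : Type} [NormedAddCommGroup E] [NormedSpace ℝ E] [NormedAddCommGroup E']
  [NormedSpace ℝ E'] {H H' M N : Type*} [TopologicalSpace H] [TopologicalSpace H']
  {I : ModelWithCorners ℝ E H} {J : ModelWithCorners ℝ E' H'} [I.Boundaryless]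
  [TopologicalSpace M] [ChartedSpace H M] [TopologicalSpace N] [ChartedSpace H' N]

/-- In the normal form `f` is a linear projection, so a section is obtained by keeping the
complementary coordinate frozen at its value at `x`. -/
theorem Manifold.IsSubmersionAt.exists_localSection {f : M → N} {x : M}
    (h : Manifold.IsSubmersionAt I J ∞ f x) :
    ∃ U : Set N, IsOpen U ∧ f x ∈ U ∧ ∃ σ : N → M, ContMDiffOn J I ∞ σ U ∧ σ (f x) = x ∧
      ∀ y ∈ U, f (σ y) = y := by
  have hx : x ∈ (h.domChart.extend I).source := by
    rw [OpenPartialHomeomorph.extend_source]; exact h.mem_domChart_source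
  have hfx : f x ∈ (h.codChart.extend J).source := by
    rw [OpenPartialHomeomorph.extend_source]; exact h.mem_codChart_source
  let m : N → E := fun y => h.equiv.symm (h.codChart.extend J y, (h.equiv (h.domChart.extend I x)).2)
  have hm : ContMDiffOn J 𝓘(ℝ, E) ∞ m h.codChart.source := by
    have h1 := h.codChart.contMDiffOn_extend h.codChart_mem_maximalAtlas
    have h2 : ContDiff ℝ ∞ (fun v : E' => h.equiv.symm (v, (h.equiv (h.domChart.extend I x)).2)) :=
      h.equiv.symm.contDiff.comp (contDiff_id.prodMk contDiff_const)
    exact h2.contMDiff.comp_contMDiffOn h1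
  have hO : IsOpen (h.codChart.source ∩ m ⁻¹' (h.domChart.extend I).target) :=
    hm.continuousOn.isOpen_inter_preimage h.codChart.open_source
      h.domChart.isOpen_extend_target
  have hmx : m (f x) = h.domChart.extend I x := by
    have := h.writtenInCharts ((h.domChart.extend I).map_source hx)
    simp only [comp_apply, (h.domChart.extend I).left_inv hx] at this
    simp only [m, this, Prod.mk.eta, ContinuousLinearEquiv.symm_apply_apply]
  have himg : (h.domChart.extend I).target = I '' h.domChart.target := by
    rw [h.domChart.extend_target']
  refine ⟨_, hO, ⟨h.mem_codChart_source, ?_⟩, fun y => (h.domChart.extend I).symm (m y), ?_, ?_, ?_⟩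
  · rw [mem_preimage, hmx]
    exact (h.domChart.extend I).map_source hx
  · exact (contMDiffOn_extend_symm h.domChart_mem_maximalAtlas).comp (hm.mono inter_subset_left)
      (fun y hy => himg ▸ hy.2)
  · simp only [hmx, (h.domChart.extend I).left_inv hx]
  · rintro y ⟨hy, hy'⟩
    have h1 := h.writtenInCharts hy'
    have h2 : f ((h.domChart.extend I).symm (m y)) ∈ h.codChart.source := by
      apply h.source_subset_preimage_source
      have := (h.domChart.extend I).map_target hy'
      rwa [OpenPartialHomeomorph.extend_source] at this
    have h3 : (h.equiv (m y)).1 = h.codChart.extend J y := by simp [m]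
    rw [comp_apply, comp_apply, comp_apply, h3] at h1
    refine (h.codChart.extend J).injOn ?_ ?_ h1 <;>
      rwa [OpenPartialHomeomorph.extend_source]

/-- Without boundary the model map is a homeomorphism onto the vector space, so charts may be taken
with values there, where the inverse function theorem lives. -/
theorem contMDiffOn_trans_toHomeomorph {e : OpenPartialHomeomorph M H}
    (he : e ∈ IsManifold.maximalAtlas I ∞ M) :
    ContMDiffOn I 𝓘(ℝ, E) ∞ (e.trans I.toHomeomorph.toOpenPartialHomeomorph)
      (e.trans I.toHomeomorph.toOpenPartialHomeomorph).source :=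
  (e.contMDiffOn_extend he).mono (by simp)

theorem contMDiffOn_trans_toHomeomorph_symm {e : OpenPartialHomeomorph M H}
    (he : e ∈ IsManifold.maximalAtlas I ∞ M) :
    ContMDiffOn 𝓘(ℝ, E) I ∞ (e.trans I.toHomeomorph.toOpenPartialHomeomorph).symm
      (e.trans I.toHomeomorph.toOpenPartialHomeomorph).target := by
  refine (contMDiffOn_extend_symm he).mono fun z hz => ?_
  rw [OpenPartialHomeomorph.trans_target] at hz
  exact ⟨I.symm z, hz.2, I.right_inv (by simp [I.range_eq_univ])⟩

variable [J.Boundaryless]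

/-- Differentiating `f ∘ σ = id` at `f x` shows that the derivative of `f` at `x` is surjective; the
inverse function theorem then straightens `f` into a projection by changing only the chart of the
source. -/
theorem isSubmersionAtOfComplement_of_section [FiniteDimensional ℝ E] [FiniteDimensional ℝ E']
    [IsManifold I ∞ M] [IsManifold J ∞ N]
    {f : M → N} (hf : ContMDiff I J ∞ f) (x : M) {σ : N → M} (hσ : ContMDiffAt J I ∞ σ (f x))
    (hσx : σ (f x) = x) (hfσ : ∀ᶠ y in 𝓝 (f x), f (σ y) = y) :
    Manifold.IsSubmersionAtOfComplement
      (EuclideanSpace ℝ (Fin (Module.finrank ℝ E - Module.finrank ℝ E'))) I J ∞ f x := by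
  let φ := (chartAt H x).trans I.toHomeomorph.toOpenPartialHomeomorph
  let χ := (chartAt H' (f x)).trans J.toHomeomorph.toOpenPartialHomeomorph
  have hφ : ContMDiffOn I 𝓘(ℝ, E) ∞ φ φ.source :=
    contMDiffOn_trans_toHomeomorph (IsManifold.chart_mem_maximalAtlas x)
  have hφ' : ContMDiffOn 𝓘(ℝ, E) I ∞ φ.symm φ.target :=
    contMDiffOn_trans_toHomeomorph_symm (IsManifold.chart_mem_maximalAtlas x)
  have hχ : ContMDiffOn J 𝓘(ℝ, E') ∞ χ χ.source :=
    contMDiffOn_trans_toHomeomorph (IsManifold.chart_mem_maximalAtlas (f x))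
  have hχ' : ContMDiffOn 𝓘(ℝ, E') J ∞ χ.symm χ.target :=
    contMDiffOn_trans_toHomeomorph_symm (IsManifold.chart_mem_maximalAtlas (f x))
  have hx : x ∈ φ.source := by simp [φ]
  have hfx : f x ∈ χ.source := by simp [χ]
  let U : Set E := φ.target ∩ φ.symm ⁻¹' (f ⁻¹' χ.source)
  have hU : IsOpen U := φ.continuousOn_symm.isOpen_inter_preimage φ.open_target
    (χ.open_source.preimage hf.continuous)
  have hxU : φ x ∈ U := ⟨φ.map_source hx, by simpa [φ.left_inv hx] using hfx⟩
  let fh : E → E' := fun z => χ (f (φ.symm z))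
  have hfh : ContDiffOn ℝ ∞ fh U := by
    rw [← contMDiffOn_iff_contDiffOn]
    exact hχ.comp (hf.comp_contMDiffOn (hφ'.mono inter_subset_left)) (fun z hz => hz.2)
  let sh : E' → E := fun y => φ (σ (χ.symm y))
  have hsh : ContMDiffAt 𝓘(ℝ, E') 𝓘(ℝ, E) ∞ sh (χ (f x)) := by
    have h1 : ContMDiffAt 𝓘(ℝ, E') J ∞ χ.symm (χ (f x)) :=
      hχ'.contMDiffAt (χ.open_target.mem_nhds (χ.map_source hfx))
    have h2 : ContMDiffAt J I ∞ σ (χ.symm (χ (f x))) := by rwa [χ.left_inv hfx]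
    have h3 : ContMDiffAt I 𝓘(ℝ, E) ∞ φ (σ (χ.symm (χ (f x)))) := by
      rw [χ.left_inv hfx, hσx]
      exact hφ.contMDiffAt (φ.open_source.mem_nhds hx)
    exact h3.comp (χ (f x)) (h2.comp (χ (f x)) h1)
  have hshx : sh (χ (f x)) = φ x := by simp only [sh]; rw [χ.left_inv hfx, hσx]
  have hD : DifferentiableAt ℝ fh (φ x) :=
    (hfh.contDiffAt (hU.mem_nhds hxU)).differentiableAt (by simp)
  have hDs : DifferentiableAt ℝ sh (χ (f x)) := hsh.contDiffAt.differentiableAt (by simp)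
  have hcomp : fh ∘ sh =ᶠ[𝓝 (χ (f x))] id := by
    have h1 : ContinuousAt χ.symm (χ (f x)) :=
      χ.continuousAt_symm (χ.map_source hfx)
    have h1' : Filter.Tendsto χ.symm (𝓝 (χ (f x))) (𝓝 (f x)) := by
      have := h1.tendsto
      rwa [χ.left_inv hfx] at this
    have h2 : ∀ᶠ y in 𝓝 (f x), σ y ∈ φ.source :=
      hσ.continuousAt.eventually (by rw [hσx]; exact φ.open_source.mem_nhds hx)
    filter_upwards [h1'.eventually h2, h1'.eventually hfσ,
      χ.open_target.mem_nhds (χ.map_source hfx)] with y hy1 hy2 hy3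
    simp only [comp_apply, fh, sh, id]
    rw [φ.left_inv hy1, hy2, χ.right_inv hy3]
  have hsurj : Surjective (fderiv ℝ fh (φ x)) := by
    have h1 : HasFDerivAt (fh ∘ sh) ((fderiv ℝ fh (φ x)).comp (fderiv ℝ sh (χ (f x))))
        (χ (f x)) := by
      refine HasFDerivAt.comp _ ?_ hDs.hasFDerivAt
      rw [hshx]; exact hD.hasFDerivAt
    have h2 := h1.unique ((hasFDerivAt_id (𝕜 := ℝ) (χ (f x))).congr_of_eventuallyEq hcomp)
    intro v
    exact ⟨fderiv ℝ sh (χ (f x)) v, by simpa using DFunLike.congr_fun h2 v⟩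
  obtain ⟨L, hL⟩ := (fderiv ℝ fh (φ x)).exists_equiv_prod_of_surjective hsurj
  -- The straightening map: its first coordinate under `L` is `f` in charts, its second is
  -- unchanged. Since `L` lifts the derivative of `fh`, the derivative of `G` at `φ x` is the
  -- identity.
  let G : E → E := fun z => L.symm (fh z, (L z).2)
  have hG : ContDiffOn ℝ ∞ G U := L.symm.contDiff.comp_contDiffOn
    (hfh.prodMk ((contDiff_snd.comp L.contDiff).contDiffOn))
  have hG' : HasFDerivAt G (ContinuousLinearEquiv.refl ℝ E : E →L[ℝ] E) (φ x) := by
    have h1 : HasFDerivAt (fun z => (fh z, (L z).2)) ((fderiv ℝ fh (φ x)).prod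
        ((ContinuousLinearMap.snd ℝ E' _).comp L.toContinuousLinearMap)) (φ x) :=
      hD.hasFDerivAt.prodMk ((ContinuousLinearMap.snd ℝ E' _).comp
        L.toContinuousLinearMap).hasFDerivAt
    have h2 := L.symm.hasFDerivAt.comp (φ x) h1
    refine HasFDerivAt.congr_fderiv (f := G) h2 ?_
    ext v
    change L.symm (fderiv ℝ fh (φ x) v, (L v).2) = v
    rw [← hL, Prod.mk.eta, L.symm_apply_apply]
  obtain ⟨e, hxe, heU, heG, hes⟩ := exists_openPartialHomeomorph_of_hasFDerivAt hU hxU hG hG'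
  have hee : ContMDiffOn 𝓘(ℝ, E) 𝓘(ℝ, E) ∞ e e.source :=
    contMDiffOn_iff_contDiffOn.2 ((hG.mono heU).congr (fun z _ => heG z))
  have hes' : ContMDiffOn 𝓘(ℝ, E) 𝓘(ℝ, E) ∞ e.symm e.target := contMDiffOn_iff_contDiffOn.2 hes
  let ψ := (φ.trans e).trans I.toHomeomorph.symm.toOpenPartialHomeomorph
  have hψ : ψ ∈ IsManifold.maximalAtlas I ∞ M := by
    apply OpenPartialHomeomorph.mem_maximalAtlas_of_contMDiffOn
    · refine (I.contMDiffOn_symm (n := ∞)).comp (t := range I)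
        (hee.comp (hφ.mono ?_) ?_) (fun z _ => by simp [I.range_eq_univ]) <;>
      · intro z hz
        simp only [ψ, OpenPartialHomeomorph.trans_source] at hz
        first | exact hz.1.1 | exact hz.1.2
    · refine hφ'.comp (hes'.comp (I.contMDiff (n := ∞)).contMDiffOn ?_) ?_ <;>
      · intro z hz
        simp only [ψ, OpenPartialHomeomorph.trans_target] at hz
        first | exact hz.2.1 | exact hz.2.2
  refine .mk_of_continuousAt hf.continuous.continuousAt L ψ (chartAt H' (f x)) ?_
    (mem_chart_source H' _) hψ (IsManifold.chart_mem_maximalAtlas _) ?_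
  · simp [ψ, hx, hxe]
  · intro v hv
    have hv' : v ∈ e.target := by
      rw [OpenPartialHomeomorph.extend_target] at hv
      have h1 : I.symm v ∈ ψ.target := hv.1
      simp only [ψ, OpenPartialHomeomorph.trans_target] at h1
      have h2 : I (I.symm v) ∈ e.target := h1.2.1
      rwa [I.right_inv hv.2] at h2
    have h3 : (ψ.extend I).symm v = φ.symm (e.symm v) := by
      have : (ψ.extend I).symm v = φ.symm (e.symm (I (I.symm v))) := rfl
      rw [this, I.right_inv (by simp [I.range_eq_univ])]
    have h4 : G (e.symm v) = v := by rw [← heG, e.right_inv hv']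
    rw [comp_apply, comp_apply, comp_apply, h3]
    change fh (e.symm v) = (L v).1
    rw [show L v = L (G (e.symm v)) by rw [h4], L.apply_symm_apply]

/-- A smooth map with a smooth local section through every point is a submersion. -/
theorem isSubmersion_of_sections [FiniteDimensional ℝ E] [FiniteDimensional ℝ E']
    [IsManifold I ∞ M] [IsManifold J ∞ N] {f : M → N} (hf : ContMDiff I J ∞ f)
    (h : ∀ x, ∃ σ : N → M, ContMDiffAt J I ∞ σ (f x) ∧ σ (f x) = x ∧
      ∀ᶠ y in 𝓝 (f x), f (σ y) = y) : Manifold.IsSubmersion I J ∞ f :=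
  ⟨_, inferInstance, inferInstance, fun x => by
    obtain ⟨σ, h1, h2, h3⟩ := h x
    exact isSubmersionAtOfComplement_of_section hf x h1 h2 h3⟩

end

/-! ## Gluing smooth structures -/

section gluing

variable {Q : Type u₁} {ι : Type*} {E H N : Type*} [NormedAddCommGroup E] [NormedSpace ℝ E]
  [TopologicalSpace H] {I : ModelWithCorners ℝ E H} [TopologicalSpace N] [ChartedSpace H N]

variable (I) in
/-- Smooth parametrizations by open subsets of `ℝⁿ` of relatively open subsets of `T`. -/
def IsSubsetChart {n : ℕ} (T : Set N) (e : PartialEquiv N (EuclideanSpace ℝ (Fin n))) : Prop :=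
  (∃ O, IsOpen O ∧ e.source = T ∩ O) ∧ IsOpen e.target ∧
    ContMDiffOn I (𝓡 n) ∞ e e.source ∧ ContMDiffOn (𝓡 n) I ∞ e.symm e.target

/-- A set which is a union of pieces `V i` in bijection with subsets `T i` of a manifold, such that
each `T i` is locally parametrized by `ℝⁿ` and the transition maps are smooth, has a smooth
structure for which the bijections are diffeomorphisms. -/
theorem exists_smoothStructure_of_gluing (n : ℕ) (b : ι → PartialEquiv Q N)
    (hcover : ∀ q, ∃ i, q ∈ (b i).source)
    (hopen : ∀ i j, ∃ O, IsOpen O ∧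
      (b i).target ∩ (b i).symm ⁻¹' (b j).source = (b i).target ∩ O)
    (hsmooth : ∀ i j, ContMDiffOn I I ∞ (b j ∘ (b i).symm)
      ((b i).target ∩ (b i).symm ⁻¹' (b j).source))
    (hchart : ∀ i, ∀ z ∈ (b i).target, ∃ e : PartialEquiv N (EuclideanSpace ℝ (Fin n)),
      z ∈ e.source ∧ IsSubsetChart I (b i).target e) :
    ∃ (_ : TopologicalSpace Q) (_ : ChartedSpace (EuclideanSpace ℝ (Fin n)) Q)
      (_ : IsManifold (𝓡 n) ∞ Q), ∀ i, IsOpen (b i).source ∧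
      ContMDiffOn (𝓡 n) I ∞ (b i) (b i).source ∧
      ContMDiffOn I (𝓡 n) ∞ (b i).symm (b i).target := by
  classical
  -- A transition has an open domain because it is cut out in two stages: by `W`, the trace of the
  -- overlap of the two pieces, and then by `O'`, the trace of the second parametrized set.
  have htrans : ∀ i j (e e' : PartialEquiv N (EuclideanSpace ℝ (Fin n))),
      IsSubsetChart I (b i).target e → IsSubsetChart I (b j).target e' →
      IsOpen (((b i).trans e).symm.trans ((b j).trans e')).source ∧
      ContMDiffOn (𝓡 n) (𝓡 n) ∞ (((b i).trans e).symm.trans ((b j).trans e'))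
        (((b i).trans e).symm.trans ((b j).trans e')).source := by
    rintro i j e e' ⟨⟨O, hO, hOe⟩, he, he1, he2⟩ ⟨⟨O', hO', hOe'⟩, he', he1', he2'⟩
    obtain ⟨W, hW, hWij⟩ := hopen i j
    have hS1 : IsOpen (e.target ∩ e.symm ⁻¹' W) := he2.continuousOn.isOpen_inter_preimage he hW
    have hm : ∀ v ∈ e.target, e.symm v ∈ (b i).target := fun v hv =>
      (hOe ▸ e.map_target hv : e.symm v ∈ (b i).target ∩ O).1
    have hm' : ∀ v ∈ e.target ∩ e.symm ⁻¹' W,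
        e.symm v ∈ (b i).target ∩ (b i).symm ⁻¹' (b j).source := fun v hv =>
      hWij ▸ ⟨hm v hv.1, hv.2⟩
    have hw : ContMDiffOn (𝓡 n) I ∞ (fun v => b j ((b i).symm (e.symm v)))
        (e.target ∩ e.symm ⁻¹' W) :=
      (hsmooth i j).comp (he2.mono inter_subset_left) hm'
    have hS2 := hw.continuousOn.isOpen_inter_preimage hS1 hO'
    have hsrc : (((b i).trans e).symm.trans ((b j).trans e')).source =
        (e.target ∩ e.symm ⁻¹' W) ∩ (fun v => b j ((b i).symm (e.symm v))) ⁻¹' O' := by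
      ext v
      have h1 : v ∈ e.target → (e.symm v ∈ W ↔ (b i).symm (e.symm v) ∈ (b j).source) := fun hv =>
        ⟨fun h => (hm' v ⟨hv, h⟩).2,
          fun h => (hWij ▸ ⟨hm v hv, h⟩ : e.symm v ∈ (b i).target ∩ W).2⟩
      have h2 : (b i).symm (e.symm v) ∈ (b j).source →
          (b j ((b i).symm (e.symm v)) ∈ e'.source ↔ b j ((b i).symm (e.symm v)) ∈ O') := by
        intro h
        rw [hOe']
        exact ⟨fun h => h.2, fun h' => ⟨(b j).map_source h, h'⟩⟩
      simp only [PartialEquiv.trans_source, PartialEquiv.symm_source,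
        PartialEquiv.trans_symm_eq_symm_trans_symm, PartialEquiv.coe_trans, mem_inter_iff,
        mem_preimage, comp_apply]
      constructor
      · rintro ⟨⟨a, -⟩, c, d⟩
        exact ⟨⟨a, (h1 a).2 c⟩, (h2 c).1 d⟩
      · rintro ⟨⟨a, c⟩, d⟩
        exact ⟨⟨a, hm v a⟩, (h1 a).1 c, (h2 ((h1 a).1 c)).2 d⟩
    refine ⟨hsrc ▸ hS2, ?_⟩
    rw [hsrc]
    refine (he1'.comp (hw.mono inter_subset_left) ?_)
    rintro v ⟨hv, hv'⟩
    rw [hOe']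
    exact ⟨(b j).map_source (hm' v hv).2, hv'⟩
  choose idx hidx using hcover
  choose ch hch hch' using hchart
  let core : ChartedSpaceCore (EuclideanSpace ℝ (Fin n)) Q :=
    { atlas := {c | ∃ i e, IsSubsetChart I (b i).target e ∧ c = (b i).trans e}
      chartAt := fun q => (b (idx q)).trans (ch (idx q) (b (idx q) q) ((b (idx q)).map_source (hidx q)))
      mem_chart_source := fun q => ⟨hidx q, hch _ _ _⟩
      chart_mem_atlas := fun q => ⟨_, _, hch' _ _ _, rfl⟩
      open_source := by
        rintro _ _ ⟨i, e, he, rfl⟩ ⟨j, e', he', rfl⟩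
        exact (htrans i j e e' he he').1
      continuousOn_toFun := by
        rintro _ _ ⟨i, e, he, rfl⟩ ⟨j, e', he', rfl⟩
        exact (htrans i j e e' he he').2.continuousOn }
  let top := core.toTopologicalSpace
  let chs : ChartedSpace (EuclideanSpace ℝ (Fin n)) Q := core.toChartedSpace
  have hatlas : ∀ c : OpenPartialHomeomorph Q (EuclideanSpace ℝ (Fin n)),
      c ∈ atlas (EuclideanSpace ℝ (Fin n)) Q ↔
        ∃ i e, IsSubsetChart I (b i).target e ∧ c.toPartialEquiv = (b i).trans e := by
    intro c
    change c ∈ (⋃ (e) (he : e ∈ core.atlas), {core.openPartialHomeomorph e he}) ↔ _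
    simp only [mem_iUnion, mem_singleton_iff]
    constructor
    · rintro ⟨_, ⟨i, e, he, rfl⟩, rfl⟩
      exact ⟨i, e, he, rfl⟩
    · rintro ⟨i, e, he, h⟩
      exact ⟨_, ⟨i, e, he, rfl⟩, OpenPartialHomeomorph.toPartialEquiv_injective h⟩
  have hman : IsManifold (𝓡 n) ∞ Q := by
    apply isManifold_of_contDiffOn
    intro c c' hc hc'
    obtain ⟨i, e, he, h⟩ := (hatlas c).1 hc
    obtain ⟨j, e', he', h'⟩ := (hatlas c').1 hc'
    have h1 := contMDiffOn_iff_contDiffOn.1 (htrans i j e e' he he').2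
    rw [← h, ← h'] at h1
    exact h1.mono (by simp)
  refine ⟨top, chs, hman, fun i => ?_⟩
  have hloc : ∀ z ∈ (b i).target, ∃ (c : OpenPartialHomeomorph Q (EuclideanSpace ℝ (Fin n)))
      (e : PartialEquiv N (EuclideanSpace ℝ (Fin n))), z ∈ e.source ∧
      IsSubsetChart I (b i).target e ∧ c ∈ IsManifold.maximalAtlas (𝓡 n) ∞ Q ∧
        c.toPartialEquiv = (b i).trans e := fun z hz =>
    ⟨core.openPartialHomeomorph _ ⟨i, _, hch' i z hz, rfl⟩, ch i z hz, hch i z hz, hch' i z hz,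
      StructureGroupoid.subset_maximalAtlas _ ((hatlas _).2 ⟨i, _, hch' i z hz, rfl⟩), rfl⟩
  refine ⟨?_, ?_, ?_⟩
  · rw [isOpen_iff_mem_nhds]
    intro q hq
    obtain ⟨c, e, hz, he, hc, hce⟩ := hloc _ ((b i).map_source hq)
    have hcs : c.source = (b i).source ∩ b i ⁻¹' e.source := by
      rw [hce, PartialEquiv.trans_source]
    refine Filter.mem_of_superset (c.open_source.mem_nhds ?_) (hcs ▸ inter_subset_left)
    rw [hcs]; exact ⟨hq, hz⟩
  · intro q hq
    obtain ⟨c, e, hz, he, hc, hce⟩ := hloc _ ((b i).map_source hq)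
    have hcs : c.source = (b i).source ∩ b i ⁻¹' e.source := by
      rw [hce, PartialEquiv.trans_source]
    have hcq : ∀ x, c x = e (b i x) := fun x => congrArg (fun p : PartialEquiv _ _ => p x) hce
    -- The chart `c` is `b i` followed by `e`, so near `q` the map `b i` is `e.symm` after `c`.
    have h1 : ContMDiffOn (𝓡 n) I ∞ (fun x => e.symm (c x)) c.source := by
      refine he.2.2.2.comp (contMDiffOn_of_mem_maximalAtlas hc) fun x hx => ?_
      rw [mem_preimage, hcq]
      exact e.map_source (hcs.subset hx).2
    have h2 : ContMDiffOn (𝓡 n) I ∞ (b i) c.source := h1.congr fun x hx => by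
      rw [hcq, e.left_inv (hcs.subset hx).2]
    refine (h2.contMDiffAt (c.open_source.mem_nhds ?_)).contMDiffWithinAt
    rw [hcs]; exact ⟨hq, hz⟩
  · intro z hz
    obtain ⟨c, e, hze, he, hc, hce⟩ := hloc z hz
    obtain ⟨O, hO, hOe⟩ := he.1
    have hcs : c.target = e.target ∩ e.symm ⁻¹' (b i).target := by
      rw [hce, PartialEquiv.trans_target]
    have hcq : ∀ x, c.symm x = (b i).symm (e.symm x) := fun x =>
      congrArg (fun p : PartialEquiv _ _ => p.symm x) hce
    have h1 : ContMDiffOn I (𝓡 n) ∞ (fun x => c.symm (e x)) e.source := by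
      refine (contMDiffOn_symm_of_mem_maximalAtlas hc).comp he.2.2.1 fun x hx => ?_
      rw [mem_preimage, hcs]
      refine ⟨e.map_source hx, ?_⟩
      rw [mem_preimage, e.left_inv hx]
      exact (hOe.subset hx).1
    have h2 : ContMDiffOn I (𝓡 n) ∞ (b i).symm e.source := h1.congr fun x hx => by
      rw [hcq, e.left_inv hx]
    -- The set `e.source` is open only relative to the target of `b i`, which is enough for
    -- smoothness within that target.
    refine (h2 z hze).mono_of_mem_nhdsWithin ?_
    rw [hOe]
    exact inter_mem_nhdsWithin _ (hO.mem_nhds (hOe.subset hze).2)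

end gluing

/-- In the normal form of `t`, a point `(x, b)` of the fibre product is determined by a coordinate
of `x` and the complementary coordinate of `b`; the remaining coordinates of `b` are those of `m x`.
This also explains the dimension. -/
theorem exists_subsetChart_fibreProduct {M : Mfd.{u₁}} {B : Mfd.{u₂}} {Y : Mfd.{u₃}} {t : B → Y}
    (ht : Manifold.IsSubmersion (𝓡 B.dim) (𝓡 Y.dim) ∞ t) {U : Set M} (hU : IsOpen U)
    {m : M → Y} (hm : ContMDiffOn (𝓡 M.dim) (𝓡 Y.dim) ∞ m U) (z : M × B) (hzU : z.1 ∈ U)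
    (hz : m z.1 = t z.2) :
    ∃ e : PartialEquiv (M × B) (EuclideanSpace ℝ (Fin (M.dim + (B.dim - Y.dim)))),
      z ∈ e.source ∧ IsSubsetChart (prodModel M B) {z | z.1 ∈ U ∧ m z.1 = t z.2} e := by
  have h := ht.isSubmersionAt z.2
  set ψ := h.domChart
  set χ := h.codChart
  let φ := chartAt (EuclideanSpace ℝ (Fin M.dim)) z.1
  set L := h.equiv
  have hψχ : ∀ b ∈ ψ.source, t b ∈ χ.source := h.source_subset_preimage_source
  have hw : ∀ b ∈ ψ.source, χ (t b) = (L (ψ b)).1 := by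
    intro b hb
    have h1 := h.writtenInCharts ((ψ.extend (𝓡 B.dim)).map_source (by simpa using hb))
    simp only [comp_apply] at h1
    rw [(ψ.extend (𝓡 B.dim)).left_inv (by simpa using hb)] at h1
    simpa using h1
  have hfdF : FiniteDimensional ℝ h.complement :=
    Module.Finite.of_surjective ((LinearMap.snd ℝ (EuclideanSpace ℝ (Fin Y.dim)) h.complement).comp
      L.toLinearEquiv.toLinearMap) (Prod.snd_surjective.comp L.surjective)
  have hfr : Module.finrank ℝ (EuclideanSpace ℝ (Fin M.dim) × h.complement) =
      Module.finrank ℝ (EuclideanSpace ℝ (Fin (M.dim + (B.dim - Y.dim)))) := by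
    have := L.toLinearEquiv.finrank_eq
    rw [Module.finrank_prod, finrank_euclideanSpace_fin, finrank_euclideanSpace_fin] at this
    rw [Module.finrank_prod, finrank_euclideanSpace_fin, finrank_euclideanSpace_fin]
    omega
  let W := (LinearEquiv.ofFinrankEq _ _ hfr).toContinuousLinearEquiv
  have hφ : φ ∈ IsManifold.maximalAtlas (𝓡 M.dim) ∞ M := IsManifold.chart_mem_maximalAtlas _
  have hψ : ψ ∈ IsManifold.maximalAtlas (𝓡 B.dim) ∞ B := h.domChart_mem_maximalAtlas
  have hχ : χ ∈ IsManifold.maximalAtlas (𝓡 Y.dim) ∞ Y := h.codChart_mem_maximalAtlas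
  let n := M.dim + (B.dim - Y.dim)
  let x : EuclideanSpace ℝ (Fin n) → M := fun v => φ.symm (W.symm v).1
  -- The coordinates of `b`, rebuilt from those of `m x` and the free complementary part. The sets
  -- `A₁`, …, `A₄` successively ensure that the next map in this reconstruction is defined and
  -- smooth.
  let k : EuclideanSpace ℝ (Fin n) → EuclideanSpace ℝ (Fin B.dim) := fun v =>
    L.symm (χ (m (x v)), (W.symm v).2)
  let A₁ : Set (EuclideanSpace ℝ (Fin n)) := (fun v => (W.symm v).1) ⁻¹' φ.target
  let A₂ := A₁ ∩ x ⁻¹' U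
  let A₃ := A₂ ∩ (fun v => m (x v)) ⁻¹' χ.source
  let A₄ := A₃ ∩ k ⁻¹' ψ.target
  have hW1 : ContMDiff (𝓡 n) (𝓡 M.dim) ∞ (fun v : EuclideanSpace ℝ (Fin n) => (W.symm v).1) :=
    (contDiff_fst.comp W.symm.contDiff).contMDiff
  have hA₁ : IsOpen A₁ := φ.open_target.preimage hW1.continuous
  have hx : ContMDiffOn (𝓡 n) (𝓡 M.dim) ∞ x A₁ :=
    (contMDiffOn_symm_of_mem_maximalAtlas hφ).comp hW1.contMDiffOn (fun v hv => hv)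
  have hA₂ : IsOpen A₂ := hx.continuousOn.isOpen_inter_preimage hA₁ hU
  have hmx : ContMDiffOn (𝓡 n) (𝓡 Y.dim) ∞ (fun v => m (x v)) A₂ :=
    hm.comp (hx.mono inter_subset_left) (fun v hv => hv.2)
  have hA₃ : IsOpen A₃ := hmx.continuousOn.isOpen_inter_preimage hA₂ χ.open_source
  have hk : ContMDiffOn (𝓡 n) (𝓡 B.dim) ∞ k A₃ := by
    have h1 : ContMDiffOn (𝓡 n) (𝓡 Y.dim) ∞ (fun v => χ (m (x v))) A₃ :=
      (contMDiffOn_of_mem_maximalAtlas hχ).comp (hmx.mono inter_subset_left) (fun v hv => hv.2)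
    have h2 : ContDiffOn ℝ ∞ (fun v => (χ (m (x v)), (W.symm v).2)) A₃ :=
      (contMDiffOn_iff_contDiffOn.1 h1).prodMk
        ((contDiff_snd.comp W.symm.contDiff).contDiffOn)
    exact (L.symm.contDiff.comp_contDiffOn h2).contMDiffOn
  have hA₄ : IsOpen A₄ := hk.continuousOn.isOpen_inter_preimage hA₃ ψ.open_target
  let e : PartialEquiv (M × B) (EuclideanSpace ℝ (Fin n)) :=
    { toFun := fun w => W (φ w.1, (L (ψ w.2)).2)
      invFun := fun v => (x v, ψ.symm (k v))
      source := {w | w.1 ∈ U ∧ m w.1 = t w.2} ∩ (φ.source ×ˢ ψ.source)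
      target := A₄
      map_source' := by
        rintro ⟨a, b⟩ ⟨⟨ha, hab⟩, ha', hb⟩
        simp only at *
        have hxa : x (W (φ a, (L (ψ b)).2)) = a := by simp [x, φ.left_inv ha']
        have hkb : k (W (φ a, (L (ψ b)).2)) = ψ b := by
          simp only [k, hxa, hab, hw b hb, W.symm_apply_apply, Prod.mk.eta, L.symm_apply_apply]
        refine ⟨⟨⟨?_, ?_⟩, ?_⟩, ?_⟩
        · simpa [A₁] using φ.map_source ha'
        · simpa [hxa] using ha
        · rw [mem_preimage, hxa, hab]; exact hψχ b hb
        · rw [mem_preimage, hkb]; exact ψ.map_source hb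
      map_target' := by
        rintro v ⟨⟨⟨h1, h2⟩, h3⟩, h4⟩
        have h5 := ψ.map_target h4
        refine ⟨⟨h2, ?_⟩, φ.map_target h1, h5⟩
        refine χ.injOn h3 (hψχ _ h5) ?_
        simp only
        rw [hw _ h5, ψ.right_inv h4, L.apply_symm_apply]
      left_inv' := by
        rintro ⟨a, b⟩ ⟨⟨ha, hab⟩, ha', hb⟩
        simp only at *
        have hxa : x (W (φ a, (L (ψ b)).2)) = a := by simp [x, φ.left_inv ha']
        have hkb : k (W (φ a, (L (ψ b)).2)) = ψ b := by
          simp only [k, hxa, hab, hw b hb, W.symm_apply_apply, Prod.mk.eta, L.symm_apply_apply]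
        rw [hxa, hkb, ψ.left_inv hb]
      right_inv' := by
        rintro v ⟨⟨⟨h1, h2⟩, h3⟩, h4⟩
        simp only
        rw [ψ.right_inv h4, L.apply_symm_apply, φ.right_inv h1, Prod.mk.eta, W.apply_symm_apply] }
  refine ⟨e, ⟨⟨hzU, hz⟩, mem_chart_source _ _, h.mem_domChart_source⟩,
    ⟨_, φ.open_source.prod ψ.open_source, rfl⟩, hA₄, ?_, ?_⟩
  · have h1 : ContMDiffOn (prodModel M B) (𝓡 M.dim) ∞ (fun w : M × B => φ w.1) e.source :=
      (contMDiffOn_of_mem_maximalAtlas hφ).comp contMDiff_fst.contMDiffOn (fun w hw => hw.2.1)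
    have h2 : ContMDiffOn (prodModel M B) (𝓡 B.dim) ∞ (fun w : M × B => ψ w.2) e.source :=
      (contMDiffOn_of_mem_maximalAtlas hψ).comp contMDiff_snd.contMDiffOn (fun w hw => hw.2.2)
    have h3 : ContMDiff (𝓡 B.dim) 𝓘(ℝ, h.complement) ∞
        (fun v : EuclideanSpace ℝ (Fin B.dim) => (L v).2) :=
      (contDiff_snd.comp L.contDiff).contMDiff
    exact W.contDiff.contMDiff.comp_contMDiffOn (h1.prodMk_space (h3.comp_contMDiffOn h2))
  · exact (hx.mono (fun v hv => hv.1.1.1)).prodMk ((contMDiffOn_symm_of_mem_maximalAtlas hψ).comp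
      (hk.mono inter_subset_left) (fun v hv => hv.2))

section sections

variable {E E' : Type} [NormedAddCommGroup E] [NormedSpace ℝ E] [NormedAddCommGroup E']
  [NormedSpace ℝ E'] {H H' M N : Type*} [TopologicalSpace H] [TopologicalSpace H']
  {I : ModelWithCorners ℝ E H} {J : ModelWithCorners ℝ E' H'} [I.Boundaryless]
  [TopologicalSpace M] [ChartedSpace H M] [TopologicalSpace N] [ChartedSpace H' N]

/-- A local section is continuous, so points near `f x` are images of points near `x`. -/
theorem Manifold.IsSubmersion.isOpenMap {f : M → N} (hf : Manifold.IsSubmersion I J ∞ f) :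
    IsOpenMap f := by
  refine IsOpenMap.of_nhds_le fun x => ?_
  obtain ⟨U, hU, hxU, σ, hσ, hσx, hfσ⟩ := (hf.isSubmersionAt x).exists_localSection
  intro S hS
  have h1 : ContinuousAt σ (f x) := hσ.continuousOn.continuousAt (hU.mem_nhds hxU)
  have h2 : ∀ᶠ y in 𝓝 (f x), f (σ y) ∈ S := h1.eventually (by rw [hσx]; exact hS)
  filter_upwards [h2, hU.mem_nhds hxU] with y hy hyU
  rwa [hfσ y hyU] at hy

end sections

/-! ## The glued bundle -/

/-! ### Groupoid identities -/

namespace LieGroupoid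

variable {A : Mfd.{u₁}} {X : Mfd.{u₂}} (G : LieGroupoid A X)

theorem inv_mul_cancel_left {g h : A} (hgh : G.s g = G.t h) : G.mul (G.inv g) (G.mul g h) = h := by
  rw [← G.mul_assoc _ _ _ (G.s_inv g) hgh, G.inv_mul, hgh, G.one_mul]

theorem mul_inv_cancel_left {g h : A} (hgh : G.t g = G.t h) : G.mul g (G.mul (G.inv g) h) = h := by
  rw [← G.mul_assoc _ _ _ (G.t_inv g).symm ((G.s_inv g).trans hgh), G.mul_inv, hgh, G.one_mul]

theorem mul_inv_cancel_right {g h : A} (hgh : G.s g = G.t h) :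
    G.mul (G.mul g h) (G.inv h) = g := by
  rw [G.mul_assoc _ _ _ hgh (G.t_inv h).symm, G.mul_inv, ← hgh, G.mul_one]

theorem inv_inv (g : A) : G.inv (G.inv g) = g := by
  have h := G.inv_mul_cancel_left (G.s_inv g)
  rwa [G.inv_mul, ← G.t_inv, ← G.s_inv, G.mul_one] at h

theorem inv_eq_of_mul_eq_one {g h : A} (hgh : G.s g = G.t h) (e : G.mul g h = G.one (G.t g)) :
    G.inv g = h := by
  rw [← G.inv_mul_cancel_left hgh, e, ← G.s_inv, G.mul_one]

theorem inv_mul_rev {g h : A} (hgh : G.s g = G.t h) :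
    G.inv (G.mul g h) = G.mul (G.inv h) (G.inv g) := by
  have h1 : G.s (G.inv h) = G.t (G.inv g) := by rw [G.s_inv, G.t_inv, hgh]
  apply G.inv_eq_of_mul_eq_one
  · rw [G.s_mul _ _ hgh, G.t_mul _ _ h1, G.t_inv]
  · rw [← G.mul_assoc _ _ _ (by rw [G.s_mul _ _ hgh, G.t_inv]) h1, G.mul_inv_cancel_right hgh,
      G.mul_inv, G.t_mul _ _ hgh]

theorem s_smooth : ContMDiff (𝓡 A.dim) (𝓡 X.dim) ∞ G.s := G.s_subm.2.contMDiff

theorem t_smooth : ContMDiff (𝓡 A.dim) (𝓡 X.dim) ∞ G.t := G.t_subm.2.contMDiff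

end LieGroupoid

/-! ### Points and fibre coordinates of the glued bundle -/

namespace TrivData

variable {ι : Type u₁} {M : Mfd.{u₂}} {B : Mfd.{u₃}} {Y : Mfd.{u₄}} {H : LieGroupoid B Y}
  (D : TrivData ι M H)

open Classical in
/-- The class `[α, x, h]`, extended by a junk value. -/
def pt (α : ι) (z : M × B) : D.Total :=
  if h : z ∈ D.trivialBundle α then D.cls α z.1 z.2 h.1 h.2
  -- The junk value still lies over `z.1`, so `proj_pt` holds without hypotheses.
  else D.cls (D.cover z.1).choose z.1 (H.one (D.mom (D.cover z.1).choose z.1))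
    (D.cover z.1).choose_spec (H.t_one _).symm

variable {D}

theorem pt_eq_cls {α : ι} {x : M} {h : B} (hx : x ∈ D.U α) (hm : D.mom α x = H.t h) :
    D.pt α (x, h) = D.cls α x h hx hm :=
  dif_pos (show (x, h) ∈ D.trivialBundle α from ⟨hx, hm⟩)

theorem proj_pt (α : ι) (z : M × B) : D.proj (D.pt α z) = z.1 := by
  unfold pt
  split_ifs <;> rfl

theorem momentum_pt {α : ι} {x : M} {h : B} (hx : x ∈ D.U α) (hm : D.mom α x = H.t h) :
    D.momentum (D.pt α (x, h)) = H.s h := by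
  rw [pt_eq_cls hx hm]; rfl

theorem pt_eq_pt_iff {α β : ι} {x : M} {h k : B} (hα : x ∈ D.U α) (hβ : x ∈ D.U β)
    (hm : D.mom α x = H.t h) (hm' : D.mom β x = H.t k) :
    D.pt α (x, h) = D.pt β (x, k) ↔ h = H.mul (D.trans α β x) k := by
  rw [pt_eq_cls hα hm, pt_eq_cls hβ hm']
  exact ⟨fun h => (Quotient.exact h).2, fun h => Quotient.sound ⟨rfl, h⟩⟩

theorem pt_trans {α β : ι} {x : M} {k : B} (hα : x ∈ D.U α) (hβ : x ∈ D.U β)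
    (hm : D.mom β x = H.t k) : D.pt α (x, H.mul (D.trans α β x) k) = D.pt β (x, k) := by
  rw [pt_eq_pt_iff hα hβ _ hm]
  rw [H.t_mul, D.t_trans _ _ _ hα hβ]
  rw [D.s_trans _ _ _ hα hβ, hm]

theorem pt_injective {α : ι} {x : M} {h k : B} (hα : x ∈ D.U α)
    (hm : D.mom α x = H.t h) (hm' : D.mom α x = H.t k) (e : D.pt α (x, h) = D.pt α (x, k)) :
    h = k := by
  rw [pt_eq_pt_iff hα hα hm hm', D.trans_self _ _ hα, hm', H.one_mul] at e
  exact e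

/-- A point given in the trivialization `β` is moved to the trivialization `α` by the transition
arrow `trans α β`. -/
theorem exists_eq_pt {α : ι} {p : D.Total} (hp : D.proj p ∈ D.U α) :
    ∃ h, D.mom α (D.proj p) = H.t h ∧ D.pt α (D.proj p, h) = p := by
  induction p using Quotient.inductionOn with
  | _ a =>
    obtain ⟨β, x, k, hx, hk⟩ := a
    have h1 : H.s (D.trans α β x) = H.t k := by rw [D.s_trans α β x hp hx, hk]
    refine ⟨H.mul (D.trans α β x) k, ?_, ?_⟩
    · rw [H.t_mul _ _ h1]
      exact (D.t_trans α β x hp hx).symm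
    · exact (pt_trans hp hx hk).trans (pt_eq_cls hx hk)

variable (D)

open Classical in
/-- The fibre coordinate `h` of `[α, x, h]`. -/
def fib (α : ι) (p : D.Total) : B :=
  if hp : D.proj p ∈ D.U α then (exists_eq_pt hp).choose else H.one (D.momentum p)

variable {D}

theorem t_fib {α : ι} {p : D.Total} (hp : D.proj p ∈ D.U α) :
    D.mom α (D.proj p) = H.t (D.fib α p) := by
  rw [fib, dif_pos hp]
  exact (exists_eq_pt hp).choose_spec.1

theorem t_fib_eq {α : ι} {p q : D.Total} (hp : D.proj p ∈ D.U α) (h : D.proj p = D.proj q) :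
    H.t (D.fib α p) = H.t (D.fib α q) := by
  rw [← t_fib hp, ← t_fib (h ▸ hp), h]

theorem pt_fib {α : ι} {p : D.Total} (hp : D.proj p ∈ D.U α) :
    D.pt α (D.proj p, D.fib α p) = p := by
  rw [fib, dif_pos hp]
  exact (exists_eq_pt hp).choose_spec.2

theorem fib_pt {α : ι} {x : M} {h : B} (hx : x ∈ D.U α) (hm : D.mom α x = H.t h) :
    D.fib α (D.pt α (x, h)) = h := by
  have hp : D.proj (D.pt α (x, h)) ∈ D.U α := by rwa [proj_pt]
  have h1 := pt_fib hp
  have h2 := t_fib hp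
  rw [proj_pt] at h1 h2
  exact pt_injective hx h2 hm h1

theorem s_fib {α : ι} {p : D.Total} (hp : D.proj p ∈ D.U α) :
    H.s (D.fib α p) = D.momentum p := by
  conv_rhs => rw [← pt_fib hp]
  rw [momentum_pt hp (t_fib hp)]

theorem fib_trans {α β : ι} {p : D.Total} (hα : D.proj p ∈ D.U α) (hβ : D.proj p ∈ D.U β) :
    D.fib α p = H.mul (D.trans α β (D.proj p)) (D.fib β p) := by
  rw [← pt_eq_pt_iff hα hβ (t_fib hα) (t_fib hβ), pt_fib hα, pt_fib hβ]

theorem actR_pt {α : ι} {x : M} {h k : B} (hx : x ∈ D.U α) (hm : D.mom α x = H.t h)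
    (hk : H.s h = H.t k) : D.actR (D.pt α (x, h)) k = D.pt α (x, H.mul h k) := by
  rw [pt_eq_cls hx hm, pt_eq_cls hx (by rw [H.t_mul _ _ hk, hm])]
  exact dif_pos hk

theorem proj_actR (p : D.Total) (k : B) : D.proj (D.actR p k) = D.proj p := by
  induction p using Quotient.inductionOn with
  | _ a =>
    unfold actR
    simp only [Quotient.lift_mk]
    split_ifs <;> rfl

theorem fib_actR {α : ι} {p : D.Total} {k : B} (hp : D.proj p ∈ D.U α)
    (hk : D.momentum p = H.t k) : D.fib α (D.actR p k) = H.mul (D.fib α p) k := by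
  have h1 := s_fib hp
  have h2 : D.mom α (D.proj p) = H.t (H.mul (D.fib α p) k) := by
    rw [H.t_mul _ _ (h1.trans hk), t_fib hp]
  conv_lhs => rw [← pt_fib hp, actR_pt hp (t_fib hp) (h1.trans hk)]
  rw [fib_pt hp h2]

theorem momentum_actR {p : D.Total} {k : B} (hk : D.momentum p = H.t k) :
    D.momentum (D.actR p k) = H.s k := by
  obtain ⟨α, hα⟩ := D.cover (D.proj p)
  rw [← s_fib (α := α) (by rwa [proj_actR]), fib_actR hα hk, H.s_mul _ _ ((s_fib hα).trans hk)]

/-- Reduces every identity between points of the bundle below to an identity between arrows of `H`.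
-/
theorem eq_of_fib_eq {α : ι} {p q : D.Total} (hp : D.proj p ∈ D.U α) (hpq : D.proj p = D.proj q)
    (h : D.fib α p = D.fib α q) : p = q := by
  rw [← pt_fib hp, h, hpq, pt_fib (hpq ▸ hp)]

end TrivData

/-! ### The left action in fibre coordinates -/

namespace LocGenMor

variable {ι : Type u₁} {A : Mfd.{u₂}} {X : Mfd.{u₃}} {B : Mfd.{u₄}} {Y : Mfd.{u₅}}
  {G : LieGroupoid A X} {H : LieGroupoid B Y} {D : TrivData ι X H} (Θ : LocGenMor G D)

theorem actL_pt {α β : ι} {g : A} {h : B} (hs : G.s g ∈ D.U α) (hm : D.mom α (G.s g) = H.t h)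
    (ht : G.t g ∈ D.U β) :
    Θ.actL g (D.pt α (G.s g, h)) = D.pt β (G.t g, H.mul (Θ.map β α g) h) := by
  have hm' : D.mom β (G.t g) = H.t (H.mul (Θ.map β α g) h) := by
    rw [H.t_mul, Θ.t_map _ _ _ hs ht]
    rw [Θ.s_map _ _ _ hs ht, hm]
  rw [TrivData.pt_eq_cls hs hm, TrivData.pt_eq_cls ht hm']
  exact Θ.actL_cls α β g h hs hm ht hm'

theorem actL_eq {α β : ι} {g : A} {p : D.Total} (hs : G.s g ∈ D.U α) (hp : G.s g = D.proj p)
    (ht : G.t g ∈ D.U β) :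
    Θ.actL g p = D.pt β (G.t g, H.mul (Θ.map β α g) (D.fib α p)) := by
  have hp' : D.proj p ∈ D.U α := hp ▸ hs
  have h1 := Θ.actL_pt hs (hp ▸ TrivData.t_fib hp') ht
  rw [← h1, hp, TrivData.pt_fib hp']

theorem s_map_eq_t_fib {α β : ι} {g : A} {p : D.Total} (hs : G.s g ∈ D.U α)
    (hp : G.s g = D.proj p) (ht : G.t g ∈ D.U β) : H.s (Θ.map β α g) = H.t (D.fib α p) := by
  rw [Θ.s_map _ _ _ hs ht, hp, TrivData.t_fib (hp ▸ hs)]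

theorem proj_actL {g : A} {p : D.Total} (hp : G.s g = D.proj p) :
    D.proj (Θ.actL g p) = G.t g := by
  obtain ⟨α, hα⟩ := D.cover (G.s g)
  obtain ⟨β, hβ⟩ := D.cover (G.t g)
  rw [Θ.actL_eq hα hp hβ, TrivData.proj_pt]

theorem fib_actL {α β : ι} {g : A} {p : D.Total} (hs : G.s g ∈ D.U α) (hp : G.s g = D.proj p)
    (ht : G.t g ∈ D.U β) :
    D.fib β (Θ.actL g p) = H.mul (Θ.map β α g) (D.fib α p) := by
  have hp' : D.proj p ∈ D.U α := hp ▸ hs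
  have h1 : H.s (Θ.map β α g) = H.t (D.fib α p) := by
    rw [Θ.s_map _ _ _ hs ht, hp, TrivData.t_fib hp']
  rw [Θ.actL_eq hs hp ht, TrivData.fib_pt ht]
  rw [H.t_mul _ _ h1, Θ.t_map _ _ _ hs ht]

theorem momentum_actL {g : A} {p : D.Total} (hp : G.s g = D.proj p) :
    D.momentum (Θ.actL g p) = D.momentum p := by
  obtain ⟨α, hα⟩ := D.cover (G.s g)
  obtain ⟨β, hβ⟩ := D.cover (G.t g)
  have hp' : D.proj p ∈ D.U α := hp ▸ hα
  have h1 : H.s (Θ.map β α g) = H.t (D.fib α p) := by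
    rw [Θ.s_map _ _ _ hα hβ, hp, TrivData.t_fib hp']
  rw [← TrivData.s_fib (α := β) (by rwa [Θ.proj_actL hp]), Θ.fib_actL hα hp hβ, H.s_mul _ _ h1,
    TrivData.s_fib hp']

/-- Functoriality: `Θ_{βα}(g) Θ_{αβ}(g⁻¹) = Θ_{ββ}(1)` is a unit. -/
theorem map_inv {α β : ι} {g : A} (hs : G.s g ∈ D.U α) (ht : G.t g ∈ D.U β) :
    Θ.map α β (G.inv g) = H.inv (Θ.map β α g) := by
  symm
  have hs' : G.t (G.inv g) ∈ D.U α := by rwa [G.t_inv]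
  have ht' : G.s (G.inv g) ∈ D.U β := by rwa [G.s_inv]
  apply H.inv_eq_of_mul_eq_one
  · rw [Θ.s_map _ _ _ hs ht, Θ.t_map _ _ _ ht' hs', G.t_inv]
  · rw [← Θ.map_mul β α β g (G.inv g) hs ht ht' hs' (G.t_inv g).symm, G.mul_inv, Θ.map_one _ _ ht,
      Θ.t_map _ _ _ hs ht]

end LocGenMor

theorem isSurjSubmersion_of_sections {M : Mfd.{u₁}} {N : Mfd.{u₂}} {f : M → N}
    (hs : Surjective f) (hf : ContMDiff (𝓡 M.dim) (𝓡 N.dim) ∞ f)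
    (h : ∀ x, ∃ U, IsOpen U ∧ f x ∈ U ∧ ∃ σ : N → M, ContMDiffOn (𝓡 N.dim) (𝓡 M.dim) ∞ σ U ∧
      σ (f x) = x ∧ ∀ y ∈ U, f (σ y) = y) : IsSurjSubmersion f := by
  refine ⟨hs, isSubmersion_of_sections hf fun x => ?_⟩
  obtain ⟨U, hU, hxU, σ, h1, h2, h3⟩ := h x
  exact ⟨σ, h1.contMDiffAt (hU.mem_nhds hxU), h2, Filter.eventually_of_mem (hU.mem_nhds hxU) h3⟩

theorem IsSurjSubmersion.exists_localSection {M : Mfd.{u₁}} {N : Mfd.{u₂}} {f : M → N}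
    (h : IsSurjSubmersion f) (x : M) : ∃ U, IsOpen U ∧ f x ∈ U ∧ ∃ σ : N → M,
      ContMDiffOn (𝓡 N.dim) (𝓡 M.dim) ∞ σ U ∧ σ (f x) = x ∧ ∀ y ∈ U, f (σ y) = y :=
  (h.2.isSubmersionAt x).exists_localSection

/-! ### Smoothness and topology of the glued structure -/

section

variable {E₀ H₀ N : Type*} [NormedAddCommGroup E₀] [NormedSpace ℝ E₀] [TopologicalSpace H₀]
  {J : ModelWithCorners ℝ E₀ H₀} [TopologicalSpace N] [ChartedSpace H₀ N]

namespace LieGroupoid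

variable {A : Mfd.{u₁}} {X : Mfd.{u₂}} (G : LieGroupoid A X)

theorem contMDiffOn_mul {f g : N → A} {S : Set N} (hf : ContMDiffOn J (𝓡 A.dim) ∞ f S)
    (hg : ContMDiffOn J (𝓡 A.dim) ∞ g S) (h : ∀ z ∈ S, G.s (f z) = G.t (g z)) :
    ContMDiffOn J (𝓡 A.dim) ∞ (fun z => G.mul (f z) (g z)) S :=
  G.mul_smooth.comp (hf.prodMk hg) h

theorem contMDiffOn_inv {f : N → A} {S : Set N} (hf : ContMDiffOn J (𝓡 A.dim) ∞ f S) :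
    ContMDiffOn J (𝓡 A.dim) ∞ (fun z => G.inv (f z)) S :=
  G.inv_smooth.comp_contMDiffOn hf

end LieGroupoid

namespace TrivData

variable {ι : Type u₁} {M : Mfd.{u₂}} {B : Mfd.{u₃}} {Y : Mfd.{u₄}} {H : LieGroupoid B Y}
  {D : TrivData ι M H} {σ : SmoothStructure D.Total}

theorem IsGluedStructure.isOpen_preimage (hσ : D.IsGluedStructure σ) (α : ι) :
    IsOpen (X := D.total σ) (D.proj ⁻¹' D.U α) := (hσ α).1

theorem IsGluedStructure.contMDiffOn_pt (hσ : D.IsGluedStructure σ) (α : ι) :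
    ContMDiffOn (prodModel M B) (𝓡 (D.total σ).dim) ∞ (M' := D.total σ) (D.pt α)
      (D.trivialBundle α) := by
  obtain ⟨-, F, hF, -, hF', -⟩ := hσ α
  refine hF'.congr fun z hz => ?_
  rw [hF z.1 z.2 hz.1 hz.2]
  exact pt_eq_cls hz.1 hz.2

/-- The inverse provided by the glued structure is not named there; being inverse to `pt`, it must
agree with the pair of projection and fibre coordinate. -/
theorem IsGluedStructure.contMDiffOn_coord (hσ : D.IsGluedStructure σ) (α : ι) :
    ContMDiffOn (𝓡 (D.total σ).dim) (prodModel M B) ∞ (M := D.total σ)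
      (fun p => (D.proj p, D.fib α p)) (D.proj ⁻¹' D.U α) := by
  obtain ⟨-, F, hF, -, -, g, hg, hg', -, hr⟩ := hσ α
  refine hg'.congr fun p hp => ?_
  have h1 := hg hp
  have h2 : D.pt α (g p) = p := by
    have h3 := hr hp
    rw [← Prod.mk.eta (p := g p), hF _ _ h1.1 h1.2] at h3
    exact (pt_eq_cls h1.1 h1.2).trans h3
  have h4 := proj_pt (D := D) α (g p)
  have h5 := fib_pt h1.1 h1.2
  rw [Prod.mk.eta] at h5
  rw [h2] at h4 h5
  exact Prod.ext h4 h5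

theorem IsGluedStructure.contMDiffOn_fib (hσ : D.IsGluedStructure σ) (α : ι) :
    ContMDiffOn (𝓡 (D.total σ).dim) (𝓡 B.dim) ∞ (M := D.total σ) (D.fib α)
      (D.proj ⁻¹' D.U α) :=
  contMDiff_snd.comp_contMDiffOn (hσ.contMDiffOn_coord α)

theorem IsGluedStructure.contMDiff_proj (hσ : D.IsGluedStructure σ) :
    ContMDiff (𝓡 (D.total σ).dim) (𝓡 M.dim) ∞ (M := D.total σ) D.proj := by
  intro p
  obtain ⟨α, hα⟩ := D.cover (D.proj p)
  have h1 : ContMDiffOn (𝓡 (D.total σ).dim) (𝓡 M.dim) ∞ (M := D.total σ) D.proj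
      (D.proj ⁻¹' D.U α) := contMDiff_fst.comp_contMDiffOn (hσ.contMDiffOn_coord α)
  exact h1.contMDiffAt ((hσ.isOpen_preimage α).mem_nhds hα)

theorem IsGluedStructure.contMDiff_momentum (hσ : D.IsGluedStructure σ) :
    ContMDiff (𝓡 (D.total σ).dim) (𝓡 Y.dim) ∞ (M := D.total σ) D.momentum := by
  intro p
  obtain ⟨α, hα⟩ := D.cover (D.proj p)
  have h1 : ContMDiffOn (𝓡 (D.total σ).dim) (𝓡 Y.dim) ∞ (M := D.total σ) D.momentum
      (D.proj ⁻¹' D.U α) :=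
    (H.s_smooth.comp_contMDiffOn (hσ.contMDiffOn_fib α)).congr fun p hp => (s_fib hp).symm
  exact h1.contMDiffAt ((hσ.isOpen_preimage α).mem_nhds hα)

/-- The test used for smoothness of maps into the bundle: only the base point and one fibre
coordinate matter. -/
theorem IsGluedStructure.contMDiffOn_of_fib (hσ : D.IsGluedStructure σ) (α : ι)
    {f : N → D.total σ} {S : Set N} (hS : ∀ z ∈ S, D.proj (f z) ∈ D.U α)
    (h1 : ContMDiffOn J (𝓡 M.dim) ∞ (fun z => D.proj (f z)) S)
    (h2 : ContMDiffOn J (𝓡 B.dim) ∞ (fun z => D.fib α (f z)) S) :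
    ContMDiffOn J (𝓡 (D.total σ).dim) ∞ f S :=
  ((hσ.contMDiffOn_pt α).comp (h1.prodMk h2) fun z hz => ⟨hS z hz, t_fib (hS z hz)⟩).congr
    fun z hz => (pt_fib (hS z hz)).symm

variable (D) in
-- The coordinates `(proj, fib α)` are glued. Transitions are left multiplications by the smooth
-- cocycle, and each piece is the fibre product of `mom α` with the submersion `t`.
theorem exists_isGluedStructure : ∃ σ, D.IsGluedStructure σ := by
  let b : ι → PartialEquiv D.Total (M × B) := fun α =>
    { toFun := fun p => (D.proj p, D.fib α p)
      invFun := D.pt α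
      source := D.proj ⁻¹' D.U α
      target := D.trivialBundle α
      map_source' := fun p hp => ⟨hp, t_fib hp⟩
      map_target' := fun z hz => by rw [mem_preimage, proj_pt]; exact hz.1
      left_inv' := fun p hp => pt_fib hp
      right_inv' := fun z hz => Prod.ext (proj_pt α z) (fib_pt hz.1 hz.2) }
  have hset : ∀ α β, (b α).target ∩ (b α).symm ⁻¹' (b β).source =
      (b α).target ∩ {z : M × B | z.1 ∈ D.U β} := by
    intro α β
    ext z
    change _ ∧ D.proj (D.pt α z) ∈ D.U β ↔ _ ∧ z.1 ∈ D.U β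
    rw [proj_pt]
  obtain ⟨top, chs, man, hb⟩ := exists_smoothStructure_of_gluing (I := prodModel M B)
    (M.dim + (B.dim - Y.dim)) b (fun p => D.cover (D.proj p))
    (fun α β => ⟨_, (D.isOpen_U β).preimage continuous_fst, hset α β⟩)
    (fun α β => by
      rw [hset]
      have h1 : ContMDiffOn (prodModel M B) (𝓡 B.dim) ∞
          (fun z : M × B => H.mul (D.trans β α z.1) z.2)
          ((b α).target ∩ {z : M × B | z.1 ∈ D.U β}) := by
        refine H.contMDiffOn_mul ((D.trans_smooth β α).comp contMDiff_fst.contMDiffOn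
          fun z hz => ⟨hz.2, hz.1.1⟩) contMDiff_snd.contMDiffOn fun z hz => ?_
        rw [D.s_trans _ _ _ hz.2 hz.1.1]
        exact hz.1.2
      refine (contMDiff_fst.contMDiffOn.prodMk h1).congr fun z hz => ?_
      have h2 : D.proj (D.pt α z) ∈ D.U β := by rw [proj_pt]; exact hz.2
      have h3 : D.proj (D.pt α z) ∈ D.U α := by rw [proj_pt]; exact hz.1.1
      change (D.proj (D.pt α z), D.fib β (D.pt α z)) = _
      rw [fib_trans h2 h3, proj_pt]
      have h4 := fib_pt hz.1.1 hz.1.2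
      rw [Prod.mk.eta] at h4
      rw [h4])
    (fun α z hz => exists_subsetChart_fibreProduct H.t_subm.2 (D.isOpen_U α) (D.mom_smooth α) z
      hz.1 hz.2)
  refine ⟨⟨_, top, chs, man⟩, fun α => ⟨(hb α).1, D.pt α, fun x h hx hm => pt_eq_cls hx hm, ?_⟩⟩
  exact ⟨(b α).symm.mapsTo, (hb α).2.2, b α, (b α).mapsTo, (hb α).2.1, (b α).rightInvOn,
    (b α).leftInvOn⟩

/-- Points over different base points are separated in the base; points of one fibre share a
trivialization and are separated by their fibre coordinates. -/
theorem IsGluedStructure.t2Space (hσ : D.IsGluedStructure σ) [T2Space M] [T2Space B] :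
    T2Space (D.total σ) := by
  refine ⟨fun p q hpq => ?_⟩
  by_cases h : D.proj p = D.proj q
  · obtain ⟨α, hα⟩ := D.cover (D.proj p)
    have hne : D.fib α p ≠ D.fib α q := fun e => hpq (eq_of_fib_eq hα h e)
    obtain ⟨V, W, hV, hW, hpV, hqW, hVW⟩ := t2_separation hne
    have hc := (hσ.contMDiffOn_fib α).continuousOn
    refine ⟨_, _, hc.isOpen_inter_preimage (hσ.isOpen_preimage α) hV,
      hc.isOpen_inter_preimage (hσ.isOpen_preimage α) hW, ⟨hα, hpV⟩,
      ⟨(h ▸ hα : D.proj q ∈ D.U α), hqW⟩, ?_⟩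
    exact (hVW.preimage _).mono inter_subset_right inter_subset_right
  · obtain ⟨V, W, hV, hW, hpV, hqW, hVW⟩ := t2_separation h
    have hc := hσ.contMDiff_proj.continuous
    exact ⟨_, _, hV.preimage hc, hW.preimage hc, hpV, hqW, hVW.preimage _⟩

/-- Countably many `U α` already cover the base (Lindelöf), and the open piece over each is
homeomorphic to a subspace of `M × B`. -/
theorem IsGluedStructure.secondCountableTopology (hσ : D.IsGluedStructure σ)
    [SecondCountableTopology M] [SecondCountableTopology B] :
    SecondCountableTopology (D.total σ) := by
  obtain ⟨T, hT, hTU⟩ := TopologicalSpace.isOpen_iUnion_countable D.U D.isOpen_U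
  have : Countable T := hT
  have hsc : ∀ α : T, SecondCountableTopology (D.proj ⁻¹' D.U α : Set (D.total σ)) := fun α => by
    let e : (D.proj ⁻¹' D.U α : Set (D.total σ)) ≃ₜ D.trivialBundle (α : ι) :=
      { toFun := fun p => ⟨(D.proj p.1, D.fib α p.1), p.2, t_fib p.2⟩
        invFun := fun z => ⟨D.pt α z.1, (proj_pt (D := D) α z.1 ▸ z.2.1 : D.proj (D.pt α z.1) ∈ D.U α)⟩
        left_inv := fun p => Subtype.ext (pt_fib p.2)
        right_inv := fun z => Subtype.ext (Prod.ext (proj_pt _ z.1) (fib_pt z.2.1 z.2.2))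
        continuous_toFun := Continuous.subtype_mk
          (continuousOn_iff_continuous_domRestrict.1 (hσ.contMDiffOn_coord α).continuousOn) _
        continuous_invFun := Continuous.subtype_mk
          (continuousOn_iff_continuous_domRestrict.1 (hσ.contMDiffOn_pt α).continuousOn) _ }
    exact e.secondCountableTopology
  refine TopologicalSpace.secondCountableTopology_of_countable_cover
    (U := fun α : T => (D.proj ⁻¹' D.U α : Set (D.total σ))) (fun α => hσ.isOpen_preimage α) ?_
  refine eq_univ_of_forall fun p => ?_
  obtain ⟨α, hα⟩ := D.cover (D.proj p)
  have h1 : D.proj p ∈ ⋃ i ∈ T, D.U i := hTU ▸ mem_iUnion_of_mem α hα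
  obtain ⟨i, hi, hp⟩ := mem_iUnion₂.1 h1
  exact mem_iUnion.2 ⟨⟨i, hi⟩, hp⟩

end TrivData

end

/-! ### The right principal bundle -/

namespace TrivData

variable {ι : Type u₁} {M : Mfd.{u₂}} {B : Mfd.{u₃}} {Y : Mfd.{u₄}} {H : LieGroupoid B Y}
  {D : TrivData ι M H} {σ : SmoothStructure D.Total}

/-- A section through `p = [α, x₀, h]` is `x ↦ [α, x, τ (ε_α x)]`, where `τ` is a local section of
`t` through `h`. -/
theorem IsGluedStructure.isSurjSubmersion_proj (hσ : D.IsGluedStructure σ) :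
    IsSurjSubmersion (M := D.total σ) D.proj := by
  refine isSurjSubmersion_of_sections (M := D.total σ) ?_ hσ.contMDiff_proj ?_
  · intro x
    obtain ⟨α, hα⟩ := D.cover x
    exact ⟨D.pt α (x, H.one (D.mom α x)), proj_pt _ _⟩
  · intro p
    obtain ⟨α, hα⟩ := D.cover (D.proj p)
    obtain ⟨V, hV, hpV, τ, hτ, hτp, hτV⟩ := H.t_subm.exists_localSection (D.fib α p)
    rw [← t_fib hα] at hτp hpV
    refine ⟨D.U α ∩ D.mom α ⁻¹' V,
      (D.mom_smooth α).continuousOn.isOpen_inter_preimage (D.isOpen_U α) hV, ⟨hα, hpV⟩,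
      fun x => D.pt α (x, τ (D.mom α x)), ?_, ?_, fun x hx => proj_pt _ _⟩
    · exact (hσ.contMDiffOn_pt α).comp (contMDiffOn_id.prodMk
        (hτ.comp ((D.mom_smooth α).mono inter_subset_left) fun x hx => hx.2))
        fun x hx => ⟨hx.1, (hτV _ hx.2).symm⟩
    · exact (congrArg (fun b => D.pt α (D.proj p, b)) hτp).trans (pt_fib hα)

theorem IsGluedStructure.isRightAction (hσ : D.IsGluedStructure σ) :
    IsRightAction H (D.total σ) D.momentum D.actR where
  mom_smooth := hσ.contMDiff_momentum
  act_smooth := by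
    refine contMDiffOn_of_locally_contMDiffOn fun z hz => ?_
    obtain ⟨α, hα⟩ := D.cover (D.proj z.1)
    have hp : ContMDiffOn (prodModel (D.total σ) B) (𝓡 M.dim) ∞
        (fun z : D.total σ × B => D.proj z.1) univ :=
      (hσ.contMDiff_proj.comp contMDiff_fst).contMDiffOn
    refine ⟨Prod.fst ⁻¹' (D.proj ⁻¹' D.U α), (hσ.isOpen_preimage α).preimage continuous_fst, hα, ?_⟩
    refine hσ.contMDiffOn_of_fib α (fun z hz => ?_) ?_ ?_
    · exact mem_of_eq_of_mem (proj_actR _ _) hz.2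
    · exact (hp.mono (subset_univ _)).congr fun z hz => proj_actR _ _
    · refine (H.contMDiffOn_mul ((hσ.contMDiffOn_fib α).comp contMDiff_fst.contMDiffOn
        fun z hz => hz.2) contMDiff_snd.contMDiffOn fun z hz => ?_).congr
        fun z hz => fib_actR hz.2 hz.1
      exact (s_fib hz.2).trans hz.1
  mom_act p g h := momentum_actR h
  act_one := fun (p : D.Total) => by
    obtain ⟨α, hα⟩ := D.cover (D.proj p)
    refine eq_of_fib_eq (α := α) (by rwa [proj_actR]) (proj_actR _ _) ?_
    rw [fib_actR hα (H.t_one _).symm, ← s_fib hα, H.mul_one]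
  act_mul := fun (p : D.Total) g h hg hgh => by
    obtain ⟨α, hα⟩ := D.cover (D.proj p)
    have h1 : D.proj (D.actR p g) ∈ D.U α := by rwa [proj_actR]
    refine eq_of_fib_eq (α := α) (by rwa [proj_actR]) (by rw [proj_actR, proj_actR, proj_actR]) ?_
    rw [fib_actR hα (by rw [H.t_mul _ _ hgh, hg]), fib_actR h1 (by rw [momentum_actR hg, hgh]),
      fib_actR hα hg, H.mul_assoc _ _ _ ((s_fib hα).trans hg) hgh]

variable (D) in
/-- The arrow `h⁻¹ h'` for two points `[α, x, h]` and `[α, x, h']` of a fibre. -/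
def div (p q : D.Total) : B :=
  H.mul (H.inv (D.fib (D.cover (D.proj p)).choose p)) (D.fib (D.cover (D.proj p)).choose q)

/-- A change of trivialization multiplies both fibre coordinates on the left by the same arrow,
which cancels in `h⁻¹ h'`. Hence the chosen index in `div` is irrelevant, and `div` can be computed
with one index on an open set. -/
theorem div_eq {α : ι} {p q : D.Total} (hα : D.proj p ∈ D.U α) (h : D.proj p = D.proj q) :
    D.div p q = H.mul (H.inv (D.fib α p)) (D.fib α q) := by
  have hc := (D.cover (D.proj p)).choose_spec
  set β := (D.cover (D.proj p)).choose
  have h1 := t_fib hα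
  have h2 : D.mom α (D.proj p) = H.t (D.fib α q) := h ▸ t_fib (h ▸ hα)
  have h3 := D.s_trans β α _ hc hα
  rw [div, fib_trans hc hα, fib_trans (p := q) (h ▸ hc) (h ▸ hα), ← h,
    H.inv_mul_rev (h3.trans h1), H.mul_assoc, H.inv_mul_cancel_left (h3.trans h2)]
  · rw [H.s_inv, H.t_inv, ← h1, h3]
  · rw [H.s_inv, H.t_mul _ _ (h3.trans h2)]

theorem actR_div {p q : D.Total} (h : D.proj p = D.proj q) :
    D.momentum p = H.t (D.div p q) ∧ D.actR p (D.div p q) = q := by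
  obtain ⟨α, hα⟩ := D.cover (D.proj p)
  have h1 := t_fib hα
  have h2 : D.mom α (D.proj p) = H.t (D.fib α q) := h ▸ t_fib (h ▸ hα)
  have h3 : H.s (H.inv (D.fib α p)) = H.t (D.fib α q) := by rw [H.s_inv, ← h1, h2]
  have h4 : D.momentum p = H.t (D.div p q) := by
    rw [div_eq hα h, H.t_mul _ _ h3, H.t_inv, s_fib hα]
  refine ⟨h4, eq_of_fib_eq (α := α) (by rwa [proj_actR]) (by rw [proj_actR, h]) ?_⟩
  rw [fib_actR hα h4, div_eq hα h, H.mul_inv_cancel_left (h1.symm.trans h2)]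

theorem div_actR {p : D.Total} {k : B} (h : D.momentum p = H.t k) :
    D.div p (D.actR p k) = k := by
  obtain ⟨α, hα⟩ := D.cover (D.proj p)
  rw [div_eq hα (proj_actR _ _).symm, fib_actR hα h, H.inv_mul_cancel_left ((s_fib hα).trans h)]

theorem IsGluedStructure.isRightPrincipal (hσ : D.IsGluedStructure σ) :
    IsRightPrincipal H (D.total σ) M D.proj D.momentum D.actR where
  isAction := hσ.isRightAction
  proj_subm := hσ.isSurjSubmersion_proj
  proj_act p g _ := proj_actR p g
  diffeo := by
    refine ⟨fun z _ => (proj_actR _ _).symm, contMDiff_fst.contMDiffOn.prodMk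
      hσ.isRightAction.act_smooth, fun z => (z.1, D.div z.1 z.2), fun z hz => (actR_div hz).1, ?_,
      fun z hz => Prod.ext rfl (div_actR hz), fun z hz => Prod.ext rfl (actR_div hz).2⟩
    refine contMDiff_fst.contMDiffOn.prodMk (contMDiffOn_of_locally_contMDiffOn fun z hz => ?_)
    obtain ⟨α, hα⟩ := D.cover (D.proj z.1)
    refine ⟨Prod.fst ⁻¹' (D.proj ⁻¹' D.U α), (hσ.isOpen_preimage α).preimage continuous_fst, hα, ?_⟩
    refine (H.contMDiffOn_mul (H.contMDiffOn_inv ((hσ.contMDiffOn_fib α).comp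
      contMDiff_fst.contMDiffOn fun z hz => hz.2)) ((hσ.contMDiffOn_fib α).comp
      contMDiff_snd.contMDiffOn fun z hz => ?_) fun z hz => ?_).congr fun z hz => div_eq hz.2 hz.1
    · exact (hz.1 ▸ hz.2 : D.proj z.2 ∈ D.U α)
    · have h1 : D.proj z.1 = D.proj z.2 := hz.1
      have h2 : D.proj z.1 ∈ D.U α := hz.2
      exact (H.s_inv _).trans (t_fib_eq h2 h1)

end TrivData

/-! ### The generalized morphism of a local generalized morphism -/

namespace LocGenMor

variable {ι : Type u₁} {A : Mfd.{u₂}} {X : Mfd.{u₃}} {B : Mfd.{u₄}} {Y : Mfd.{u₅}}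
  {G : LieGroupoid A X} {H : LieGroupoid B Y} {D : TrivData ι X H} (Θ : LocGenMor G D)
  {σ : SmoothStructure D.Total}

theorem isLeftAction (hσ : D.IsGluedStructure σ) :
    IsLeftAction G (D.total σ) D.proj Θ.actL where
  mom_smooth := hσ.contMDiff_proj
  act_smooth := by
    refine contMDiffOn_of_locally_contMDiffOn fun z hz => ?_
    obtain ⟨α, hα⟩ := D.cover (G.s z.1)
    obtain ⟨β, hβ⟩ := D.cover (G.t z.1)
    refine ⟨Prod.fst ⁻¹' (G.s ⁻¹' D.U α ∩ G.t ⁻¹' D.U β),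
      (((D.isOpen_U α).preimage G.s_smooth.continuous).inter
        ((D.isOpen_U β).preimage G.t_smooth.continuous)).preimage continuous_fst, ⟨hα, hβ⟩, ?_⟩
    refine hσ.contMDiffOn_of_fib β (fun z hz => ?_) ?_ ?_
    · exact mem_of_eq_of_mem (Θ.proj_actL hz.1) hz.2.2
    · exact (G.t_smooth.comp contMDiff_fst).contMDiffOn.congr fun z hz => Θ.proj_actL hz.1
    · refine (H.contMDiffOn_mul ((Θ.map_smooth α β).comp contMDiff_fst.contMDiffOn
        fun z hz => hz.2) ((hσ.contMDiffOn_fib α).comp contMDiff_snd.contMDiffOn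
        fun z hz => ?_) fun z hz => ?_).congr fun z hz => Θ.fib_actL hz.2.1 hz.1 hz.2.2
      · exact ((show G.s z.1 = D.proj z.2 from hz.1) ▸ hz.2.1 : D.proj z.2 ∈ D.U α)
      · have h1 : G.s z.1 = D.proj z.2 := hz.1
        have h2 : G.s z.1 ∈ D.U α := hz.2.1
        exact Θ.s_map_eq_t_fib h2 h1 hz.2.2
  mom_act g p h := Θ.proj_actL h
  act_one := fun (p : D.Total) => by
    obtain ⟨α, hα⟩ := D.cover (D.proj p)
    have h1 : G.s (G.one (D.proj p)) ∈ D.U α := by rwa [G.s_one]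
    have h2 : G.t (G.one (D.proj p)) ∈ D.U α := by rwa [G.t_one]
    have h3 : D.proj (Θ.actL (G.one (D.proj p)) p) = D.proj p := by
      rw [Θ.proj_actL (G.s_one _), G.t_one]
    refine TrivData.eq_of_fib_eq (α := α) (by rwa [h3]) h3 ?_
    rw [Θ.fib_actL h1 (G.s_one _) h2, Θ.map_one _ _ hα, TrivData.t_fib hα, H.one_mul]
  act_mul := fun g h (p : D.Total) hgh hp => by
    obtain ⟨α, hα⟩ := D.cover (G.s h)
    obtain ⟨β, hβ⟩ := D.cover (G.t h)
    obtain ⟨γ, hγ⟩ := D.cover (G.t g)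
    have hp' := hp ▸ hα
    have h1 : G.s (G.mul g h) = D.proj p := by rw [G.s_mul _ _ hgh, hp]
    have h2 : G.s g = D.proj (Θ.actL h p) := by rw [Θ.proj_actL hp, hgh]
    have h3 : G.s g ∈ D.U β := hgh ▸ hβ
    have h4 : G.s (G.mul g h) ∈ D.U α := h1 ▸ hp'
    have h5 : G.t (G.mul g h) ∈ D.U γ := by rwa [G.t_mul _ _ hgh]
    refine TrivData.eq_of_fib_eq (α := γ) (by rwa [Θ.proj_actL h1])
      (by rw [Θ.proj_actL h1, Θ.proj_actL h2, G.t_mul _ _ hgh]) ?_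
    rw [Θ.fib_actL h4 h1 h5, Θ.fib_actL h3 h2 hγ, Θ.fib_actL hα hp hβ,
      Θ.map_mul α β γ g h h3 hγ hα hβ hgh, H.mul_assoc]
    · rw [Θ.s_map _ _ _ h3 hγ, Θ.t_map _ _ _ hα hβ, hgh]
    · rw [Θ.s_map _ _ _ hα hβ, hp, TrivData.t_fib hp']

theorem isGeneralizedMorphism (hσ : D.IsGluedStructure σ) :
    IsGeneralizedMorphism G H (D.total σ) D.proj D.momentum Θ.actL D.actR where
  principal := hσ.isRightPrincipal
  leftAction := Θ.isLeftAction hσ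
  mom_actL g p h := Θ.momentum_actL h
  compatible := fun g (p : D.Total) k hg hk => by
    obtain ⟨α, hα⟩ := D.cover (G.s g)
    obtain ⟨β, hβ⟩ := D.cover (G.t g)
    have hp' : D.proj p ∈ D.U α := hg ▸ hα
    have h1 : G.s g = D.proj (D.actR p k) := hg.trans (TrivData.proj_actR _ _).symm
    have h2 : D.proj (Θ.actL g p) ∈ D.U β := by rwa [Θ.proj_actL hg]
    have h3 : D.momentum (Θ.actL g p) = H.t k := (Θ.momentum_actL hg).trans hk
    refine TrivData.eq_of_fib_eq (α := β) (by rwa [TrivData.proj_actR])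
      (by rw [TrivData.proj_actR, Θ.proj_actL h1, Θ.proj_actL hg]) ?_
    rw [TrivData.fib_actR h2 h3, Θ.fib_actL hα hg hβ, Θ.fib_actL hα h1 hβ, TrivData.fib_actR hp' hk,
      H.mul_assoc]
    · rw [Θ.s_map _ _ _ hα hβ, hg, TrivData.t_fib hp']
    · exact (TrivData.s_fib hp').trans hk

end LocGenMor

/-! ## From local to global Morita equivalences -/

/-- The inverse of `(p, g) ↦ (p, p g)` fixes the first component; its second component is the
division map. -/
theorem IsRightPrincipal.exists_div {A : Mfd.{u₁}} {X : Mfd.{u₂}} {G : LieGroupoid A X}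
    {P : Mfd.{u₃}} {M : Mfd.{u₄}} {π : P → M} {ε : P → X} {act : P → A → P}
    (h : IsRightPrincipal G P M π ε act) :
    ∃ div : P → P → A, ContMDiffOn (prodModel P P) (𝓡 A.dim) ∞ (fun z : P × P => div z.1 z.2)
        {z | π z.1 = π z.2} ∧
      (∀ p q, π p = π q → ε p = G.t (div p q)) ∧ (∀ p q, π p = π q → act p (div p q) = q) ∧
      ∀ p g, ε p = G.t g → div p (act p g) = g := by
  obtain ⟨-, -, g, hg, hg', hl, hr⟩ := h.diffeo
  have h1 : ∀ z ∈ {z : P × P | π z.1 = π z.2}, (g z).1 = z.1 := fun z hz =>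
    congrArg Prod.fst (hr hz)
  refine ⟨fun p q => (g (p, q)).2, contMDiff_snd.comp_contMDiffOn hg', fun p q hpq => ?_,
    fun p q hpq => ?_, fun p k hk => congrArg Prod.snd (hl (x := (p, k)) hk)⟩
  · have h2 : ε (g (p, q)).1 = G.t (g (p, q)).2 := hg (x := (p, q)) hpq
    rwa [h1 (p, q) hpq] at h2
  · have h2 := congrArg Prod.snd (hr (x := (p, q)) hpq)
    have h3 : act (g (p, q)).1 (g (p, q)).2 = q := h2
    rwa [h1 (p, q) hpq] at h3

/-- The map `f` turns the left `G`-action on `P` into the right action on the principal bundle `P'`,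
so sections and division can be borrowed from `P'`. The maps `f` and `f'` are not assumed mutually
inverse; equivariance of the composites suffices to make `f` injective and to produce preimages
smoothly. -/
theorem isLeftPrincipal_of_equivariant {A : Mfd.{u₁}} {X : Mfd.{u₂}} {B : Mfd.{u₃}} {Y : Mfd.{u₄}}
    {G : LieGroupoid A X} {H : LieGroupoid B Y} {P : Mfd.{u₅}} {π : P → X} {ε : P → Y}
    {actL : A → P → P} {actR : P → B → P} (hP : IsGeneralizedMorphism G H P π ε actL actR)
    {P' : Mfd.{u₆}} {π' : P' → Y} {ε' : P' → X} {actR' : P' → A → P'}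
    (hP' : IsRightPrincipal G P' Y π' ε' actR') {f : P → P'} {f' : P' → P}
    (hf : ContMDiff (𝓡 P.dim) (𝓡 P'.dim) ∞ f) (hf' : ContMDiff (𝓡 P'.dim) (𝓡 P.dim) ∞ f')
    (hfπ : ∀ p, π' (f p) = ε p) (hfε : ∀ p, ε' (f p) = π p)
    (hfπ' : ∀ q, π (f' q) = ε' q) (hfε' : ∀ q, ε (f' q) = π' q)
    (hfG : ∀ g p, G.s g = π p → f (actL g p) = actR' (f p) (G.inv g))
    (hfG' : ∀ q g, ε' q = G.t g → f' (actR' q g) = actL (G.inv g) (f' q))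
    (hff : ∀ p k, ε p = H.t k → f' (f (actR p k)) = actR (f' (f p)) k) :
    IsLeftPrincipal G P Y ε π actL := by
  obtain ⟨div, -, hdiv_t, hdiv_act, hact_div⟩ := hP.principal.exists_div
  obtain ⟨div', hdiv', hdiv_t', hdiv_act', hact_div'⟩ := hP'.exists_div
  -- If `f p = f q`, then `q = p k`, and `H`-equivariance of `f' ∘ f` gives `f' (f p) = f' (f p) k`.
  -- The right action of `H` is free, so `k` is a unit.
  have hinj : Injective f := by
    intro p q hpq
    have hπ : π p = π q := by rw [← hfε, hpq, hfε]
    have hk := hdiv_t p q hπ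
    have h1 := hff p (div p q) hk
    rw [hdiv_act p q hπ, ← hpq] at h1
    have hw : ε (f' (f p)) = ε p := by rw [hfε', hfπ]
    have h2 : div p q = H.one (ε p) := by
      rw [← hact_div (f' (f p)) _ (hw.trans hk), ← h1, ← hw]
      have := hact_div (f' (f p)) (H.one (ε (f' (f p)))) (H.t_one _).symm
      rwa [hP.principal.isAction.act_one] at this
    rw [← hdiv_act p q hπ, h2, hP.principal.isAction.act_one]
  -- The two inversions cancel, so `f ∘ f'` is `G`-equivariant on `P'`.
  have hffG : ∀ q g, ε' q = G.t g → f (f' (actR' q g)) = actR' (f (f' q)) g := by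
    intro q g h
    rw [hfG' q g h, hfG _ _ (by rw [G.s_inv, hfπ', h]), G.inv_inv]
  have hπff : ∀ q, π' (f (f' q)) = π' q := fun q => by rw [hfπ, hfε']
  have hεff : ∀ q, ε' (f (f' q)) = ε' q := fun q => by rw [hfε, hfπ']
  refine ⟨hP.leftAction, isSurjSubmersion_of_sections ?_ hP.principal.isAction.mom_smooth ?_,
    hP.mom_actL, ?_⟩
  · intro y
    obtain ⟨q, hq⟩ := hP'.proj_subm.1 y
    exact ⟨f' q, by rw [hfε', hq]⟩
  · intro p
    obtain ⟨U, hU, hpU, τ, hτ, hτp, hτU⟩ := hP'.proj_subm.exists_localSection (f p)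
    rw [hfπ] at hpU hτp
    have hτt : ∀ y, ε' (τ y) = G.t (div' (f (f' (τ y))) (τ y)) := fun y => by
      rw [← hdiv_t' _ _ (hπff _), hεff]
    -- The points `f (f' (τ y))` and `τ y` lie in one fibre. Translating `τ y` by the arrow between
    -- them before applying `f'` compensates the discrepancy and yields a preimage of `τ y` under
    -- `f`.
    have hfσ : ∀ y, f (f' (actR' (τ y) (div' (f (f' (τ y))) (τ y)))) = τ y := fun y => by
      rw [hffG _ _ (hτt y), hdiv_act' _ _ (hπff _)]
    refine ⟨U, hU, hpU, fun y => f' (actR' (τ y) (div' (f (f' (τ y))) (τ y))), ?_, ?_, ?_⟩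
    · have h1 : ContMDiffOn (𝓡 Y.dim) (𝓡 A.dim) ∞ (fun y => div' (f (f' (τ y))) (τ y)) U :=
        hdiv'.comp (((hf.comp hf').comp_contMDiffOn hτ).prodMk hτ) fun y _ => hπff _
      exact hf'.comp_contMDiffOn
        (hP'.isAction.act_smooth.comp (hτ.prodMk h1) fun y _ => hτt y)
    · exact hinj ((hfσ _).trans hτp)
    · intro y hy
      rw [← hfπ, hfσ, hτU y hy]
  -- The arrow carrying `q` to `p` is `div' (f p) (f q)`: the relation `p = g q` becomes `f p = f q
  -- · g⁻¹`, that is, `f p · g = f q`.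
  · refine ⟨fun z hz => hP.mom_actL _ _ hz,
      hP.leftAction.act_smooth.prodMk contMDiff_snd.contMDiffOn,
      fun z => (div' (f z.1) (f z.2), z.2), ?_, ?_, ?_, ?_⟩
    · intro z hz
      have h1 : π' (f z.1) = π' (f z.2) := by rw [hfπ, hfπ]; exact hz
      change G.s (div' (f z.1) (f z.2)) = π z.2
      rw [← hP'.isAction.mom_act _ _ (hdiv_t' _ _ h1), hdiv_act' _ _ h1, hfε]
    · refine ContMDiffOn.prodMk (hdiv'.comp ((hf.comp contMDiff_fst).prodMk
        (hf.comp contMDiff_snd)).contMDiffOn fun z hz => ?_) contMDiff_snd.contMDiffOn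
      change π' (f z.1) = π' (f z.2)
      rw [hfπ, hfπ]; exact hz
    · rintro ⟨g, p⟩ hgp
      refine Prod.ext ?_ rfl
      change div' (f (actL g p)) (f p) = g
      have hgp' : G.s g = π p := hgp
      have h1 : ε' (f (actL g p)) = G.t g := by rw [hfε, hP.leftAction.mom_act _ _ hgp']
      have h2 : ε' (f p) = G.t (G.inv g) := by rw [hfε, G.t_inv, hgp']
      have h3 : actR' (f (actL g p)) g = f p := by
        rw [hfG _ _ hgp', ← hP'.isAction.act_mul _ _ _ h2 (G.s_inv g), G.inv_mul, hgp', ← hfε,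
          hP'.isAction.act_one]
      conv_lhs => rw [← h3]
      exact hact_div' _ _ h1
    · rintro ⟨p, q⟩ hpq
      refine Prod.ext ?_ rfl
      change actL (div' (f p) (f q)) q = p
      have h1 : π' (f p) = π' (f q) := by rw [hfπ, hfπ]; exact hpq
      have h2 := hdiv_t' _ _ h1
      have h3 : G.s (div' (f p) (f q)) = π q := by
        rw [← hP'.isAction.mom_act _ _ h2, hdiv_act' _ _ h1, hfε]
      apply hinj
      rw [hfG _ _ h3]
      conv_lhs => rw [← hdiv_act' _ _ h1]
      have h4 : div' (f p) (actR' (f p) (div' (f p) (f q))) = div' (f p) (f q) :=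
        hact_div' _ _ h2
      rw [h4, ← hP'.isAction.act_mul _ _ _ h2 (G.t_inv _).symm, G.mul_inv, ← h2,
        hP'.isAction.act_one]

namespace LocalMoritaEquivalence

variable {ι : Type u₁} {κ : Type u₂} {A : Mfd.{u₃}} {X : Mfd.{u₄}}
  {B : Mfd.{u₅}} {Y : Mfd.{u₆}} {G : LieGroupoid A X} {H : LieGroupoid B Y}
  {D : TrivData ι X H} {E : TrivData κ Y G} {Θ : LocGenMor G D} {Η : LocGenMor H E}

/-- The local Morita equivalence with the roles of the two groupoids exchanged. -/
def symm (L : LocalMoritaEquivalence Θ Η) : LocalMoritaEquivalence Η Θ where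
  R := L.S
  S := L.R
  Φ := L.Ψ
  Ψ := L.Φ
  Φ_smooth := L.Ψ_smooth
  Ψ_smooth := L.Φ_smooth
  t_Φ := L.t_Ψ
  s_Φ := L.s_Ψ
  t_Ψ := L.t_Φ
  s_Ψ := L.s_Φ
  Φ_trans := L.Ψ_trans
  Ψ_trans := L.Φ_trans
  comp_eq := L.comp_eq'
  comp_eq' := L.comp_eq

variable (L : LocalMoritaEquivalence Θ Η)

/-- The arrow `Η_{ji}(h⁻¹) Φ_{αi}(x)⁻¹` for `p = [α, x, h]` and `a = (α, i)`. -/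
def flipArr (a : ι × κ) (j : κ) (p : D.Total) : A :=
  G.mul (Η.map j a.2 (H.inv (D.fib a.1 p))) (G.inv (L.Φ a (D.proj p)))

/-- The map `[α, x, h] ↦ [j, s h, Η_{ji}(h⁻¹) Φ_{αi}(x)⁻¹]`. -/
def flip (p : D.Total) : E.Total :=
  E.pt (E.cover (D.momentum p)).choose
    (D.momentum p, L.flipArr (L.R.cover (D.proj p)).choose (E.cover (D.momentum p)).choose p)

variable {L} {a b : ι × κ} {i j : κ} {p : D.Total}

theorem s_inv_fib (ha : D.proj p ∈ L.R.U a) :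
    H.s (H.inv (D.fib a.1 p)) = D.mom a.1 (D.proj p) := by
  rw [H.s_inv, TrivData.t_fib (L.R.subset _ _ ha)]

theorem s_inv_fib_mem (ha : D.proj p ∈ L.R.U a) :
    H.s (H.inv (D.fib a.1 p)) ∈ E.U a.2 :=
  s_inv_fib ha ▸ L.R.mapsTo _ _ ha

theorem t_inv_fib (ha : D.proj p ∈ L.R.U a) :
    H.t (H.inv (D.fib a.1 p)) = D.momentum p := by
  rw [H.t_inv, TrivData.s_fib (L.R.subset _ _ ha)]

theorem flipArr_composable (ha : D.proj p ∈ L.R.U a) (hj : D.momentum p ∈ E.U j) :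
    G.s (Η.map j a.2 (H.inv (D.fib a.1 p))) = G.t (G.inv (L.Φ a (D.proj p))) := by
  rw [Η.s_map _ _ _ (s_inv_fib_mem ha) ((t_inv_fib ha).symm ▸ hj), G.t_inv, L.s_Φ _ _ ha,
    s_inv_fib ha]

theorem t_flipArr (ha : D.proj p ∈ L.R.U a) (hj : D.momentum p ∈ E.U j) :
    E.mom j (D.momentum p) = G.t (L.flipArr a j p) := by
  rw [flipArr, G.t_mul _ _ (flipArr_composable ha hj),
    Η.t_map _ _ _ (s_inv_fib_mem ha) ((t_inv_fib ha).symm ▸ hj), t_inv_fib ha]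

theorem s_flipArr (ha : D.proj p ∈ L.R.U a) (hj : D.momentum p ∈ E.U j) :
    G.s (L.flipArr a j p) = D.proj p := by
  rw [flipArr, G.s_mul _ _ (flipArr_composable ha hj), G.s_inv, L.t_Φ _ _ ha]

theorem flipArr_change_left (ha : D.proj p ∈ L.R.U a) (hi : D.momentum p ∈ E.U i)
    (hj : D.momentum p ∈ E.U j) :
    L.flipArr a i p = G.mul (E.trans i j (D.momentum p)) (L.flipArr a j p) := by
  have hs := s_inv_fib_mem ha
  have ht := t_inv_fib ha
  rw [flipArr, flipArr, Η.map_trans_left a.2 i j _ hs (ht.symm ▸ hi) (ht.symm ▸ hj), ht,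
    G.mul_assoc]
  · rw [E.s_trans _ _ _ hi hj, Η.t_map _ _ _ hs (ht.symm ▸ hj), ht]
  · exact flipArr_composable ha hj

/-- Passing from `b` to `a` inserts `Η(Φ_{βα}(x))` to the right of `Η(h⁻¹)`, while condition (b)
inserts its inverse to the left of `Φ_b(x)⁻¹`; the two cancel. -/
theorem flipArr_change_right (ha : D.proj p ∈ L.R.U a) (hb : D.proj p ∈ L.R.U b)
    (hj : D.momentum p ∈ E.U j) : L.flipArr a j p = L.flipArr b j p := by
  have ha' := L.R.subset _ _ ha
  have hb' := L.R.subset _ _ hb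
  have hbs := s_inv_fib_mem hb
  have hbt := t_inv_fib hb
  have hc : H.s (D.trans a.1 b.1 (D.proj p)) = H.t (D.fib b.1 p) := by
    rw [D.s_trans _ _ _ ha' hb', TrivData.t_fib hb']
  have hc' : H.s (H.inv (D.fib b.1 p)) = H.t (H.inv (D.trans a.1 b.1 (D.proj p))) := by
    rw [H.s_inv, H.t_inv, hc]
  have h1 := L.Φ_trans a b _ ha hb
  have h2 : H.s (D.trans a.1 b.1 (D.proj p)) ∈ E.U b.2 := by
    rw [D.s_trans _ _ _ ha' hb']; exact L.R.mapsTo _ _ hb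
  have h3 : H.t (D.trans a.1 b.1 (D.proj p)) ∈ E.U a.2 := by
    rw [D.t_trans _ _ _ ha' hb']; exact L.R.mapsTo _ _ ha
  have h2' : H.t (D.trans b.1 a.1 (D.proj p)) ∈ E.U b.2 := by
    rw [D.t_trans _ _ _ hb' ha']; exact L.R.mapsTo _ _ hb
  have h3' : H.s (D.trans b.1 a.1 (D.proj p)) ∈ E.U a.2 := by
    rw [D.s_trans _ _ _ hb' ha']; exact L.R.mapsTo _ _ ha
  have hinv : H.inv (D.trans a.1 b.1 (D.proj p)) = D.trans b.1 a.1 (D.proj p) := by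
    apply H.inv_eq_of_mul_eq_one
    · rw [D.s_trans _ _ _ ha' hb', D.t_trans _ _ _ hb' ha']
    · rw [← D.cocycle _ _ _ _ ha' hb' ha', D.trans_self _ _ ha', D.t_trans _ _ _ ha' hb']
  rw [hinv] at hc'
  have h4 : G.s (L.Φ b (D.proj p)) = G.t (Η.map b.2 a.2 (D.trans b.1 a.1 (D.proj p))) := by
    rw [L.s_Φ _ _ hb, Η.t_map _ _ _ h3' h2', D.t_trans _ _ _ hb' ha']
  have h5 : G.inv (L.Φ a (D.proj p)) =
      G.mul (G.inv (Η.map b.2 a.2 (D.trans b.1 a.1 (D.proj p)))) (G.inv (L.Φ b (D.proj p))) := by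
    rw [h1]
    exact G.inv_mul_rev h4
  have h6 : G.s (Η.map j b.2 (H.inv (D.fib b.1 p))) =
      G.t (Η.map b.2 a.2 (D.trans b.1 a.1 (D.proj p))) := by
    rw [flipArr_composable hb hj, G.t_inv, h4]
  rw [flipArr, flipArr, TrivData.fib_trans ha' hb', H.inv_mul_rev hc, hinv,
    Η.map_mul a.2 b.2 j _ _ hbs (hbt.symm ▸ hj) h3' h2' hc', h5, ← G.mul_assoc,
    G.mul_inv_cancel_right h6]
  · rw [G.s_mul _ _ h6, G.t_inv]
  · rw [G.s_inv, G.t_inv, h4]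

theorem flip_eq (ha : D.proj p ∈ L.R.U a) (hj : D.momentum p ∈ E.U j) :
    L.flip p = E.pt j (D.momentum p, L.flipArr a j p) := by
  have hc := (L.R.cover (D.proj p)).choose_spec
  have hd := (E.cover (D.momentum p)).choose_spec
  rw [flip, TrivData.pt_eq_pt_iff hd hj (t_flipArr hc hd) (t_flipArr ha hj),
    flipArr_change_right hc ha hd, flipArr_change_left ha hd hj]

variable (L) in
theorem proj_flip (p : D.Total) : E.proj (L.flip p) = D.momentum p := TrivData.proj_pt _ _

theorem fib_flip (ha : D.proj p ∈ L.R.U a) (hj : D.momentum p ∈ E.U j) :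
    E.fib j (L.flip p) = L.flipArr a j p := by
  rw [flip_eq ha hj, TrivData.fib_pt hj (t_flipArr ha hj)]

variable (L) in
theorem momentum_flip (p : D.Total) : E.momentum (L.flip p) = D.proj p := by
  obtain ⟨a, ha⟩ := L.R.cover (D.proj p)
  obtain ⟨j, hj⟩ := E.cover (D.momentum p)
  rw [flip_eq ha hj, TrivData.momentum_pt hj (t_flipArr ha hj), s_flipArr ha hj]

/-- Only multiplicativity of `Η` is at work: `Η((h k)⁻¹) = Η(k⁻¹) Η(h⁻¹)`. -/
theorem flip_actR {k : B} (hk : D.momentum p = H.t k) :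
    L.flip (D.actR p k) = Η.actL (H.inv k) (L.flip p) := by
  obtain ⟨a, ha⟩ := L.R.cover (D.proj p)
  obtain ⟨j, hj⟩ := E.cover (D.momentum p)
  obtain ⟨l, hl⟩ := E.cover (H.s k)
  have ha' := L.R.subset _ _ ha
  have ha2 : D.proj (D.actR p k) ∈ L.R.U a := by rwa [TrivData.proj_actR]
  have hl2 : D.momentum (D.actR p k) ∈ E.U l := by rwa [TrivData.momentum_actR hk]
  have h1 : H.s (H.inv k) = E.proj (L.flip p) := by rw [H.s_inv, proj_flip, hk]
  have h2 : H.s (H.inv k) ∈ E.U j := by rw [h1, proj_flip]; exact hj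
  have h3 : H.t (H.inv k) ∈ E.U l := by rwa [H.t_inv]
  have h4 : H.s (D.fib a.1 p) = H.t k := (TrivData.s_fib ha').trans hk
  have hs := s_inv_fib_mem ha
  have ht := t_inv_fib ha
  have h5 : H.s (H.inv k) = H.t (H.inv (D.fib a.1 p)) := by rw [ht, H.s_inv, hk]
  refine TrivData.eq_of_fib_eq (α := l) (by rwa [proj_flip])
    (by rw [proj_flip, Η.proj_actL h1, H.t_inv, TrivData.momentum_actR hk]) ?_
  rw [fib_flip ha2 hl2, Η.fib_actL h2 h1 h3, fib_flip ha hj, flipArr, flipArr,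
    TrivData.fib_actR ha' hk, TrivData.proj_actR, H.inv_mul_rev h4,
    Η.map_mul a.2 j l _ _ h2 h3 hs (ht.symm ▸ hj) h5, G.mul_assoc]
  · rw [Η.s_map _ _ _ h2 h3, Η.t_map _ _ _ hs (ht.symm ▸ hj), h5]
  · exact flipArr_composable ha hj

/-- By condition (c), `Η(Θ(g)⁻¹) = Φ_a(s g)⁻¹ g⁻¹ Φ_b(t g)`. The last factor cancels against the
`Φ_b(t g)⁻¹` of the flipped arrow, leaving `Φ_a(s g)⁻¹` followed by `g⁻¹`. -/
theorem flip_actL {g : A} (hg : G.s g = D.proj p) :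
    L.flip (Θ.actL g p) = E.actR (L.flip p) (G.inv g) := by
  obtain ⟨a, ha⟩ := L.R.cover (D.proj p)
  obtain ⟨b, hb⟩ := L.R.cover (G.t g)
  obtain ⟨j, hj⟩ := E.cover (D.momentum p)
  have ha' := L.R.subset _ _ ha
  have hb' := L.R.subset _ _ hb
  have hga : G.s g ∈ L.R.U a := hg ▸ ha
  have hga' := L.R.subset _ _ hga
  have hb2 : D.proj (Θ.actL g p) ∈ L.R.U b := by rwa [Θ.proj_actL hg]
  have hj2 : D.momentum (Θ.actL g p) ∈ E.U j := by rwa [Θ.momentum_actL hg]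
  have h1 : E.momentum (L.flip p) = G.t (G.inv g) := by rw [momentum_flip, G.t_inv, hg]
  have hpj : E.proj (L.flip p) ∈ E.U j := by rwa [proj_flip]
  have hs := s_inv_fib_mem ha
  have ht := t_inv_fib ha
  have h2 : H.s (Θ.map b.1 a.1 g) = H.t (D.fib a.1 p) := Θ.s_map_eq_t_fib hga' hg hb'
  have h3 : H.s (Θ.map b.1 a.1 g) ∈ E.U a.2 := by
    rw [Θ.s_map _ _ _ hga' hb']; exact L.R.mapsTo _ _ hga
  have h4 : H.t (Θ.map b.1 a.1 g) ∈ E.U b.2 := by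
    rw [Θ.t_map _ _ _ hga' hb']; exact L.R.mapsTo _ _ hb
  have h5 : H.s (H.inv (D.fib a.1 p)) = H.t (H.inv (Θ.map b.1 a.1 g)) := by
    rw [H.s_inv, H.t_inv, h2]
  have h6 : G.s (G.inv (L.Φ b (G.t g))) = G.t g := by rw [G.s_inv, L.t_Φ _ _ hb]
  have h7 : G.s (G.mul (G.inv (L.Φ b (G.t g))) g) = G.t (L.Φ a (G.s g)) := by
    rw [G.s_mul _ _ h6, L.t_Φ _ _ hga]
  have h8 : G.inv (Η.map b.2 a.2 (Θ.map b.1 a.1 g)) =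
      G.mul (G.inv (L.Φ a (G.s g))) (G.mul (G.inv g) (L.Φ b (G.t g))) := by
    have := L.comp_eq a b g hga hb
    change Η.map b.2 a.2 (Θ.map b.1 a.1 g) = _ at this
    rw [this, G.inv_mul_rev h7, G.inv_mul_rev h6, G.inv_inv]
  have h9 : G.s (G.inv g) = G.t (L.Φ b (G.t g)) := by rw [G.s_inv, L.t_Φ _ _ hb]
  have h10 : G.s (G.inv (L.Φ a (G.s g))) = G.t (G.inv g) := by
    rw [G.s_inv, G.t_inv, L.t_Φ _ _ hga]
  have h11 := flipArr_composable ha hj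
  have h12 : G.s (G.mul (G.inv (L.Φ a (G.s g))) (G.inv g)) = G.t (L.Φ b (G.t g)) := by
    rw [G.s_mul _ _ h10, h9]
  refine TrivData.eq_of_fib_eq (α := j) (by rwa [proj_flip])
    (by rw [proj_flip, TrivData.proj_actR, proj_flip, Θ.momentum_actL hg]) ?_
  rw [fib_flip hb2 hj2, TrivData.fib_actR hpj h1, fib_flip ha hj, flipArr, flipArr,
    Θ.fib_actL hga' hg hb', H.inv_mul_rev h2, Θ.proj_actL hg,
    Η.map_mul b.2 a.2 j _ _ hs (ht.symm ▸ hj) (by rwa [H.s_inv]) (by rwa [H.t_inv]) h5,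
    Η.map_inv h3 h4, h8, ← hg, ← G.mul_assoc _ _ _ h10 h9, G.mul_assoc, G.mul_inv_cancel_right h12,
    G.mul_assoc _ _ _ (by rw [h11, hg]) h10]
  · rw [h11, G.t_mul _ _ h12, G.t_mul _ _ h10, hg]
  · rw [G.s_mul _ _ h12, G.t_inv]

theorem contMDiff_flip {σ : SmoothStructure D.Total} {τ : SmoothStructure E.Total}
    (hσ : D.IsGluedStructure σ) (hτ : E.IsGluedStructure τ) :
    ContMDiff (𝓡 (D.total σ).dim) (𝓡 (E.total τ).dim) ∞ (M := D.total σ) (M' := E.total τ)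
      L.flip := by
  intro p
  obtain ⟨a, ha⟩ := L.R.cover (D.proj p)
  obtain ⟨j, hj⟩ := E.cover (D.momentum p)
  let S : Set (D.total σ) := D.proj ⁻¹' L.R.U a ∩ D.momentum ⁻¹' E.U j
  have hS : IsOpen S := ((L.R.isOpen_U a).preimage hσ.contMDiff_proj.continuous).inter
    ((E.isOpen_U j).preimage hσ.contMDiff_momentum.continuous)
  have h1 : ContMDiffOn (𝓡 (D.total σ).dim) (𝓡 B.dim) ∞ (M := D.total σ)
      (fun p => H.inv (D.fib a.1 p)) S :=
    H.contMDiffOn_inv ((hσ.contMDiffOn_fib a.1).mono fun p hp => L.R.subset _ _ hp.1)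
  have h2 : ContMDiffOn (𝓡 (D.total σ).dim) (𝓡 A.dim) ∞ (M := D.total σ)
      (fun p => L.flipArr a j p) S := by
    refine G.contMDiffOn_mul ((Η.map_smooth a.2 j).comp h1 fun p hp => ?_)
      (G.contMDiffOn_inv ((L.Φ_smooth a).comp hσ.contMDiff_proj.contMDiffOn fun p hp => hp.1))
      fun p hp => flipArr_composable hp.1 hp.2
    exact ⟨s_inv_fib_mem hp.1, mem_of_eq_of_mem (t_inv_fib hp.1) hp.2⟩
  have h3 : ContMDiffOn (𝓡 (D.total σ).dim) (𝓡 (E.total τ).dim) ∞ (M := D.total σ)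
      (M' := E.total τ) L.flip S :=
    hτ.contMDiffOn_of_fib j (fun p hp => mem_of_eq_of_mem (L.proj_flip p) hp.2)
      (hσ.contMDiff_momentum.contMDiffOn.congr fun p _ => L.proj_flip p)
      (h2.congr fun p hp => fib_flip hp.1 hp.2)
  exact h3.contMDiffAt (hS.mem_nhds ⟨ha, hj⟩)

theorem isMoritaEquivalence (L : LocalMoritaEquivalence Θ Η) {σ : SmoothStructure D.Total} (hσ : D.IsGluedStructure σ) :
    IsMoritaEquivalence G H (D.total σ) D.proj D.momentum Θ.actL D.actR := by
  obtain ⟨τ, hτ⟩ := TrivData.exists_isGluedStructure E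
  refine ⟨Θ.isGeneralizedMorphism hσ, isLeftPrincipal_of_equivariant
    (Θ.isGeneralizedMorphism hσ) hτ.isRightPrincipal (f := L.flip) (f' := L.symm.flip)
    (contMDiff_flip hσ hτ) (contMDiff_flip hτ hσ) L.proj_flip L.momentum_flip L.symm.proj_flip
    L.symm.momentum_flip (fun g p h => flip_actL h) (fun q g h => flip_actR h) fun p k h => ?_⟩
  have h1 : H.s (H.inv k) = E.proj (L.flip p) :=
    (H.s_inv k).trans (h.symm.trans (L.proj_flip p).symm)
  refine (congrArg L.symm.flip (flip_actR h)).trans ((flip_actL h1).trans ?_)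
  rw [H.inv_inv]

end LocalMoritaEquivalence

/-! ## Principal bundles of Lie groups and their gauge groupoids -/

/-- A principal bundle with structure group `A` and division map `div`: `p (div p q) = q` for two
points of a fibre. -/
structure IsGroupBundle {A : Mfd.{u₁}} [Group A] {P : Mfd.{u₂}} {M : Mfd.{u₃}} (π : P → M)
    (act : P → A → P) (div : P → P → A) : Prop where
  proj_subm : IsSurjSubmersion π
  act_smooth : ContMDiff (prodModel P A) (𝓡 P.dim) ∞ (fun z : P × A => act z.1 z.2)
  act_one : ∀ p, act p 1 = p
  act_mul : ∀ p g h, act p (g * h) = act (act p g) h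
  proj_act : ∀ p g, π (act p g) = π p
  div_smooth : ContMDiffOn (prodModel P P) (𝓡 A.dim) ∞ (fun z : P × P => div z.1 z.2)
    {z | π z.1 = π z.2}
  act_div : ∀ p q, π p = π q → act p (div p q) = q
  div_act : ∀ p g, div p (act p g) = g

/-- Over the one-point base all composability conditions are vacuous, so the action is smooth on the
whole product. -/
theorem IsRightPrincipal.exists_isGroupBundle {A : Mfd.{u₁}} [Group A] [LieGroup (𝓡 A.dim) ∞ A]
    {P : Mfd.{u₂}} {M : Mfd.{u₃}} {π : P → M} {act : P → A → P}
    (h : IsRightPrincipal (LieGroupoid.ofLieGroup A) P M π (fun _ => default) act) :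
    ∃ div, IsGroupBundle π act div := by
  obtain ⟨div, h1, -, h2, h3⟩ := h.exists_div
  refine ⟨div, h.proj_subm, ?_, h.isAction.act_one, fun p g k => h.isAction.act_mul p g k rfl rfl,
    fun p g => h.proj_act p g rfl, h1, h2, fun p g => h3 p g rfl⟩
  have h4 := h.isAction.act_smooth
  have h5 : {z : P × A | (default : Mfd.point) = (LieGroupoid.ofLieGroup A).t z.2} = univ :=
    eq_univ_of_forall fun z => rfl
  rwa [h5, contMDiffOn_univ] at h4

/-! ### Calculus of the division map -/

section

variable {E₀ H₀ N : Type*} [NormedAddCommGroup E₀] [NormedSpace ℝ E₀] [TopologicalSpace H₀]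
  {J : ModelWithCorners ℝ E₀ H₀} [TopologicalSpace N] [ChartedSpace H₀ N]

namespace IsGroupBundle

variable {A : Mfd.{u₁}} [Group A] {P : Mfd.{u₂}} {M : Mfd.{u₃}} {π : P → M}
    {act : P → A → P} {div : P → P → A}

/-- Freeness of the action; the identities for `div` that follow are obtained by checking that both
sides move `p` to the same point. -/
theorem eq_div (h : IsGroupBundle π act div) {p q : P} {g : A} (e : act p g = q) : g = div p q := by
  rw [← e, h.div_act]

theorem div_self (h : IsGroupBundle π act div) (p : P) : div p p = 1 := (h.eq_div (h.act_one p)).symm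

theorem div_mul_div (h : IsGroupBundle π act div) {p q r : P} (h₁ : π p = π q) (h₂ : π q = π r) :
    div p q * div q r = div p r :=
  h.eq_div (by rw [h.act_mul, h.act_div p q h₁, h.act_div q r h₂])

theorem div_act_left (h : IsGroupBundle π act div) {p q : P} (h₁ : π p = π q) (g : A) :
    div (act p g) q = g⁻¹ * div p q :=
  (h.eq_div (by rw [h.act_mul, ← h.act_mul p, mul_inv_cancel, h.act_one, h.act_div p q h₁])).symm

theorem div_act_right (h : IsGroupBundle π act div) {p q : P} (h₁ : π p = π q) (g : A) :
    div p (act q g) = div p q * g :=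
  (h.eq_div (by rw [h.act_mul, h.act_div p q h₁])).symm

theorem contMDiffOn_act (h : IsGroupBundle π act div) {f : N → P} {g : N → A} {S : Set N}
    (hf : ContMDiffOn J (𝓡 P.dim) ∞ f S)
    (hg : ContMDiffOn J (𝓡 A.dim) ∞ g S) :
    ContMDiffOn J (𝓡 P.dim) ∞ (fun z => act (f z) (g z)) S :=
  h.act_smooth.comp_contMDiffOn (hf.prodMk hg)

theorem contMDiffOn_div (h : IsGroupBundle π act div) {f g : N → P} {S : Set N}
    (hf : ContMDiffOn J (𝓡 P.dim) ∞ f S)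
    (hg : ContMDiffOn J (𝓡 P.dim) ∞ g S) (hfg : ∀ z ∈ S, π (f z) = π (g z)) :
    ContMDiffOn J (𝓡 A.dim) ∞ (fun z => div (f z) (g z)) S :=
  h.div_smooth.comp (hf.prodMk hg) hfg

theorem proj_smooth (h : IsGroupBundle π act div) : ContMDiff (𝓡 P.dim) (𝓡 M.dim) ∞ π :=
  h.proj_subm.2.contMDiff

end IsGroupBundle

end

/-- `q : P × P → Q` presents `Q` as the quotient manifold by the diagonal action. -/
structure IsGaugeQuotient {A : Mfd.{u₁}} {P : Mfd.{u₂}} {Q : Mfd.{u₃}}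
    (act : P → A → P) (q : P × P → Q) : Prop where
  surj : Surjective q
  subm : Manifold.IsSubmersion (prodModel P P) (𝓡 Q.dim) ∞ q
  q_eq_iff : ∀ p₁ p₂ p₁' p₂', q (p₁, p₂) = q (p₁', p₂') ↔
    ∃ g : A, p₁' = act p₁ g ∧ p₂' = act p₂ g

/-- The diagonal action on `P × P`. -/
def IsGroupBundle.diagonalSetoid {A : Mfd.{u₁}} [Group A] {P : Mfd.{u₂}} {M : Mfd.{u₃}} {π : P → M}
    {act : P → A → P} {div : P → P → A} (h : IsGroupBundle π act div) : Setoid (P × P) where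
  r z w := ∃ g : A, w.1 = act z.1 g ∧ w.2 = act z.2 g
  iseqv := by
    refine ⟨fun z => ⟨1, (h.act_one _).symm, (h.act_one _).symm⟩, ?_, ?_⟩
    · rintro z w ⟨g, h1, h2⟩
      refine ⟨g⁻¹, ?_, ?_⟩
      · rw [h1, ← h.act_mul, mul_inv_cancel, h.act_one]
      · rw [h2, ← h.act_mul, mul_inv_cancel, h.act_one]
    · rintro z w v ⟨g, h1, h2⟩ ⟨k, h3, h4⟩
      exact ⟨g * k, by rw [h3, h1, h.act_mul], by rw [h4, h2, h.act_mul]⟩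

/-- Where the source lies in the domain of a local section `σ`, each class is normalized to a unique
representative `(p, σ y)`. This identifies the piece with `V × P`; changing `σ` acts on the second
factor by a smooth family of group elements. -/
theorem IsGroupBundle.exists_isGaugeQuotient {A : Mfd.{u₁}} [Group A] {P : Mfd.{u₂}} {M : Mfd.{u₃}}
    [Nonempty M] {π : P → M} {act : P → A → P} {div : P → P → A} (h : IsGroupBundle π act div) :
    ∃ (Q : Mfd.{u₂}) (q : P × P → Q), IsGaugeQuotient act q := by
  -- Needed for the constant map from `P` to the point to be a surjective submersion.
  have hP : Nonempty P := ⟨(h.proj_subm.1 (Classical.arbitrary M)).choose⟩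
  let cl : P × P → Quotient h.diagonalSetoid := Quotient.mk _
  have hcl : ∀ z w, cl z = cl w ↔ ∃ g : A, w.1 = act z.1 g ∧ w.2 = act z.2 g := fun z w =>
    Quotient.eq (r := h.diagonalSetoid)
  let src : Quotient h.diagonalSetoid → M := Quotient.lift (fun z => π z.2) (by
    rintro z w ⟨g, -, h2⟩
    rw [h2, h.proj_act])
  choose V hV hpV σ hσ hσp hσV using fun p => h.proj_subm.exists_localSection p
  -- The normalized coordinates: `[p₁, p₂] = [p₁ g, σ y]` with `y = π p₂` and `g` the element
  -- carrying `p₂` to `σ y`.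
  let co : P → Quotient h.diagonalSetoid → M × P := fun p x =>
    (src x, act x.out.1 (div x.out.2 (σ p (src x))))
  have hco : ∀ p z, π z.2 ∈ V p → co p (cl z) = (π z.2, act z.1 (div z.2 (σ p (π z.2)))) := by
    intro p z hz
    obtain ⟨g, h1, h2⟩ := (hcl (cl z).out z).1 (Quotient.out_eq _)
    refine Prod.ext rfl ?_
    have h3 : π (cl z).out.2 = π (σ p (π z.2)) := by rw [hσV p _ hz, h2, h.proj_act]
    change act (cl z).out.1 (div (cl z).out.2 (σ p (π z.2))) = _
    conv_rhs => rw [h1]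
    rw [show div z.2 (σ p (π z.2)) = g⁻¹ * div (cl z).out.2 (σ p (π z.2)) by
      rw [← h.div_act_left h3, ← h2], ← h.act_mul, mul_inv_cancel_left]
  let b : P → PartialEquiv (Quotient h.diagonalSetoid) (M × P) := fun p =>
    { toFun := co p
      invFun := fun w => cl (w.2, σ p w.1)
      source := src ⁻¹' V p
      -- The trivial equation writes `V p × P` as a fibre product over the point, the form required
      -- by `exists_subsetChart_fibreProduct`.
      target := {w | w.1 ∈ V p ∧ (default : Mfd.point) = default}
      map_source' := fun x hx => ⟨hx, rfl⟩
      map_target' := fun w hw => by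
        change π (σ p w.1) ∈ V p
        rw [hσV p _ hw.1]; exact hw.1
      left_inv' := by
        intro x hx
        induction x using Quotient.inductionOn with
        | _ z =>
          have hz : π z.2 ∈ V p := hx
          change cl ((co p (cl z)).2, σ p (co p (cl z)).1) = cl z
          rw [hco p z hz, eq_comm, hcl]
          exact ⟨_, rfl, (h.act_div _ _ (hσV p _ hz).symm).symm⟩
      right_inv' := by
        intro w hw
        have h1 : π (σ p w.1) = w.1 := hσV p _ hw.1
        have := hco p (w.2, σ p w.1) (by rw [h1]; exact hw.1)
        rw [this]
        simp only [h1]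
        rw [h.div_self, h.act_one] }
  have hset : ∀ p p', (b p).target ∩ (b p).symm ⁻¹' (b p').source =
      (b p).target ∩ {w : M × P | w.1 ∈ V p'} := by
    intro p p'
    ext w
    refine and_congr_right fun hw => ?_
    change π (σ p w.1) ∈ V p' ↔ w.1 ∈ V p'
    rw [hσV p _ hw.1]
  obtain ⟨top, chs, man, hb⟩ := exists_smoothStructure_of_gluing (I := prodModel M P)
    (M.dim + (P.dim - Mfd.point.dim)) b
    (fun x => by
      obtain ⟨p, hp⟩ := h.proj_subm.1 (src x)
      exact ⟨p, (hp ▸ hpV p : src x ∈ V p)⟩)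
    (fun p p' => ⟨_, (hV p').preimage continuous_fst, hset p p'⟩)
    (fun p p' => by
      rw [hset]
      have h1 : ContMDiffOn (prodModel M P) (𝓡 P.dim) ∞
          (fun w : M × P => act w.2 (div (σ p w.1) (σ p' w.1)))
          ((b p).target ∩ {w : M × P | w.1 ∈ V p'}) := by
        refine h.contMDiffOn_act contMDiff_snd.contMDiffOn (h.contMDiffOn_div
          ((hσ p).comp contMDiff_fst.contMDiffOn fun w hw => hw.1.1)
          ((hσ p').comp contMDiff_fst.contMDiffOn fun w hw => hw.2) fun w hw => ?_)
        exact (hσV p _ hw.1.1).trans (hσV p' _ hw.2).symm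
      refine (contMDiff_fst.contMDiffOn.prodMk h1).congr fun w hw => ?_
      have h2 : π (σ p w.1) = w.1 := hσV p _ hw.1.1
      have := hco p' (w.2, σ p w.1) (by rw [h2]; exact hw.2)
      change co p' (cl (w.2, σ p w.1)) = _
      rw [this]
      simp only [h2])
    (fun p w hw => exists_subsetChart_fibreProduct (isSurjSubmersion_point P).2 (hV p)
      (m := fun _ => default) contMDiffOn_const w hw.1 rfl)
  let Q : Mfd.{u₂} := ⟨Quotient h.diagonalSetoid, ⟨_, top, chs, man⟩⟩
  have hsm : ContMDiff (prodModel P P) (𝓡 Q.dim) ∞ (M' := Q) cl := by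
    intro z₀
    let S : Set (P × P) := {z | π z.2 ∈ V z₀.2}
    have hS : IsOpen S := (hV z₀.2).preimage (h.proj_smooth.continuous.comp continuous_snd)
    have h0 : ContMDiff (prodModel P P) (𝓡 M.dim) ∞ (fun z : P × P => π z.2) :=
      h.proj_smooth.comp contMDiff_snd
    have h1 : ContMDiffOn (prodModel P P) (prodModel M P) ∞
        (fun z : P × P => (π z.2, act z.1 (div z.2 (σ z₀.2 (π z.2))))) S := by
      refine h0.contMDiffOn.prodMk (h.contMDiffOn_act contMDiff_fst.contMDiffOn
        (h.contMDiffOn_div contMDiff_snd.contMDiffOn ((hσ z₀.2).comp h0.contMDiffOn fun z hz => hz)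
          fun z hz => (hσV z₀.2 _ hz).symm))
    have h2 : ContMDiffOn (prodModel P P) (𝓡 Q.dim) ∞ (M' := Q) cl S := by
      refine ((hb z₀.2).2.2.comp h1 fun z hz => ⟨hz, rfl⟩).congr fun z hz => ?_
      have := (b z₀.2).left_inv (x := cl z) hz
      rw [← this]
      exact congrArg (b z₀.2).symm (hco z₀.2 z hz)
    exact h2.contMDiffAt (hS.mem_nhds (hpV z₀.2))
  refine ⟨Q, cl, ⟨Quotient.mk_surjective, ?_, fun p₁ p₂ p₁' p₂' => hcl _ _⟩⟩
  refine isSubmersion_of_sections hsm fun z => ?_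
  have hz : cl z ∈ (b z.2).source := hpV z.2
  -- The normalized representative is a section of the quotient map. It passes through `z` because
  -- the local section attached to `z.2` takes the value `z.2` at `π z.2`.
  refine ⟨fun x => ((co z.2 x).2, σ z.2 (co z.2 x).1), ?_, ?_, ?_⟩
  · have h1 : ContMDiffOn (𝓡 Q.dim) (prodModel P P) ∞ (M := Q)
        (fun x => ((co z.2 x).2, σ z.2 (co z.2 x).1)) (b z.2).source :=
      (contMDiff_snd.comp_contMDiffOn (hb z.2).2.1).prodMk ((hσ z.2).comp
        (contMDiff_fst.comp_contMDiffOn (hb z.2).2.1) fun x hx => hx)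
    exact h1.contMDiffAt ((hb z.2).1.mem_nhds hz)
  · simp only [hco z.2 z hz, hσp, h.div_self, h.act_one]
  · exact Filter.eventually_of_mem ((hb z.2).1.mem_nhds hz) fun x hx => (b z.2).left_inv hx

/-! ### The gauge groupoid on the quotient manifold -/

section quotient

variable {A : Mfd.{u₁}} {P : Mfd.{u₂}} {M : Mfd.{u₃}} {Q : Mfd.{u₄}} {π : P → M}
  {act : P → A → P} {div : P → P → A} {q : P × P → Q}

/-- Near any class, `f` is the composite of `f ∘ q` with a local section of the submersion `q`. -/
theorem IsGaugeQuotient.contMDiff_of_comp (hq : IsGaugeQuotient act q) {N : Mfd.{u₅}} {f : Q → N}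
    (hf : ContMDiff (prodModel P P) (𝓡 N.dim) ∞ (fun z => f (q z))) :
    ContMDiff (𝓡 Q.dim) (𝓡 N.dim) ∞ f := by
  intro x
  obtain ⟨z, rfl⟩ := hq.surj x
  obtain ⟨U, hU, hxU, σ, hσ, -, hσU⟩ := (hq.subm.isSubmersionAt z).exists_localSection
  exact ((hf.comp_contMDiffOn hσ).congr fun y hy => by rw [comp_apply, hσU y hy]).contMDiffAt
    (hU.mem_nhds hxU)

theorem IsGaugeQuotient.act_eq (hq : IsGaugeQuotient act q) (p₁ p₂ : P) (g : A) :
    q (act p₁ g, act p₂ g) = q (p₁, p₂) :=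
  ((hq.q_eq_iff _ _ _ _).2 ⟨g, rfl, rfl⟩).symm

theorem IsGaugeQuotient.secondCountableTopology (hq : IsGaugeQuotient act q)
    [SecondCountableTopology P] : SecondCountableTopology Q := by
  have hopen : IsOpenMap q := hq.subm.isOpenMap
  exact (⟨hq.surj, hq.subm.contMDiff.continuous, hopen⟩ :
    IsOpenQuotientMap q).isQuotientMap.secondCountableTopology hopen

variable [Group A]

/-- The structure maps are defined on arbitrary chosen representatives. Once independence of the
choice is known (`hs`, `ht`, `hone`, `hinv`, `hmul`), every axiom is an identity for `div`, and
smoothness comes from local sections of `q` and `π`. -/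
theorem IsGaugeQuotient.exists_gaugeGroupoid (hq : IsGaugeQuotient act q)
    (h : IsGroupBundle π act div) :
    ∃ K : LieGroupoid Q M, IsGaugeGroupoid K π act q := by
  let rep : Q → P × P := surjInv hq.surj
  have hrep : ∀ z, ∃ g : A, z.1 = act (rep (q z)).1 g ∧ z.2 = act (rep (q z)).2 g := fun z =>
    (hq.q_eq_iff _ _ _ _).1 (surjInv_eq hq.surj (q z))
  let s : Q → M := fun x => π (rep x).2
  let t : Q → M := fun x => π (rep x).1
  let one : M → Q := fun x => q (surjInv h.proj_subm.1 x, surjInv h.proj_subm.1 x)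
  let mul : Q → Q → Q := fun x y => q (act (rep x).1 (div (rep x).2 (rep y).1), (rep y).2)
  let inv : Q → Q := fun x => q ((rep x).2, (rep x).1)
  have hs : ∀ p₁ p₂, s (q (p₁, p₂)) = π p₂ := fun p₁ p₂ => by
    obtain ⟨g, -, h2⟩ := hrep (p₁, p₂)
    exact ((congrArg π h2).trans (h.proj_act _ _)).symm
  have ht : ∀ p₁ p₂, t (q (p₁, p₂)) = π p₁ := fun p₁ p₂ => by
    obtain ⟨g, h1, -⟩ := hrep (p₁, p₂)
    exact ((congrArg π h1).trans (h.proj_act _ _)).symm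
  have hone : ∀ p, one (π p) = q (p, p) := fun p => by
    have h1 : π (surjInv h.proj_subm.1 (π p)) = π p := surjInv_eq _ _
    exact (hq.q_eq_iff _ _ _ _).2 ⟨_, (h.act_div _ _ h1).symm, (h.act_div _ _ h1).symm⟩
  have hinv : ∀ p₁ p₂, inv (q (p₁, p₂)) = q (p₂, p₁) := fun p₁ p₂ => by
    obtain ⟨g, h1, h2⟩ := hrep (p₁, p₂)
    exact (hq.q_eq_iff _ _ _ _).2 ⟨g, h2, h1⟩
  have hmul : ∀ p₁ p₂ p₃ p₄, π p₂ = π p₃ →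
      mul (q (p₁, p₂)) (q (p₃, p₄)) = q (act p₁ (div p₂ p₃), p₄) := fun p₁ p₂ p₃ p₄ e => by
    obtain ⟨g, h1, h2⟩ := hrep (p₁, p₂)
    obtain ⟨k, h3, h4⟩ := hrep (p₃, p₄)
    -- Replacing the representatives by their translates by `g` and `k` changes the product
    -- representative by the diagonal action of `k`. General pairs `a`, `b` are used so that the
    -- chosen representatives remain fixed when the translates are rewritten.
    have key : ∀ (a b : P × P), π (act a.2 g) = π (act b.1 k) → q (act a.1 (div a.2 b.1), b.2) =
        q (act (act a.1 g) (div (act a.2 g) (act b.1 k)), act b.2 k) := fun a b e => by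
      have e' : π a.2 = π b.1 := by rwa [h.proj_act, h.proj_act] at e
      refine (hq.q_eq_iff _ _ _ _).2 ⟨k, ?_, rfl⟩
      rw [h.div_act_right (by rwa [h.proj_act]), h.div_act_left e', ← h.act_mul, ← h.act_mul,
        ← mul_assoc, mul_inv_cancel_left]
    have h5 := key (rep (q (p₁, p₂))) (rep (q (p₃, p₄)))
    rw [← h1, ← h2, ← h3, ← h4] at h5
    exact h5 e
  have hs' : ContMDiff (𝓡 Q.dim) (𝓡 M.dim) ∞ s := hq.contMDiff_of_comp <| by
    have : (fun z => s (q z)) = fun z => π z.2 := funext fun z => hs z.1 z.2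
    rw [this]; exact h.proj_smooth.comp contMDiff_snd
  have ht' : ContMDiff (𝓡 Q.dim) (𝓡 M.dim) ∞ t := hq.contMDiff_of_comp <| by
    have : (fun z => t (q z)) = fun z => π z.1 := funext fun z => ht z.1 z.2
    rw [this]; exact h.proj_smooth.comp contMDiff_fst
  have hqs : ContMDiff (prodModel P P) (𝓡 Q.dim) ∞ q := hq.subm.contMDiff
  have hex : ∀ x : Q, ∃ p₁ p₂, q (p₁, p₂) = x := fun x => by
    obtain ⟨z, hz⟩ := hq.surj x
    exact ⟨z.1, z.2, hz⟩
  have hss : IsSurjSubmersion s := by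
    refine isSurjSubmersion_of_sections (fun y => ?_) hs' fun x => ?_
    · obtain ⟨p, hp⟩ := h.proj_subm.1 y
      exact ⟨q (p, p), by rw [hs, hp]⟩
    · obtain ⟨p₁, p₂, rfl⟩ := hex x
      obtain ⟨U, hU, hpU, τ, hτ, hτp, hτU⟩ := h.proj_subm.exists_localSection p₂
      rw [hs]
      exact ⟨U, hU, hpU, fun y => q (p₁, τ y),
        hqs.comp_contMDiffOn (contMDiffOn_const.prodMk hτ), by simp only [hτp],
        fun y hy => by rw [hs, hτU y hy]⟩
  have hts : IsSurjSubmersion t := by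
    refine isSurjSubmersion_of_sections (fun y => ?_) ht' fun x => ?_
    · obtain ⟨p, hp⟩ := h.proj_subm.1 y
      exact ⟨q (p, p), by rw [ht, hp]⟩
    · obtain ⟨p₁, p₂, rfl⟩ := hex x
      obtain ⟨U, hU, hpU, τ, hτ, hτp, hτU⟩ := h.proj_subm.exists_localSection p₁
      rw [ht]
      exact ⟨U, hU, hpU, fun y => q (τ y, p₂),
        hqs.comp_contMDiffOn (hτ.prodMk contMDiffOn_const), by simp only [hτp],
        fun y hy => by rw [ht, hτU y hy]⟩
  refine ⟨{ s := s, t := t, one := one, mul := mul, inv := inv, s_subm := hss, t_subm := hts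
            one_smooth := ?_, mul_smooth := ?_, inv_smooth := ?_, s_one := ?_, t_one := ?_
            s_mul := ?_, t_mul := ?_, mul_assoc := ?_, one_mul := ?_, mul_one := ?_, s_inv := ?_
            t_inv := ?_, inv_mul := ?_, mul_inv := ?_ },
    hq.surj, hq.subm, hq.q_eq_iff, ht, hs, hone, fun p₁ p₂ p₃ g => ?_⟩
  · intro x
    obtain ⟨p, rfl⟩ := h.proj_subm.1 x
    obtain ⟨U, hU, hpU, τ, hτ, hτp, hτU⟩ := h.proj_subm.exists_localSection p
    have h1 : ContMDiffOn (𝓡 M.dim) (𝓡 Q.dim) ∞ one U :=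
      (hqs.comp_contMDiffOn (hτ.prodMk hτ)).congr fun y hy => by
        conv_lhs => rw [← hτU y hy, hone]
        rfl
    exact h1.contMDiffAt (hU.mem_nhds hpU)
  -- Local sections of `q` on the two factors send composable arrows to pairs with `π p₂ = π p₃`,
  -- where `div` is smooth.
  · refine contMDiffOn_of_locally_contMDiffOn fun w hw => ?_
    obtain ⟨z₁, hz₁⟩ := hq.surj w.1
    obtain ⟨z₂, hz₂⟩ := hq.surj w.2
    obtain ⟨U₁, hU₁, hzU₁, τ₁, hτ₁, -, hτU₁⟩ := (hq.subm.isSubmersionAt z₁).exists_localSection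
    obtain ⟨U₂, hU₂, hzU₂, τ₂, hτ₂, -, hτU₂⟩ := (hq.subm.isSubmersionAt z₂).exists_localSection
    refine ⟨U₁ ×ˢ U₂, hU₁.prod hU₂, ⟨hz₁ ▸ hzU₁, hz₂ ▸ hzU₂⟩, ?_⟩
    set S := {z : Q × Q | s z.1 = t z.2} ∩ U₁ ×ˢ U₂
    have h1 : ContMDiffOn (prodModel Q Q) (prodModel P P) ∞ (fun z : Q × Q => τ₁ z.1) S :=
      hτ₁.comp contMDiff_fst.contMDiffOn fun z hz => hz.2.1
    have h2 : ContMDiffOn (prodModel Q Q) (prodModel P P) ∞ (fun z : Q × Q => τ₂ z.2) S :=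
      hτ₂.comp contMDiff_snd.contMDiffOn fun z hz => hz.2.2
    have h3 : ∀ z ∈ S, π (τ₁ z.1).2 = π (τ₂ z.2).1 := fun z hz => by
      rw [← hs (τ₁ z.1).1, ← ht _ (τ₂ z.2).2, Prod.mk.eta, Prod.mk.eta, hτU₁ _ hz.2.1,
        hτU₂ _ hz.2.2]
      exact hz.1
    refine (hqs.comp_contMDiffOn ((h.contMDiffOn_act (contMDiff_fst.comp_contMDiffOn h1)
      (h.contMDiffOn_div (contMDiff_snd.comp_contMDiffOn h1) (contMDiff_fst.comp_contMDiffOn h2)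
        h3)).prodMk (contMDiff_snd.comp_contMDiffOn h2))).congr fun z hz => ?_
    have h4 := hmul (τ₁ z.1).1 _ _ (τ₂ z.2).2 (h3 z hz)
    rw [Prod.mk.eta, Prod.mk.eta, hτU₁ _ hz.2.1, hτU₂ _ hz.2.2] at h4
    exact h4
  · refine hq.contMDiff_of_comp ?_
    have : (fun z => inv (q z)) = fun z => q (z.2, z.1) := funext fun z => hinv z.1 z.2
    rw [this]
    exact hqs.comp (contMDiff_snd.prodMk contMDiff_fst)
  · intro x
    obtain ⟨p, rfl⟩ := h.proj_subm.1 x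
    rw [hone, hs]
  · intro x
    obtain ⟨p, rfl⟩ := h.proj_subm.1 x
    rw [hone, ht]
  · intro x y e
    obtain ⟨p₁, p₂, rfl⟩ := hex x
    obtain ⟨p₃, p₄, rfl⟩ := hex y
    rw [hs, ht] at e
    rw [hmul _ _ _ _ e, hs, hs]
  · intro x y e
    obtain ⟨p₁, p₂, rfl⟩ := hex x
    obtain ⟨p₃, p₄, rfl⟩ := hex y
    rw [hs, ht] at e
    rw [hmul _ _ _ _ e, ht, ht, h.proj_act]
  · intro x y w e e'
    obtain ⟨p₁, p₂, rfl⟩ := hex x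
    obtain ⟨p₃, p₄, rfl⟩ := hex y
    obtain ⟨p₅, p₆, rfl⟩ := hex w
    rw [hs, ht] at e e'
    rw [hmul _ _ _ _ e, hmul _ _ _ _ e', hmul _ _ _ _ e', hmul _ _ _ _ (by rw [e, h.proj_act]),
      h.div_act_right e, h.act_mul]
  · intro x
    obtain ⟨p₁, p₂, rfl⟩ := hex x
    rw [ht, hone, hmul _ _ _ _ rfl, h.div_self, h.act_one]
  · intro x
    obtain ⟨p₁, p₂, rfl⟩ := hex x
    rw [hs, hone, hmul _ _ _ _ rfl, h.div_self, h.act_one]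
  · intro x
    obtain ⟨p₁, p₂, rfl⟩ := hex x
    rw [hinv, hs, ht]
  · intro x
    obtain ⟨p₁, p₂, rfl⟩ := hex x
    rw [hinv, hs, ht]
  · intro x
    obtain ⟨p₁, p₂, rfl⟩ := hex x
    rw [hinv, hs, hone, hmul _ _ _ _ rfl, h.div_self, h.act_one]
  · intro x
    obtain ⟨p₁, p₂, rfl⟩ := hex x
    rw [hinv, ht, hone, hmul _ _ _ _ rfl, h.div_self, h.act_one]
  · change mul _ _ = _
    rw [hmul _ _ _ _ (h.proj_act _ _).symm, h.div_act]

/-- Since `q × q` is an open quotient map, it suffices that the orbit relation be closed. Inside the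
closed set of pairs with equal projections, where `div` is continuous, it is the equation `p₁ · div
p₂ p₄ = p₃`. -/
theorem IsGaugeQuotient.t2Space (hq : IsGaugeQuotient act q) (h : IsGroupBundle π act div)
    [T2Space M] [T2Space P] : T2Space Q := by
  have hopen : IsOpenMap q := hq.subm.isOpenMap
  rw [t2_iff_isClosed_diagonal]
  have hqc : IsOpenQuotientMap (Prod.map q q) :=
    have := (⟨hq.surj, hq.subm.contMDiff.continuous, hopen⟩ : IsOpenQuotientMap q)
    this.prodMap this
  rw [← hqc.isQuotientMap.isClosed_preimage]
  let C : Set ((P × P) × (P × P)) := {z | π z.1.1 = π z.2.1 ∧ π z.1.2 = π z.2.2}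
  have hπ := h.proj_smooth.continuous
  have hC : IsClosed C := (isClosed_eq (by fun_prop) (by fun_prop)).inter
    (isClosed_eq (by fun_prop) (by fun_prop))
  have hc : ContinuousOn (fun z : (P × P) × (P × P) => act z.1.1 (div z.1.2 z.2.2)) C := by
    have h1 : ContinuousOn (fun z : (P × P) × (P × P) => div z.1.2 z.2.2) C :=
      h.div_smooth.continuousOn.comp (f := fun z : (P × P) × (P × P) => (z.1.2, z.2.2))
        (by fun_prop) fun z hz => hz.2
    exact h.act_smooth.continuous.comp_continuousOn
      ((continuous_fst.comp continuous_fst).continuousOn.prodMk h1)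
  have hset : Prod.map q q ⁻¹' diagonal Q =
      C ∩ (fun z => (act z.1.1 (div z.1.2 z.2.2), z.2.1)) ⁻¹' diagonal P := by
    ext ⟨⟨p₁, p₂⟩, ⟨p₃, p₄⟩⟩
    change q (p₁, p₂) = q (p₃, p₄) ↔ (π p₁ = π p₃ ∧ π p₂ = π p₄) ∧ act p₁ (div p₂ p₄) = p₃
    rw [hq.q_eq_iff]
    constructor
    · rintro ⟨g, rfl, rfl⟩
      exact ⟨⟨(h.proj_act _ _).symm, (h.proj_act _ _).symm⟩, by rw [h.div_act]⟩
    · rintro ⟨⟨-, h2⟩, h3⟩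
      exact ⟨_, h3.symm, (h.act_div _ _ h2).symm⟩
  rw [hset]
  exact (hc.prodMk (by fun_prop)).preimage_isClosed_of_isClosed hC isClosed_diagonal

end quotient

theorem IsGroupBundle.inv_div {A : Mfd.{u₁}} [Group A] {P : Mfd.{u₂}} {M : Mfd.{u₃}} {π : P → M}
    {act : P → A → P} {div : P → P → A} (h : IsGroupBundle π act div) {p p' : P}
    (e : π p = π p') : (div p p')⁻¹ = div p' p :=
  inv_eq_of_mul_eq_one_right (by rw [h.div_mul_div e e.symm, h.div_self])

/-! ### Local Morita equivalence with the structure group -/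

namespace IsGaugeGroupoid

variable {A : Mfd.{u₁}} [Group A] {P : Mfd.{u₂}} {M : Mfd.{u₃}} {Q : Mfd.{u₄}} {K : LieGroupoid Q M}
  {π : P → M} {act : P → A → P} {div : P → P → A} {q : P × P → Q}

theorem isGaugeQuotient (hK : IsGaugeGroupoid K π act q) : IsGaugeQuotient act q :=
  ⟨hK.surj, hK.subm, hK.q_eq_iff⟩

theorem mul_eq (hK : IsGaugeGroupoid K π act q) (h : IsGroupBundle π act div) {p₁ p₂ p₃ p₄ : P}
    (e : π p₂ = π p₃) : K.mul (q (p₁, p₂)) (q (p₃, p₄)) = q (act p₁ (div p₂ p₃), p₄) := by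
  rw [← hK.mul_q, h.act_div _ _ e]

theorem mul_eq_of_eq (hK : IsGaugeGroupoid K π act q) (h : IsGroupBundle π act div) (p₁ p₂ p₃ : P) :
    K.mul (q (p₁, p₂)) (q (p₂, p₃)) = q (p₁, p₃) := by
  rw [hK.mul_eq h rfl, h.div_self, h.act_one]

theorem inv_eq (hK : IsGaugeGroupoid K π act q) (h : IsGroupBundle π act div) (p₁ p₂ : P) :
    K.inv (q (p₁, p₂)) = q (p₂, p₁) := by
  apply K.inv_eq_of_mul_eq_one
  · rw [hK.s_q, hK.t_q]
  · rw [hK.mul_eq_of_eq h, hK.t_q, hK.one_q]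

/-- Translate a representative diagonally so that its first entry becomes `p`; this makes composable
arrows multiply as `[p, p'] [p', p'']`. -/
theorem exists_eq_left (hK : IsGaugeGroupoid K π act q) (h : IsGroupBundle π act div) {g : Q}
    {p : P} (e : K.t g = π p) : ∃ p', g = q (p, p') := by
  obtain ⟨⟨p₁, p₂⟩, rfl⟩ := hK.surj g
  rw [hK.t_q] at e
  refine ⟨act p₂ (div p₁ p), ?_⟩
  rw [← hK.isGaugeQuotient.act_eq p₁ p₂ (div p₁ p), h.act_div _ _ e]

/-- In local sections `σ` and `τ` near the target and the source, the element `a` with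
`g = [σ a, τ]`. -/
def localArrow (div : P → P → A) (hK : IsGaugeGroupoid K π act q) (σ τ : M → P) (g : Q) : A :=
  div (σ (K.t g)) (surjInv hK.surj g).1 * div (surjInv hK.surj g).2 (τ (K.s g))

/-- A diagonal translation by `k` contributes `k` to the first factor and `k⁻¹` to the second, so
the product does not see the representative. -/
theorem localArrow_q (hK : IsGaugeGroupoid K π act q) (h : IsGroupBundle π act div) {σ τ : M → P}
    {p₁ p₂ : P} (h₁ : π (σ (π p₁)) = π p₁) (h₂ : π (τ (π p₂)) = π p₂) :
    hK.localArrow div σ τ (q (p₁, p₂)) = div (σ (π p₁)) p₁ * div p₂ (τ (π p₂)) := by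
  obtain ⟨k, h3, h4⟩ := (hK.q_eq_iff (surjInv hK.surj (q (p₁, p₂))).1
    (surjInv hK.surj (q (p₁, p₂))).2 p₁ p₂).1 (surjInv_eq hK.surj (q (p₁, p₂)))
  rw [localArrow, hK.t_q, hK.s_q]
  generalize surjInv hK.surj (q (p₁, p₂)) = a at h3 h4
  have h5 : π p₁ = π a.1 := by rw [h3, h.proj_act]
  have h6 : π p₂ = π a.2 := by rw [h4, h.proj_act]
  have h7 := h.div_act_right (h₁.trans h5) k
  have h8 := h.div_act_left (h6.symm.trans h₂.symm) k
  rw [← h3] at h7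
  rw [← h4] at h8
  rw [h7, h8, mul_assoc, mul_inv_cancel_left]

variable [LieGroup (𝓡 A.dim) ∞ A]

theorem contMDiffOn_localArrow (hK : IsGaugeGroupoid K π act q) (h : IsGroupBundle π act div)
    {σ τ : M → P} {U V : Set M}
    (hσ : ContMDiffOn (𝓡 M.dim) (𝓡 P.dim) ∞ σ U) (hσU : ∀ y ∈ U, π (σ y) = y)
    (hτ : ContMDiffOn (𝓡 M.dim) (𝓡 P.dim) ∞ τ V) (hτV : ∀ y ∈ V, π (τ y) = y) :
    ContMDiffOn (𝓡 Q.dim) (𝓡 A.dim) ∞ (hK.localArrow div σ τ) {g | K.s g ∈ V ∧ K.t g ∈ U} := by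
  refine contMDiffOn_of_locally_contMDiffOn fun g hg => ?_
  obtain ⟨z, rfl⟩ := hK.surj g
  obtain ⟨W, hW, hzW, ρ, hρ, -, hρW⟩ := (hK.subm.isSubmersionAt z).exists_localSection
  refine ⟨W, hW, hzW, ?_⟩
  set S := {g | K.s g ∈ V ∧ K.t g ∈ U} ∩ W
  have hρ' := hρ.mono (show S ⊆ W from inter_subset_right)
  have ht : ∀ g ∈ S, π (ρ g).1 = K.t g := fun g hg => by
    rw [← hK.t_q _ (ρ g).2, Prod.mk.eta, hρW _ hg.2]
  have hs : ∀ g ∈ S, π (ρ g).2 = K.s g := fun g hg => by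
    rw [← hK.s_q (ρ g).1 _, Prod.mk.eta, hρW _ hg.2]
  have h1 : ContMDiffOn (𝓡 Q.dim) (𝓡 A.dim) ∞
      (fun g => div (σ (K.t g)) (ρ g).1 * div (ρ g).2 (τ (K.s g))) S := by
    refine ContMDiffOn.mul
      (h.contMDiffOn_div (hσ.comp K.t_smooth.contMDiffOn fun g hg => hg.1.2)
        (contMDiff_fst.comp_contMDiffOn hρ') fun g hg => ?_)
      (h.contMDiffOn_div (contMDiff_snd.comp_contMDiffOn hρ')
        (hτ.comp K.s_smooth.contMDiffOn fun g hg => hg.1.1) fun g hg => ?_)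
    · rw [hσU _ hg.1.2, ht g hg]
    · rw [hτV _ hg.1.1, hs g hg]
  refine h1.congr fun g hg => ?_
  have h2 : π (σ (π (ρ g).1)) = π (ρ g).1 := by rw [ht g hg, hσU _ hg.1.2]
  have h3 : π (τ (π (ρ g).2)) = π (ρ g).2 := by rw [hs g hg, hτV _ hg.1.1]
  conv_lhs => rw [← hρW g hg.2]
  rw [← Prod.mk.eta (p := ρ g), hK.localArrow_q h h2 h3, ht g hg, hs g hg]

/-- The gauge groupoid of a principal bundle is locally Morita equivalent to its structure
group. -/
theorem locallyMoritaEquivalent [Nonempty M] (hK : IsGaugeGroupoid K π act q)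
    (h : IsGroupBundle π act div) :
    LocallyMoritaEquivalent K (LieGroupoid.ofLieGroup A) := by
  have hloc : ∀ m : M, ∃ V : Set M, IsOpen V ∧ m ∈ V ∧ ∃ σ : M → P,
      ContMDiffOn (𝓡 M.dim) (𝓡 P.dim) ∞ σ V ∧ ∀ y ∈ V, π (σ y) = y := fun m => by
    obtain ⟨p, rfl⟩ := h.proj_subm.1 m
    obtain ⟨V, hV, hp, σ, hσ, -, hσV⟩ := h.proj_subm.exists_localSection p
    exact ⟨V, hV, hp, σ, hσ, hσV⟩
  choose V hV hmV σ hσ hσV using hloc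
  obtain ⟨p₀, -⟩ := h.proj_subm.1 (Classical.arbitrary M)
  have hrep : ∀ g : Q, ∀ β, K.t g ∈ V β → ∃ p, g = q (σ β (K.t g), p) ∧ K.s g = π p := by
    intro g β hg
    obtain ⟨p, hp⟩ := hK.exists_eq_left h (hσV β _ hg).symm
    exact ⟨p, hp, by conv_lhs => rw [hp, hK.s_q]⟩
  have harr : ∀ α β (p p' : P), π p ∈ V β → π p' ∈ V α →
      hK.localArrow div (σ β) (σ α) (q (p, p')) = div (σ β (π p)) p * div p' (σ α (π p')) :=
    fun α β p p' hp hp' => hK.localArrow_q h (hσV β _ hp) (hσV α _ hp')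
  -- Indexing the cover by the points of `M` keeps the index type in the universe required by
  -- `LocallyMoritaEquivalent`.
  let D : TrivData M M (LieGroupoid.ofLieGroup A) :=
    { U := V
      mom := fun _ _ => default
      trans := fun α β x => div (σ α x) (σ β x)
      isOpen_U := hV
      cover := fun x => ⟨x, hmV x⟩
      mom_smooth := fun _ => contMDiffOn_const
      trans_smooth := fun α β => h.contMDiffOn_div ((hσ α).mono inter_subset_left)
        ((hσ β).mono inter_subset_right) fun x hx => (hσV α x hx.1).trans (hσV β x hx.2).symm
      t_trans := fun _ _ _ _ _ => rfl
      s_trans := fun _ _ _ _ _ => rfl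
      trans_self := fun α x _ => h.div_self _
      cocycle := fun α β γ x hα hβ hγ => (h.div_mul_div ((hσV α x hα).trans (hσV β x hβ).symm)
        ((hσV β x hβ).trans (hσV γ x hγ).symm)).symm }
  let E : TrivData Unit Mfd.point K :=
    { U := fun _ => univ
      mom := fun _ _ => π p₀
      trans := fun _ _ _ => K.one (π p₀)
      isOpen_U := fun _ => isOpen_univ
      cover := fun _ => ⟨(), trivial⟩
      mom_smooth := fun _ => contMDiffOn_const
      trans_smooth := fun _ _ => contMDiffOn_const
      t_trans := fun _ _ _ _ _ => K.t_one _
      s_trans := fun _ _ _ _ _ => K.s_one _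
      trans_self := fun _ _ _ => rfl
      cocycle := fun _ _ _ _ _ _ _ => by rw [hK.one_q, hK.mul_eq_of_eq h] }
  let Θ : LocGenMor K D :=
    { map := fun β α => hK.localArrow div (σ β) (σ α)
      map_smooth := fun α β =>
        hK.contMDiffOn_localArrow h (hσ β) (hσV β) (hσ α) (hσV α)
      s_map := fun _ _ _ _ _ => rfl
      t_map := fun _ _ _ _ _ => rfl
      map_one := fun α x hx => by
        obtain ⟨p, rfl⟩ := h.proj_subm.1 x
        have h1 := hσV α _ hx
        rw [hK.one_q, harr α α p p hx hx, h.div_mul_div h1 h1.symm, h.div_self]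
        rfl
      map_mul := fun α β γ g₁ g₂ h1 h2 h3 h4 e => by
        obtain ⟨p, hp, hp'⟩ := hrep g₁ γ h2
        obtain ⟨r, rfl⟩ := hK.exists_eq_left h (e.symm.trans hp')
        rw [hK.s_q] at h3
        have h5 := hσV γ _ h2
        have h6 := hσV α _ h3
        have h7 := hσV β (π p) (hp' ▸ h1)
        change hK.localArrow div (σ γ) (σ α) _ =
          hK.localArrow div (σ γ) (σ β) _ * hK.localArrow div (σ β) (σ α) _
        rw [hp] at h2 ⊢
        rw [hK.t_q] at h2
        rw [hK.mul_eq_of_eq h, harr _ _ _ _ h2 h3, harr _ _ _ _ h2 (hp' ▸ h1),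
          harr _ _ _ _ (hp' ▸ h1) h3, mul_assoc, ← mul_assoc (div p _), h.div_mul_div h7.symm h7,
          h.div_self, one_mul]
      map_trans := fun α β γ δ g hα hβ hγ hδ => by
        obtain ⟨⟨p₁, p₂⟩, rfl⟩ := hK.surj g
        rw [hK.s_q] at hα hγ
        rw [hK.t_q] at hβ hδ
        change hK.localArrow div (σ β) (σ α) _ = div (σ β (K.t (q (p₁, p₂)))) _ *
          hK.localArrow div (σ δ) (σ γ) _ * div _ _
        have e1 := hσV β _ hβ
        have e2 := hσV δ _ hδ
        have e3 := hσV α _ hα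
        have e4 := hσV γ _ hγ
        rw [harr _ _ _ _ hβ hα, harr _ _ _ _ hδ hγ, hK.t_q, hK.s_q, ← mul_assoc,
          h.div_mul_div (e1.trans e2.symm) e2, mul_assoc, h.div_mul_div e4.symm (e4.trans e3.symm)] }
  -- The identification of the group with the isotropy group at `π p₀`.
  let Η : LocGenMor (LieGroupoid.ofLieGroup A) E :=
    { map := fun _ _ a => q (act p₀ a, p₀)
      map_smooth := fun _ _ => hK.subm.contMDiff.comp_contMDiffOn
        ((h.contMDiffOn_act contMDiffOn_const contMDiffOn_id).prodMk contMDiffOn_const)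
      s_map := fun _ _ _ _ _ => hK.s_q _ _
      t_map := fun _ _ _ _ _ => (hK.t_q _ _).trans (h.proj_act _ _)
      map_one := fun _ _ _ => by
        change q (act p₀ 1, p₀) = K.one (π p₀)
        rw [h.act_one, hK.one_q]
      map_mul := fun _ _ _ a b _ _ _ _ _ => by
        change q (act p₀ (a * b), p₀) = _
        rw [hK.mul_q, h.act_mul]
      map_trans := fun _ _ _ _ a _ _ _ _ => by
        have h1 : K.t (q (act p₀ a, p₀)) = π p₀ := (hK.t_q _ _).trans (h.proj_act _ _)
        have h2 := K.one_mul (q (act p₀ a, p₀))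
        have h3 := K.mul_one (q (act p₀ a, p₀))
        rw [h1] at h2
        rw [hK.s_q] at h3
        change _ = K.mul (K.mul (K.one (π p₀)) _) (K.one (π p₀))
        rw [h2, h3] }
  refine ⟨M, Unit, D, E, Θ, Η, ⟨?_⟩⟩
  exact
    { R :=
        { U := fun a => V a.1
          isOpen_U := fun a => hV a.1
          cover := fun x => ⟨(x, ()), hmV x⟩
          subset := fun _ _ hx => hx
          mapsTo := fun _ _ _ => trivial }
      S :=
        -- Each of these sets is all of the one-point space or empty, according to whether `π p₀`
        -- lies in `V a.2`.
        { U := fun a => {_y | π p₀ ∈ V a.2}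
          isOpen_U := fun a => isOpen_const
          cover := fun _ => ⟨((), π p₀), hmV _⟩
          subset := fun _ _ _ => trivial
          mapsTo := fun _ _ hx => hx }
      -- The arrow from `π p₀` to `x` represented by the local section; below, `Ψ` measures the
      -- position of the local section at `π p₀` relative to `p₀`.
      Φ := fun a x => q (σ a.1 x, p₀)
      Ψ := fun a _ => div p₀ (σ a.2 (π p₀))
      Φ_smooth := fun a => hK.subm.contMDiff.comp_contMDiffOn ((hσ a.1).prodMk contMDiffOn_const)
      Ψ_smooth := fun _ => contMDiffOn_const
      t_Φ := fun a x hx => (hK.t_q _ _).trans (hσV a.1 x hx)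
      s_Φ := fun _ _ _ => hK.s_q _ _
      t_Ψ := fun _ _ _ => Subsingleton.elim _ _
      s_Ψ := fun _ _ _ => rfl
      Φ_trans := fun a b x ha hb => by
        change q (σ a.1 x, p₀) = K.mul (q (σ b.1 x, p₀)) (q (act p₀ (div (σ b.1 x) (σ a.1 x)), p₀))
        rw [hK.mul_q, h.act_div _ _ ((hσV _ x hb).trans (hσV _ x ha).symm)]
      Ψ_trans := fun a b y ha hb => by
        have e1 := hσV a.2 _ ha
        have e2 := hσV b.2 _ hb
        change div p₀ _ = div p₀ _ * hK.localArrow div (σ b.2) (σ a.2) (K.one (π p₀))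
        rw [hK.one_q, harr _ _ _ _ hb ha, ← mul_assoc, h.div_mul_div e2.symm e2, h.div_self,
          one_mul]
      comp_eq := fun a b g ha hb => by
        -- With the representative of `g` starting on the section `σ b.1`, the left factor of the
        -- local arrow is trivial and only its source end contributes.
        obtain ⟨p, hp, hp'⟩ := hrep g b.1 hb
        have e1 := hσV a.1 _ ha
        have e2 := hσV b.1 _ hb
        have hb' : π (σ b.1 (K.t g)) ∈ V b.1 := e2.symm ▸ hb
        change q (act p₀ (hK.localArrow div (σ b.1) (σ a.1) g), p₀) =
          K.mul (K.mul (K.inv (q (σ b.1 (K.t g), p₀))) g) (q (σ a.1 (K.s g), p₀))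
        have h1 : hK.localArrow div (σ b.1) (σ a.1) g = div p (σ a.1 (K.s g)) := by
          conv_lhs => rw [hp]
          rw [harr _ _ _ _ hb' (hp' ▸ ha), e2, h.div_self, one_mul, hp']
        have h2 : K.mul (q (p₀, σ b.1 (K.t g))) g = q (p₀, p) :=
          (congrArg (K.mul _) hp).trans (hK.mul_eq_of_eq h _ _ _)
        rw [h1, hK.inv_eq h, h2, hK.mul_eq h (hp'.symm.trans e1.symm)]
      comp_eq' := fun a b k ha hb => by
        have e1 := hσV a.2 _ ha
        have e2 := hσV b.2 _ hb
        have hb' : π (act p₀ k) ∈ V b.2 := (h.proj_act p₀ k).symm ▸ hb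
        change hK.localArrow div (σ b.2) (σ a.2) (q (act p₀ k, p₀)) =
          (div p₀ (σ b.2 (π p₀)))⁻¹ * k * div p₀ (σ a.2 (π p₀))
        rw [harr _ _ _ _ hb' ha, h.proj_act, h.div_act_right e2, h.inv_div e2.symm] }

end IsGaugeGroupoid

end

theorem mainTheorem12 :
    (∀ {ι : Type u₁} {κ : Type u₂} {A : Mfd.{u₃}} {X : Mfd.{u₄}} {B : Mfd.{u₅}} {Y : Mfd.{u₆}}
      (G : LieGroupoid A X) (H : LieGroupoid B Y)
      (D : TrivData ι X H) (E : TrivData κ Y G)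
      (Θ : LocGenMor G D) (Η : LocGenMor H E),
      LocalMoritaEquivalence Θ Η →
      -- the bundle of `Θ` is a Morita equivalence from `G` to `H`
      ((∃ σ, D.IsGluedStructure σ) ∧
        ∀ σ, D.IsGluedStructure σ →
          IsMoritaEquivalence G H (D.total σ) D.proj D.momentum Θ.actL D.actR ∧
          (T2Space X → T2Space B → T2Space (D.total σ)) ∧
          (SecondCountableTopology X → SecondCountableTopology B →
            SecondCountableTopology (D.total σ))) ∧
      -- the bundle of `Η` is a Morita equivalence from `H` to `G`
      ((∃ σ, E.IsGluedStructure σ) ∧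
        ∀ σ, E.IsGluedStructure σ →
          IsMoritaEquivalence H G (E.total σ) E.proj E.momentum Η.actL E.actR ∧
          (T2Space Y → T2Space A → T2Space (E.total σ)) ∧
          (SecondCountableTopology Y → SecondCountableTopology A →
            SecondCountableTopology (E.total σ)))) ∧
    -- the gauge groupoid of a principal bundle is locally Morita equivalent to the structure group
    (∀ (A : Mfd.{u₁}) [Group A] [LieGroup (𝓡 A.dim) ∞ A] (P : Mfd.{u₂}) (M : Mfd.{u₃}) [Nonempty M]
      (π : P → M) (act : P → A → P),
      IsRightPrincipal (LieGroupoid.ofLieGroup A) P M π (fun _ => default) act →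
      (∃ (Q : Mfd.{u₂}) (K : LieGroupoid Q M) (q : P × P → Q), IsGaugeGroupoid K π act q) ∧
      ∀ (Q : Mfd.{u₄}) (K : LieGroupoid Q M) (q : P × P → Q), IsGaugeGroupoid K π act q →
        LocallyMoritaEquivalent K (LieGroupoid.ofLieGroup A) ∧
        (T2Space M → T2Space P → T2Space Q) ∧
        (SecondCountableTopology P → SecondCountableTopology Q)) := by
  refine ⟨fun G H D E Θ Η L => ⟨⟨D.exists_isGluedStructure, fun σ hσ =>
    ⟨L.isMoritaEquivalence hσ, fun _ _ => hσ.t2Space, fun _ _ => hσ.secondCountableTopology⟩⟩,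
    ⟨E.exists_isGluedStructure, fun σ hσ => ⟨L.symm.isMoritaEquivalence hσ,
      fun _ _ => hσ.t2Space, fun _ _ => hσ.secondCountableTopology⟩⟩⟩, ?_⟩
  intro A _ _ P M _ π act hP
  obtain ⟨div, h⟩ := hP.exists_isGroupBundle
  refine ⟨?_, fun Q K q hK => ⟨hK.locallyMoritaEquivalent h,
    fun _ _ => hK.isGaugeQuotient.t2Space h,
    fun _ => hK.isGaugeQuotient.secondCountableTopology⟩⟩
  obtain ⟨Q, q, hq⟩ := h.exists_isGaugeQuotient
  obtain ⟨K, hK⟩ := hq.exists_gaugeGroupoid h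
  exact ⟨Q, K, q, hK⟩
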